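/- **Proposition 3.3 (modified Maxwell equations).** Let $M>0$ and $|a|\le M$, and put $r_\pm=M\pm\sqrt{M^2-a^2}$, $\Delta=(r-r_+)(r-r_-)$, $\Sigma=r^2+a^2\cos^2\theta$. Let $(\mathcal M,g)$ be the Kerr exterior manifold $\mathcal M=\mathbb R_{\bar t}\times[r_+,\infty)_{r}\times\mathbb S^2_{(\theta,\bar\phi)}$ (including the event horizon $r=r_+$) with the metric $$g=-\Big(1-\frac{2Mr}{\Sigma}\Big)d\bar t^2+2\,d\bar t\,dr+\Sigma\,d\theta^2+\frac{(r^2+a^2)^2-\Delta a^2\sin^2\theta}{\Sigma}\sin^2\theta\,d\bar\phi^2-2a\sin^2\theta\,dr\,d\bar\phi-\frac{4aMr}{\Sigma}\sin^2\theta\,d\bar t\,d\bar\phi ,$$ extended smoothly across the axis, and let $\nabla$ be its Levi-Civita connection. Let $$e_3=-\partial_r,\qquad e_4=\frac{2(r^2+a^2)}{\Sigma}\partial_{\bar t}+\frac{\Delta}{\Sigma}\partial_r+\frac{2a}{\Sigma}\partial_{\bar\phi}$$ be the algebraically special null vector fields (in the coordinates $(\bar t,r,\theta,\bar\phi)$),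 so that $g(e_3,e_4)=-2$, and let $\mathfrak D=\langle e_3,e_4\rangle^\perp$ be the horizontal distribution, with induced metric $\slashed g$ and induced volume form $\slashed\varepsilon(X,Y)=\frac12\mathrm{vol}_g(X,Y,e_3,e_4)$, where $\mathcal M$ is oriented by $d\bar t\wedge dr\wedge d\theta\wedge d\bar\phi$. Capital indices $A,B,C$ refer to a local frame of $\mathfrak D$, and horizontal indices are raised with $\slashed g^{-1}$. Let $\slashed\nabla$ be the connection on $\mathfrak D$ induced by $\nabla$ (horizontal projection); on functions, $\slashed\nabla_3=e_3$, $\slashed\nabla_4=e_4$ and $\slashed\nabla f=df|_{\mathfrak D}$. For $\mathfrak D$ one-forms $\varsigma$ put $\slashed{\mathrm{div}}\,\varsigma=\slashed g^{AB}(\slashed\nabla_A\varsigma)_B$, $\slashed{\mathrm{curl}}\,\varsigma=\slashed\varepsilon^{AB}(\slashed\nabla_A\varsigma)_B$, ${}^\star\varsigma_A=\slashed\varepsilon_{AC}\slashed g^{CB}\varsigma_B$. Let $\chi_{AB}=g(\nabla_{e_A}e_4,e_B)$, $\underline\chi_{AB}=g(\nabla_{e_A}e_3,e_B)$, $\hat\omega=\frac12g(\nabla_{e_4}e_3,e_4)$,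 $\mathrm{tr}\underline\chi=\slashed g^{AB}\underline\chi_{AB}$, $(\slashed\varepsilon\cdot\underline\chi)=\slashed\varepsilon^{AB}\underline\chi_{AB}$, and $(\chi^{\sharp_2}\cdot\varsigma)_A=\slashed g^{BC}\chi_{AC}\varsigma_B$, similarly for $\underline\chi$. Let $F$ be a smooth two-form on $\mathcal M$, with components $\alpha(e_A)=F(e_A,e_4)$, $\underline\alpha(e_A)=F(e_A,e_3)$, $\rho=\frac12F(e_3,e_4)$, $\sigma=\frac12\slashed\varepsilon^{AB}F(e_A,e_B)$, and set $$\widehat\rho=(r^2-a^2\cos^2\theta)\rho-2ar\cos\theta\,\sigma,\qquad \widehat\sigma=2ar\cos\theta\,\rho+(r^2-a^2\cos^2\theta)\sigma,$$ $$\mathfrak T(\alpha)=\tfrac12\Sigma(\slashed\nabla_3\alpha+\underline\chi^{\sharp_2}\cdot\alpha),\qquad \underline{\mathfrak T}(\underline\alpha)=\tfrac12\Sigma(\slashed\nabla_4\underline\alpha+\chi^{\sharp_2}\cdot\underline\alpha+\hat\omega\,\underline\alpha).$$ Then, on $\mathcal M$, $$\widehat\rho=\tfrac14\Sigma[(\mathrm{tr}\underline\chi)^2-(\slashed\varepsilon\cdot\underline\chi)^2]\Sigma\rho+\tfrac12\Sigma(\slashed\varepsilon\cdot\underline\chi)(\mathrm{tr}\underline\chi)\Sigma\sigma,\qquad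 \widehat\sigma=-\tfrac12\Sigma(\slashed\varepsilon\cdot\underline\chi)(\mathrm{tr}\underline\chi)\Sigma\rho+\tfrac14\Sigma[(\mathrm{tr}\underline\chi)^2-(\slashed\varepsilon\cdot\underline\chi)^2]\Sigma\sigma,$$ and $F$ satisfies the source-free Maxwell equations $\nabla_{[I}F_{JK]}=0$, $g^{JK}(\nabla_JF)_{KI}=0$ on $\mathcal M$ if and only if the following identities hold on $\mathcal M$: \begin{align*} \slashed\nabla_3\widehat\sigma&=\tfrac12\Sigma^2(\slashed\varepsilon\cdot\underline\chi)(\mathrm{tr}\underline\chi)\,\slashed{\mathrm{div}}\,\underline\alpha-\tfrac14\Sigma^2[(\mathrm{tr}\underline\chi)^2-(\slashed\varepsilon\cdot\underline\chi)^2]\,\slashed{\mathrm{curl}}\,\underline\alpha,\\ \slashed\nabla_3\widehat\rho&=-\tfrac14\Sigma^2[(\mathrm{tr}\underline\chi)^2-(\slashed\varepsilon\cdot\underline\chi)^2]\,\slashed{\mathrm{div}}\,\underline\alpha-\tfrac12\Sigma^2(\slashed\varepsilon\cdot\underline\chi)(\mathrm{tr}\underline\chi)\,\slashed{\mathrm{curl}}\,\underline\alpha,\\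 \slashed\nabla_4\widehat\sigma&=-\tfrac12\Sigma(\slashed\varepsilon\cdot\underline\chi)(\mathrm{tr}\underline\chi)\,\slashed{\mathrm{div}}(\Sigma\alpha)-\tfrac14\Sigma[(\mathrm{tr}\underline\chi)^2-(\slashed\varepsilon\cdot\underline\chi)^2]\,\slashed{\mathrm{curl}}(\Sigma\alpha),\\ \slashed\nabla_4\widehat\rho&=\tfrac14\Sigma[(\mathrm{tr}\underline\chi)^2-(\slashed\varepsilon\cdot\underline\chi)^2]\,\slashed{\mathrm{div}}(\Sigma\alpha)-\tfrac12\Sigma(\slashed\varepsilon\cdot\underline\chi)(\mathrm{tr}\underline\chi)\,\slashed{\mathrm{curl}}(\Sigma\alpha),\\ \slashed\nabla\widehat\sigma&=-\tfrac12\Sigma(\slashed\varepsilon\cdot\underline\chi)(\mathrm{tr}\underline\chi)\,(\mathfrak T(\alpha)-\underline{\mathfrak T}(\underline\alpha))-\tfrac14\Sigma[(\mathrm{tr}\underline\chi)^2-(\slashed\varepsilon\cdot\underline\chi)^2]\,({}^\star\mathfrak T(\alpha)+{}^\star\underline{\mathfrak T}(\underline\alpha)),\\ \slashed\nabla\widehat\rho&=\tfrac14\Sigma[(\mathrm{tr}\underline\chi)^2-(\slashed\varepsilon\cdot\underline\chi)^2]\,(\mathfrak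 T(\alpha)-\underline{\mathfrak T}(\underline\alpha))-\tfrac12\Sigma(\slashed\varepsilon\cdot\underline\chi)(\mathrm{tr}\underline\chi)\,({}^\star\mathfrak T(\alpha)+{}^\star\underline{\mathfrak T}(\underline\alpha)). \end{align*} In particular, all first derivatives of $\widehat\rho$ and of $\widehat\sigma$ are given solely by $\alpha$, $\underline\alpha$ and their first derivatives, and the equations for $\widehat\rho$ and for $\widehat\sigma$ are decoupled from each other. -/

import Mathlib

open scoped ContDiff

/-! The Kerr exterior `ℝ × [r₊, ∞) × S²` is covered by the single global chart
`(t̄, r̄, ω) ↦ (t̄, x) = (t̄, r̄ ω) ∈ ℝ × ℝ³`, with image `{(t̄, x) : r₊ ≤ |x|}`; here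
`(t̄, r̄, θ̄, φ̄)` are (ingoing) Kerr coordinates. All tensors are written through their components
in this chart, which is regular on the axis and at the event horizon. Tensors over the horizontal
distribution `𝔇 = ⟨e₃, e₄⟩^⊥` are represented by their canonical extensions to spacetime tensors,
which vanish as soon as `e₃` or `e₄` is inserted in one of the slots. -/

noncomputable section

namespace Kerr

/-- A point `(t̄, x¹, x², x³)`. -/
abbrev Point := Fin 4 → ℝ

/-- Components, in the global chart, of a field of vectors or covectors. -/
abbrev Field₁ := Point → Fin 4 → ℝ

/-- Components, in the global chart, of a field of two-tensors. -/
abbrev Field₂ := Point → Matrix (Fin 4) (Fin 4) ℝ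

/-! ### The Kerr exterior manifold -/

/-- The radial coordinate `r = |x|`. -/
def rad (p : Point) : ℝ := √(p 1 ^ 2 + p 2 ^ 2 + p 3 ^ 2)

/-- The function `cos θ`. -/
def cosθ (p : Point) : ℝ := p 3 / rad p

/-- The radius of the event horizon. -/
def rPlus (M a : ℝ) : ℝ := M + √(M ^ 2 - a ^ 2)

/-- The constant `r₋`. -/
def rMinus (M a : ℝ) : ℝ := M - √(M ^ 2 - a ^ 2)

/-- The function `Δ`. -/
def Del (M a : ℝ) (p : Point) : ℝ := (rad p - rPlus M a) * (rad p - rMinus M a)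

/-- The function `Σ = r² + a² cos² θ`. -/
def Sig (a : ℝ) (p : Point) : ℝ := rad p ^ 2 + a ^ 2 * cosθ p ^ 2

/-- The Kerr exterior, including its boundary, the event horizon. -/
def exterior (M a : ℝ) : Set Point := {p | rPlus M a ≤ rad p}

/-- The one-form `dt̄`. -/
def dt : Field₁ := fun _ => ![1, 0, 0, 0]

/-- The one-form `dr`. -/
def dr : Field₁ := fun p => ![0, p 1 / rad p, p 2 / rad p, p 3 / rad p]

/-- The one-form `sin² θ dφ̄`. -/
def sinSqdφ : Field₁ := fun p => ![0, -p 2 / rad p ^ 2, p 1 / rad p ^ 2, 0]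

/-- The round metric `dθ² + sin² θ dφ̄²` of the unit sphere, which is `(|dx|² - dr²) / r²`. -/
def roundMetric : Field₂ := fun p =>
  Matrix.of fun μ ν => ((if μ = ν ∧ μ ≠ 0 then 1 else 0) - dr p μ * dr p ν) / rad p ^ 2

/-- The Kerr metric. In Kerr coordinates it is
`-(1 - 2Mr/Σ) dt² + 2 dt dr + Σ dθ² + ((r²+a²)² - Δ a² sin²θ)/Σ sin²θ dφ² - 2a sin²θ dr dφ
  - 4aMr/Σ sin²θ dt dφ`, see `metric_kerr_coordinates`. -/
def metric (M a : ℝ) : Field₂ := fun p => Matrix.of fun μ ν =>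
  -(1 - 2 * M * rad p / Sig a p) * (dt p μ * dt p ν)
    + (dt p μ * dr p ν + dr p μ * dt p ν)
    + Sig a p * roundMetric p μ ν
    + a ^ 2 * (1 + 2 * M * rad p / Sig a p) * (sinSqdφ p μ * sinSqdφ p ν)
    - a * (dr p μ * sinSqdφ p ν + sinSqdφ p μ * dr p ν)
    - 2 * a * M * rad p / Sig a p * (dt p μ * sinSqdφ p ν + sinSqdφ p μ * dt p ν)

/-- The point with Kerr coordinates `(t, r, θ, φ)`. -/
def kerrPoint (t r θ φ : ℝ) : Point :=
  ![t, r * Real.sin θ * Real.cos φ, r * Real.sin θ * Real.sin φ, r * Real.cos θ]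

/-- The vector `t' ∂_t + r' ∂_r + θ' ∂_θ + φ' ∂_φ` at the point with coordinates `(t, r, θ, φ)`. -/
def kerrVector (r θ φ t' r' θ' φ' : ℝ) : Fin 4 → ℝ :=
  ![t',
    r' * Real.sin θ * Real.cos φ + θ' * r * Real.cos θ * Real.cos φ
      - φ' * r * Real.sin θ * Real.sin φ,
    r' * Real.sin θ * Real.sin φ + θ' * r * Real.cos θ * Real.sin φ
      + φ' * r * Real.sin θ * Real.cos φ,
    r' * Real.cos θ - θ' * r * Real.sin θ]

/-- The metric in Kerr coordinates. -/
theorem metric_kerr_coordinates (M a t r θ φ t' r' θ' φ' : ℝ) (ha : |a| ≤ M) (hr : 0 < r) :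
    (∑ μ, ∑ ν, metric M a (kerrPoint t r θ φ) μ ν
        * kerrVector r θ φ t' r' θ' φ' μ * kerrVector r θ φ t' r' θ' φ' ν) =
      -(1 - 2 * M * r / (r ^ 2 + a ^ 2 * Real.cos θ ^ 2)) * t' ^ 2 + 2 * t' * r'
        + (r ^ 2 + a ^ 2 * Real.cos θ ^ 2) * θ' ^ 2
        + ((r ^ 2 + a ^ 2) ^ 2
              - (r - rPlus M a) * (r - rMinus M a) * a ^ 2 * Real.sin θ ^ 2)
            / (r ^ 2 + a ^ 2 * Real.cos θ ^ 2) * Real.sin θ ^ 2 * φ' ^ 2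
        - 2 * a * Real.sin θ ^ 2 * r' * φ'
        - 4 * a * M * r / (r ^ 2 + a ^ 2 * Real.cos θ ^ 2) * Real.sin θ ^ 2 * t' * φ' := by
  have hrad : rad (kerrPoint t r θ φ) = r := by
    have h : (r * Real.sin θ * Real.cos φ) ^ 2 + (r * Real.sin θ * Real.sin φ) ^ 2
        + (r * Real.cos θ) ^ 2 = r ^ 2 := by
      linear_combination (r ^ 2 * Real.sin θ ^ 2) * Real.sin_sq_add_cos_sq φ
        + r ^ 2 * Real.sin_sq_add_cos_sq θ
    simp only [rad, kerrPoint, Matrix.cons_val]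
    rw [h, Real.sqrt_sq hr.le]
  have hcos : cosθ (kerrPoint t r θ φ) = Real.cos θ := by
    rw [cosθ, hrad]
    simp only [kerrPoint, Matrix.cons_val]
    field_simp
  have hD : (r - rPlus M a) * (r - rMinus M a) = r ^ 2 - 2 * M * r + a ^ 2 := by
    have h0 : 0 ≤ M ^ 2 - a ^ 2 := by nlinarith [abs_nonneg a, sq_abs a]
    have := Real.sq_sqrt h0
    simp only [rPlus, rMinus]
    linear_combination -this
  have hS : Sig a (kerrPoint t r θ φ) = r ^ 2 + a ^ 2 * Real.cos θ ^ 2 := by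
    rw [Sig, hrad, hcos]
  have hS0 : 0 < r ^ 2 + a ^ 2 * Real.cos θ ^ 2 := by positivity
  set S := r ^ 2 + a ^ 2 * Real.cos θ ^ 2 with hSdef
  set V := kerrVector r θ φ t' r' θ' φ' with hV
  have hr0 : r ≠ 0 := hr.ne'
  have s1 := Real.sin_sq_add_cos_sq θ
  have s2 := Real.sin_sq_add_cos_sq φ
  have d1 : ∑ μ, dt (kerrPoint t r θ φ) μ * V μ = t' := by
    simp [Fin.sum_univ_four, dt, hV, kerrVector]
  have d2 : ∑ μ, dr (kerrPoint t r θ φ) μ * V μ = r' := by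
    simp only [dr, hrad]
    simp only [Fin.sum_univ_four, hV, kerrVector, kerrPoint, Matrix.cons_val]
    field_simp
    linear_combination (r' * Real.sin θ ^ 2 + θ' * r * Real.sin θ * Real.cos θ) * s2 + r' * s1
  have d3 : ∑ μ, sinSqdφ (kerrPoint t r θ φ) μ * V μ = Real.sin θ ^ 2 * φ' := by
    simp only [sinSqdφ, hrad]
    simp only [Fin.sum_univ_four, hV, kerrVector, kerrPoint, Matrix.cons_val]
    field_simp
    linear_combination (r * φ' * Real.sin θ ^ 2) * s2
  have d4 : V 1 ^ 2 + V 2 ^ 2 + V 3 ^ 2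
      = r' ^ 2 + r ^ 2 * θ' ^ 2 + r ^ 2 * Real.sin θ ^ 2 * φ' ^ 2 := by
    simp only [hV, kerrVector, Matrix.cons_val]
    linear_combination ((r' * Real.sin θ + θ' * r * Real.cos θ) ^ 2
      + φ' ^ 2 * r ^ 2 * Real.sin θ ^ 2) * s2 + (r' ^ 2 + θ' ^ 2 * r ^ 2) * s1
  have key : (∑ μ, ∑ ν, metric M a (kerrPoint t r θ φ) μ ν * V μ * V ν) =
      -(1 - 2 * M * r / S) * (∑ μ, dt (kerrPoint t r θ φ) μ * V μ) ^ 2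
      + 2 * (∑ μ, dt (kerrPoint t r θ φ) μ * V μ) * (∑ μ, dr (kerrPoint t r θ φ) μ * V μ)
      + S * ((V 1 ^ 2 + V 2 ^ 2 + V 3 ^ 2
          - (∑ μ, dr (kerrPoint t r θ φ) μ * V μ) ^ 2) / r ^ 2)
      + a ^ 2 * (1 + 2 * M * r / S) * (∑ μ, sinSqdφ (kerrPoint t r θ φ) μ * V μ) ^ 2
      - 2 * a * (∑ μ, dr (kerrPoint t r θ φ) μ * V μ)
        * (∑ μ, sinSqdφ (kerrPoint t r θ φ) μ * V μ)
      - 4 * a * M * r / S * (∑ μ, dt (kerrPoint t r θ φ) μ * V μ)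
        * (∑ μ, sinSqdφ (kerrPoint t r θ φ) μ * V μ) := by
    simp only [metric, roundMetric, Matrix.of_apply, hrad, hS, Fin.sum_univ_four]
    simp
    ring
  rw [key, d1, d2, d3, d4, hD]
  have hsin : Real.sin θ ^ 2 = 1 - Real.cos θ ^ 2 := by linear_combination s1
  rw [hsin]
  clear_value V
  clear key d1 d2 d3 d4 hsin
  field_simp
  rw [hSdef]
  ring

/-- Lowering an index with the metric. -/
def lower (M a : ℝ) (X : Field₁) : Field₁ := fun p μ => ∑ ν, metric M a p μ ν * X p ν

/-- The inverse metric. -/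
def metricInv (M a : ℝ) : Field₂ := fun p => (metric M a p)⁻¹

/-- The partial derivative `∂_μ f` on the exterior (one-sided at the event horizon). -/
def pd (M a : ℝ) (f : Point → ℝ) (μ : Fin 4) (p : Point) : ℝ :=
  fderivWithin ℝ f (exterior M a) p (Pi.single μ 1)

/-! ### The Levi-Civita connection -/

/-- The Christoffel symbol `Γ^κ_{μν}` of the Kerr metric. -/
def christoffel (M a : ℝ) (p : Point) (κ μ ν : Fin 4) : ℝ :=
  1 / 2 * ∑ l, metricInv M a p κ l *
    (pd M a (fun q => metric M a q l ν) μ p + pd M a (fun q => metric M a q l μ) ν p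
      - pd M a (fun q => metric M a q μ ν) l p)

/-- The component `(∇_μ Y)^ν` for a vector field `Y`. -/
def covVector (M a : ℝ) (Y : Field₁) (p : Point) (μ ν : Fin 4) : ℝ :=
  pd M a (fun q => Y q ν) μ p + ∑ κ, christoffel M a p ν μ κ * Y p κ

/-- The component `(∇_μ ς)_ν` for a one-form `ς`. -/
def covForm (M a : ℝ) (s : Field₁) (p : Point) (μ ν : Fin 4) : ℝ :=
  pd M a (fun q => s q ν) μ p - ∑ κ, christoffel M a p κ μ ν * s p κ

/-- The component `(∇_μ F)_{νl}` for a covariant two-tensor `F`. -/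
def covTwo (M a : ℝ) (F : Field₂) (p : Point) (μ ν l : Fin 4) : ℝ :=
  pd M a (fun q => F q ν l) μ p
    - ∑ κ, (christoffel M a p κ μ ν * F p κ l + christoffel M a p κ μ l * F p ν κ)

/-! ### The algebraically special frame and the horizontal distribution -/

/-- The null vector field `e₃`. In Boyer–Lindquist coordinates it is
`(r²+a²)/Δ ∂_t - ∂_r + a/Δ ∂_φ`; since the Boyer–Lindquist `∂_r` is
`∂_r̄ + (r²+a²)/Δ ∂_t̄ + a/Δ ∂_φ̄` in Kerr coordinates, this is `-∂_r̄`. -/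
def e3 : Field₁ := fun p => ![0, -(p 1 / rad p), -(p 2 / rad p), -(p 3 / rad p)]

/-- The null vector field `e₄`. In Boyer–Lindquist coordinates it is
`(r²+a²)/Σ ∂_t + Δ/Σ ∂_r + a/Σ ∂_φ`, hence
`2(r²+a²)/Σ ∂_t̄ + Δ/Σ ∂_r̄ + 2a/Σ ∂_φ̄` in Kerr coordinates. -/
def e4 (M a : ℝ) : Field₁ := fun p =>
  (2 * (rad p ^ 2 + a ^ 2) / Sig a p) • ![1, 0, 0, 0]
    + (Del M a p / Sig a p) • ![0, p 1 / rad p, p 2 / rad p, p 3 / rad p]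
    + (2 * a / Sig a p) • ![0, -p 2, p 1, 0]

/-- The `g`-orthogonal projection `X ↦ X + ½ g(X, e₄) e₃ + ½ g(X, e₃) e₄` onto the horizontal
distribution; `proj M a p μ ν` has upper index `μ` and lower index `ν`. -/
def proj (M a : ℝ) : Field₂ := fun p => Matrix.of fun μ ν =>
  (if μ = ν then 1 else 0)
    + 1 / 2 * (e3 p μ * lower M a (e4 M a) p ν + e4 M a p μ * lower M a e3 p ν)

/-- The inverse induced metric on the horizontal distribution, with upper indices. -/
def hInv (M a : ℝ) : Field₂ := fun p => Matrix.of fun μ ν =>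
  metricInv M a p μ ν + 1 / 2 * (e3 p μ * e4 M a p ν + e4 M a p μ * e3 p ν)

/-- The horizontal volume form `ε(X, Y) = ½ vol_g(X, Y, e₃, e₄)`, where `vol_g` is the volume form
of the Kerr metric for the orientation `dt̄ ∧ dx¹ ∧ dx² ∧ dx³`; lower indices. -/
def hVol (M a : ℝ) : Field₂ := fun p => Matrix.of fun μ ν =>
  1 / 2 * (√|(metric M a p).det| *
    (Matrix.of ![Pi.single μ 1, Pi.single ν 1, e3 p, e4 M a p]).det)

/-- The horizontal volume form with upper indices. -/
def hVolUp (M a : ℝ) : Field₂ := fun p => Matrix.of fun μ ν =>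
  ∑ κ, ∑ l, hInv M a p μ κ * hInv M a p ν l * hVol M a p κ l

/-! ### Connection coefficients -/

/-- The second fundamental form `(X, Y) ↦ g(∇_X e, Y)`, with `X`, `Y` horizontal. -/
def secondForm (M a : ℝ) (e : Field₁) : Field₂ := fun p => Matrix.of fun μ ν =>
  ∑ κ, ∑ l, ∑ i, proj M a p κ μ * proj M a p l ν * metric M a p l i * covVector M a e p κ i

/-- `χ(X, Y) = g(∇_X e₄, Y)`. -/
def chi (M a : ℝ) : Field₂ := secondForm M a (e4 M a)

/-- `χ̲(X, Y) = g(∇_X e₃, Y)`. -/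
def chiBar (M a : ℝ) : Field₂ := secondForm M a e3

/-- The trace of a horizontal covariant two-tensor. -/
def hTr (M a : ℝ) (T : Field₂) (p : Point) : ℝ := ∑ μ, ∑ ν, hInv M a p μ ν * T p μ ν

/-- The antitrace `ε · T = ε^{AB} T_{AB}` of a horizontal covariant two-tensor. -/
def hAtr (M a : ℝ) (T : Field₂) (p : Point) : ℝ := ∑ μ, ∑ ν, hVolUp M a p μ ν * T p μ ν

/-- `tr χ̲`. -/
def trChiBar (M a : ℝ) (p : Point) : ℝ := hTr M a (chiBar M a) p

/-- `ε · χ̲`. -/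
def atrChiBar (M a : ℝ) (p : Point) : ℝ := hAtr M a (chiBar M a) p

/-- `ω̂ = ½ g(∇_{e₄} e₃, e₄)`. -/
def omegaHat (M a : ℝ) (p : Point) : ℝ :=
  1 / 2 * ∑ μ, ∑ ν, e4 M a p μ * covVector M a e3 p μ ν * lower M a (e4 M a) p ν

/-! ### Horizontal operators -/

/-- The derivative of a scalar function along a vector field. -/
def along (M a : ℝ) (e : Field₁) (f : Point → ℝ) (p : Point) : ℝ := ∑ μ, e p μ * pd M a f μ p

/-- The horizontal gradient of a scalar function. -/
def hGrad (M a : ℝ) (f : Point → ℝ) : Field₁ := fun p ν => ∑ μ, proj M a p μ ν * pd M a f μ p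

/-- The induced connection on horizontal one-forms: the component along `ν` of the horizontal part
of `∇_μ ς`. -/
def hCov (M a : ℝ) (s : Field₁) : Field₂ := fun p => Matrix.of fun μ ν =>
  ∑ l, proj M a p l ν * covForm M a s p μ l

/-- The induced connection on horizontal one-forms along a vector field. -/
def hCovAlong (M a : ℝ) (e : Field₁) (s : Field₁) : Field₁ := fun p ν =>
  ∑ μ, e p μ * hCov M a s p μ ν

/-- The horizontal divergence of a horizontal one-form. -/
def hDiv (M a : ℝ) (s : Field₁) (p : Point) : ℝ := hTr M a (hCov M a s) p

/-- The horizontal curl of a horizontal one-form. -/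
def hCurl (M a : ℝ) (s : Field₁) (p : Point) : ℝ := hAtr M a (hCov M a s) p

/-- The horizontal Hodge dual `(⋆ς)_A = ε_{AC} g^{CB} ς_B`. -/
def hStar (M a : ℝ) (s : Field₁) : Field₁ := fun p ν =>
  ∑ l, ∑ κ, hVol M a p ν l * hInv M a p l κ * s p κ

/-- The product `(T^{♯₂} · ς)_A = g^{BC} T_{AC} ς_B`. -/
def sharpDot (M a : ℝ) (T : Field₂) (s : Field₁) : Field₁ := fun p μ =>
  ∑ κ, ∑ l, hInv M a p κ l * T p μ l * s p κ

/-! ### Maxwell fields -/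

/-- A smooth two-form on the Kerr exterior. -/
def IsTwoForm (M a : ℝ) (F : Field₂) : Prop :=
  (∀ μ ν, ContDiffOn ℝ ∞ (fun p => F p μ ν) (exterior M a)) ∧
    ∀ p ∈ exterior M a, ∀ μ ν, F p μ ν = -F p ν μ

/-- The source-free Maxwell equations on the Kerr exterior. -/
def IsMaxwell (M a : ℝ) (F : Field₂) : Prop :=
  ∀ p ∈ exterior M a,
    (∀ i j k, covTwo M a F p i j k + covTwo M a F p j k i + covTwo M a F p k i j = 0) ∧
    ∀ i, ∑ j, ∑ k, metricInv M a p j k * covTwo M a F p j k i = 0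

/-- `α(X) = F(X, e₄)` for horizontal `X`. -/
def alpha (M a : ℝ) (F : Field₂) : Field₁ := fun p ν =>
  ∑ μ, ∑ l, proj M a p μ ν * F p μ l * e4 M a p l

/-- `α̲(X) = F(X, e₃)` for horizontal `X`. -/
def alphaBar (M a : ℝ) (F : Field₂) : Field₁ := fun p ν =>
  ∑ μ, ∑ l, proj M a p μ ν * F p μ l * e3 p l

/-- `ρ = ½ F(e₃, e₄)`. -/
def rho (M a : ℝ) (F : Field₂) (p : Point) : ℝ :=
  1 / 2 * ∑ μ, ∑ ν, F p μ ν * e3 p μ * e4 M a p ν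

/-- `σ = ½ ε^{AB} F_{AB}`. -/
def sigma (M a : ℝ) (F : Field₂) (p : Point) : ℝ := 1 / 2 * hAtr M a F p

/-- `ρ̂ = (r² - a² cos² θ) ρ - 2 a r cos θ σ`. -/
def rhoHat (M a : ℝ) (F : Field₂) (p : Point) : ℝ :=
  (rad p ^ 2 - a ^ 2 * cosθ p ^ 2) * rho M a F p - 2 * a * rad p * cosθ p * sigma M a F p

/-- `σ̂ = 2 a r cos θ ρ + (r² - a² cos² θ) σ`. -/
def sigmaHat (M a : ℝ) (F : Field₂) (p : Point) : ℝ :=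
  2 * a * rad p * cosθ p * rho M a F p + (rad p ^ 2 - a ^ 2 * cosθ p ^ 2) * sigma M a F p

/-- `𝔗(α) = ½ Σ (∇₃ α + χ̲^{♯₂} · α)`. -/
def frakT (M a : ℝ) (s : Field₁) : Field₁ := fun p ν =>
  1 / 2 * Sig a p * (hCovAlong M a e3 s p ν + sharpDot M a (chiBar M a) s p ν)

/-- `𝔗̲(α̲) = ½ Σ (∇₄ α̲ + χ^{♯₂} · α̲ + ω̂ α̲)`. -/
def frakTBar (M a : ℝ) (s : Field₁) : Field₁ := fun p ν =>
  1 / 2 * Sig a p * (hCovAlong M a (e4 M a) s p ν + sharpDot M a (chi M a) s p ν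
    + omegaHat M a p * s p ν)

end Kerr

end

open Kerr

/-!
Decompose `F` into `α`, `α̲`, `ρ`, `σ` and differentiate covariantly: in a null frame
`e₃, e₄, X, Y` at a point, the components of `∇F` are derivatives of `α`, `α̲`, `ρ`, `σ` plus
products with the connection coefficients `g(∇e₃, ·)` and `g(∇e₄, ·)`. The antisymmetric part of
such a coefficient is an exterior derivative of the lowered `e₃` or `e₄`, and the symmetric part a
Lie derivative of the metric along `e₃` or `e₄`, so that no Christoffel symbol has to be computed.
The eight Maxwell equations become scalar equations, two for each of `e₃`, `e₄`, `X`, `Y`, and the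
equations for `Y` are those for `X` in the frame rotated by a right angle.

Since `tr χ̲ = -2r/Σ` and `ε·χ̲ = 2a cos θ/Σ`, the coefficients of the modified equations are, up to
powers of `Σ`, the real and imaginary parts of `(r + i a cos θ)²`, while
`ρ̂ + i σ̂ = (r + i a cos θ)² (ρ + i σ)`. Each pair of modified equations is therefore a pair of
Maxwell equations, read as one complex equation for `ρ + i σ`, multiplied by `(r + i a cos θ)²`. The
squared modulus `Σ²` of this factor does not vanish, and its derivative absorbs the zeroth order
terms in `ρ` and `σ`.
-/

noncomputable section

namespace Kerr

variable {M a : ℝ} {p : Point} {f g : Point → ℝ} {X Y U V W Z : Fin 4 → ℝ}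
  {s t e e' : Field₁} {F G : Field₂}

/-! ### Calculus on the exterior -/

lemma rPlus_pos (hM : 0 < M) : 0 < rPlus M a := by
  unfold rPlus; positivity

lemma rad_pos (hM : 0 < M) (hp : p ∈ exterior M a) : 0 < rad p :=
  (rPlus_pos hM).trans_le hp

lemma rad_sq (p : Point) : rad p ^ 2 = p 1 ^ 2 + p 2 ^ 2 + p 3 ^ 2 :=
  Real.sq_sqrt (by positivity)

-- By Cauchy–Schwarz the exterior contains the half-space `{q | |p|² ≤ ⟨p, q⟩}` touching `p`.
lemma uniqueDiffWithinAt_exterior (hM : 0 < M) (hp : p ∈ exterior M a) :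
    UniqueDiffWithinAt ℝ (exterior M a) p := by
  have hr := rad_pos hM hp
  let L : Point →L[ℝ] ℝ := p 1 • .proj 1 + p 2 • .proj 2 + p 3 • .proj 3
  have hL (q : Point) : L q = p 1 * q 1 + p 2 * q 2 + p 3 * q 3 := rfl
  have hLp : L p = rad p ^ 2 := by rw [hL, rad_sq]; ring
  have hsub : {q | L p ≤ L q} ⊆ exterior M a := by
    intro q (hq : L p ≤ L q)
    refine le_trans hp (Real.sqrt_le_sqrt ?_)
    rw [hL, hL] at hq
    nlinarith [sq_nonneg (q 1 - p 1), sq_nonneg (q 2 - p 2), sq_nonneg (q 3 - p 3)]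
  refine UniqueDiffWithinAt.mono (uniqueDiffWithinAt_convex
    (convex_halfSpace_ge L.toLinearMap.isLinear _) ?_ (subset_closure (le_refl (L p)))) hsub
  refine ⟨(2 : ℝ) • p, mem_interior.2 ⟨{q | L p < L q}, fun q (hq : L p < L q) => hq.le,
    isOpen_lt continuous_const L.continuous, ?_⟩⟩
  have : 0 < L p := by rw [hLp]; positivity
  simp only [Set.mem_ofPred_eq, map_smul, smul_eq_mul]
  linarith

section Derivative

variable {E : Type*} [NormedAddCommGroup E] [NormedSpace ℝ E]

/-- The derivative at `p`, in the direction `Z`, of a function on the exterior. -/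
def der (M a : ℝ) (p : Point) (f : Point → E) (Z : Fin 4 → ℝ) : E :=
  fderivWithin ℝ f (exterior M a) p Z

lemma sum_mul_pd (f : Point → ℝ) (Z : Fin 4 → ℝ) : ∑ μ, Z μ * pd M a f μ p = der M a p f Z := by
  conv_rhs => rw [der, pi_eq_sum_univ' Z, map_sum]
  refine Finset.sum_congr rfl fun μ _ => ?_
  rw [map_smul, smul_eq_mul, pd]

lemma der_congr {f g : Point → E} (h : ∀ q ∈ exterior M a, f q = g q) (hp : p ∈ exterior M a)
    (Z : Fin 4 → ℝ) : der M a p f Z = der M a p g Z := by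
  rw [der, fderivWithin_congr h (h p hp), der]

lemma der_const (c : E) (Z : Fin 4 → ℝ) : der M a p (fun _ => c) Z = 0 := by
  simp [der]

variable (hu : UniqueDiffWithinAt ℝ (exterior M a) p) (Z : Fin 4 → ℝ)
include hu

lemma der_of_hasFDerivAt {f : Point → E} {f' : Point →L[ℝ] E} (h : HasFDerivAt f f' p) :
    der M a p f Z = f' Z := by
  rw [der, h.hasFDerivWithinAt.fderivWithin hu]

variable (hf : DifferentiableWithinAt ℝ f (exterior M a) p)
  (hg : DifferentiableWithinAt ℝ g (exterior M a) p)
include hf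

lemma der_const_mul (c : ℝ) : der M a p (fun q => c * f q) Z = c * der M a p f Z := by
  rw [der, fderivWithin_const_mul hu hf]; rfl

include hg

lemma der_add : der M a p (fun q => f q + g q) Z = der M a p f Z + der M a p g Z := by
  rw [der, fderivWithin_fun_add hu hf hg]; rfl

lemma der_sub : der M a p (fun q => f q - g q) Z = der M a p f Z - der M a p g Z := by
  rw [der, fderivWithin_fun_sub hu hf hg]; rfl

lemma der_mul :
    der M a p (fun q => f q * g q) Z = f p * der M a p g Z + g p * der M a p f Z := by
  rw [der, fderivWithin_fun_mul hu hf hg]; rfl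

end Derivative

section Fields

variable (hu : UniqueDiffWithinAt ℝ (exterior M a) p) (Z : Fin 4 → ℝ)
  (hs : DifferentiableWithinAt ℝ s (exterior M a) p)
  (ht : DifferentiableWithinAt ℝ t (exterior M a) p)
include hu hs

lemma der_apply (ν : Fin 4) : der M a p s Z ν = der M a p (fun q => s q ν) Z := by
  rw [der, der, fderivWithin_apply hs hu]; rfl

include ht in
lemma der_dotProduct : der M a p (fun q => s q ⬝ᵥ t q) Z
    = der M a p s Z ⬝ᵥ t p + s p ⬝ᵥ der M a p t Z := by
  have hs' := differentiableWithinAt_pi.1 hs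
  have ht' := differentiableWithinAt_pi.1 ht
  simp only [dotProduct]
  rw [der, fderivWithin_fun_sum hu fun ν _ => (hs' ν).fun_mul (ht' ν), sum_apply,
    ← Finset.sum_add_distrib]
  refine Finset.sum_congr rfl fun ν _ => ?_
  rw [← der, der_mul hu Z (hs' ν) (ht' ν), der_apply hu Z hs, der_apply hu Z ht]
  ring

lemma der_dotProduct_const (V : Fin 4 → ℝ) :
    der M a p (fun q => s q ⬝ᵥ V) Z = der M a p s Z ⬝ᵥ V := by
  rw [der_dotProduct hu Z hs (differentiableWithinAt_const V), der_const,
    dotProduct_zero, add_zero]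

end Fields

/-! ### Scalar functions and one-forms -/

/-- A covector as a continuous linear form. -/
def covector (s : Fin 4 → ℝ) : Point →L[ℝ] ℝ := (dotProductBilin ℝ ℝ s).toContinuousLinearMap

@[simp] lemma covector_apply (s Z : Fin 4 → ℝ) : covector s Z = s ⬝ᵥ Z := rfl

/-- The one-form `dt̄ - a sin² θ dφ̄`. -/
def theta (a : ℝ) : Field₁ := fun p => dt p - a • sinSqdφ p

/-- The differential of `cos θ`. -/
def dcos : Field₁ := fun p => (1 / rad p) • (![0, 0, 0, 1] - cosθ p • dr p)

/-- The axial Killing field `∂_φ̄`. -/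
def axial : Field₁ := fun p => ![0, -p 2, p 1, 0]

lemma dt_dot (V : Fin 4 → ℝ) : dt p ⬝ᵥ V = V 0 := by
  simp [dt, dotProduct, Fin.sum_univ_four]

lemma dr_dot (V : Fin 4 → ℝ) : dr p ⬝ᵥ V = (p 1 * V 1 + p 2 * V 2 + p 3 * V 3) / rad p := by
  simp only [dr, dotProduct, Fin.sum_univ_four, Matrix.cons_val]; ring

lemma sinSqdφ_dot (V : Fin 4 → ℝ) :
    sinSqdφ p ⬝ᵥ V = (p 1 * V 2 - p 2 * V 1) / rad p ^ 2 := by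
  simp only [sinSqdφ, dotProduct, Fin.sum_univ_four, Matrix.cons_val]; ring

lemma theta_dot (V : Fin 4 → ℝ) : theta a p ⬝ᵥ V = V 0 - a * (sinSqdφ p ⬝ᵥ V) := by
  simp [theta, sub_dotProduct, dt_dot]

lemma dcos_dot (V : Fin 4 → ℝ) : dcos p ⬝ᵥ V = (V 3 - cosθ p * (dr p ⬝ᵥ V)) / rad p := by
  have h : ![0, 0, 0, 1] ⬝ᵥ V = V 3 := by simp [dotProduct, Fin.sum_univ_four]
  rw [dcos, smul_dotProduct, sub_dotProduct, smul_dotProduct, h, smul_eq_mul, smul_eq_mul]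
  ring

lemma e3_eq (p : Point) : e3 p = -dr p := by
  ext μ; fin_cases μ <;> simp [e3, dr]

lemma Sig_pos (a : ℝ) (hr : 0 < rad p) : 0 < Sig a p := by
  unfold Sig; positivity

lemma Del_eq (ha : |a| ≤ M) (p : Point) : Del M a p = rad p ^ 2 - 2 * M * rad p + a ^ 2 := by
  have h := Real.sq_sqrt (sub_nonneg.2 (sq_le_sq' (neg_le_of_abs_le ha) (le_of_abs_le ha)))
  simp only [Del, rPlus, rMinus]
  linear_combination -h

/-- The function `Δ / Σ`. -/
def quot (M a : ℝ) (p : Point) : ℝ := Del M a p / Sig a p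

/-- The partial derivative `∂_r (Δ / Σ)`. -/
def quotR (M a : ℝ) (p : Point) : ℝ :=
  (2 * rad p - 2 * M - 2 * rad p * quot M a p) / Sig a p

lemma hasFDerivAt_div {E : Type*} [NormedAddCommGroup E] [NormedSpace ℝ E] {f g : E → ℝ}
    {f' g' : E →L[ℝ] ℝ} {x : E} (hf : HasFDerivAt f f' x) (hg : HasFDerivAt g g' x) (h : g x ≠ 0) :
    HasFDerivAt (fun q => f q / g q) ((g x)⁻¹ • (f' - (f x / g x) • g')) x := by
  simp only [div_eq_mul_inv]
  refine (hf.mul ((hasDerivAt_inv h).comp_hasFDerivAt x hg)).congr_fderiv ?_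
  ext Z
  simp only [neg_smul, smul_neg, Function.comp_apply, add_apply, neg_apply, smul_apply,
    smul_eq_mul, sub_apply]
  field_simp
  ring

section Differentials

variable (hr : 0 < rad p)
include hr

lemma hasFDerivAt_rad : HasFDerivAt rad (covector (dr p)) p := by
  have hp : p 1 ^ 2 + p 2 ^ 2 + p 3 ^ 2 ≠ 0 := by rw [← rad_sq]; positivity
  have hc (μ : Fin 4) : HasFDerivAt (fun q : Point => q μ) (.proj μ : Point →L[ℝ] ℝ) p :=
    hasFDerivAt_apply μ p
  refine ((((hc 1).pow 2).add ((hc 2).pow 2)).add ((hc 3).pow 2) |>.sqrt hp).congr_fderiv ?_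
  ext Z
  rw [covector_apply, dr_dot, rad]
  simp only [Pi.add_apply, Nat.add_one_sub_one, pow_one, nsmul_eq_mul, Nat.cast_ofNat,
    smul_add, add_apply, smul_apply, ContinuousLinearMap.proj_apply, smul_eq_mul]
  field_simp

lemma hasFDerivAt_cosθ : HasFDerivAt cosθ (covector (dcos p)) p := by
  refine (hasFDerivAt_div (hasFDerivAt_apply 3 p) (hasFDerivAt_rad hr) hr.ne').congr_fderiv ?_
  ext Z
  rw [covector_apply, dcos_dot, cosθ]
  simp only [smul_apply, sub_apply, ContinuousLinearMap.proj_apply, covector_apply, smul_eq_mul]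
  field_simp

lemma hasFDerivAt_Sig : HasFDerivAt (Sig a)
    (covector ((2 * rad p) • dr p + (2 * a ^ 2 * cosθ p) • dcos p)) p := by
  refine (((hasFDerivAt_rad hr).pow 2).add
    (((hasFDerivAt_cosθ hr).pow 2).const_mul (a ^ 2))).congr_fderiv ?_
  ext Z
  simp only [covector_apply, add_dotProduct, smul_dotProduct]
  simp only [Nat.add_one_sub_one, pow_one, nsmul_eq_mul, Nat.cast_ofNat, add_apply, smul_apply,
    covector_apply, smul_eq_mul]
  ring

lemma hasFDerivAt_Del : HasFDerivAt (Del M a) (covector ((2 * rad p - 2 * M) • dr p)) p := by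
  have h := hasFDerivAt_rad hr
  refine ((h.sub_const (rPlus M a)).mul (h.sub_const (rMinus M a))).congr_fderiv ?_
  ext Z
  simp only [rPlus, rMinus, covector_apply, smul_dotProduct]
  simp only [add_apply, smul_apply, covector_apply, smul_eq_mul]
  ring

lemma hasFDerivAt_quot : HasFDerivAt (quot M a)
    (covector (quotR M a p • dr p - (2 * a ^ 2 * cosθ p * quot M a p / Sig a p) • dcos p)) p := by
  have hS := (Sig_pos a hr).ne'
  refine (hasFDerivAt_div (hasFDerivAt_Del hr) (hasFDerivAt_Sig hr) hS).congr_fderiv ?_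
  ext Z
  simp only [covector_apply, sub_dotProduct, smul_dotProduct, quotR, quot]
  simp only [smul_apply, sub_apply, covector_apply, smul_dotProduct, smul_eq_mul, add_dotProduct]
  field_simp
  ring

end Differentials

lemma e4_eq (p : Point) : e4 M a p =
    (2 * (rad p ^ 2 + a ^ 2) / Sig a p) • dt p + quot M a p • dr p
      + (2 * a / Sig a p) • axial p := rfl

section Differentiability

variable (hr : 0 < rad p)
include hr

lemma differentiableAt_dr : DifferentiableAt ℝ dr p := by
  have := (hasFDerivAt_rad hr).differentiableAt
  refine differentiableAt_pi.2 fun μ => ?_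
  fin_cases μ <;> simp only [dr, Fin.mk_one, Fin.reduceFinMk, Matrix.cons_val] <;>
    fun_prop (disch := exact hr.ne')

lemma differentiableAt_sinSqdφ : DifferentiableAt ℝ sinSqdφ p := by
  have := (hasFDerivAt_rad hr).differentiableAt
  refine differentiableAt_pi.2 fun μ => ?_
  fin_cases μ <;> simp only [sinSqdφ, Fin.mk_one, Fin.reduceFinMk, Matrix.cons_val] <;>
    fun_prop (disch := positivity)

lemma differentiableAt_theta : DifferentiableAt ℝ (theta a) p :=
  (differentiableAt_const _).sub ((differentiableAt_sinSqdφ hr).const_smul a)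

lemma differentiableAt_e3 : DifferentiableAt ℝ e3 p := by
  rw [funext e3_eq]
  exact (differentiableAt_dr hr).neg

omit hr in
lemma differentiableAt_axial : DifferentiableAt ℝ axial p := by
  refine differentiableAt_pi.2 fun μ => ?_
  fin_cases μ <;> simp only [axial, Fin.mk_one, Fin.reduceFinMk, Matrix.cons_val] <;> fun_prop

lemma differentiableAt_e4 : DifferentiableAt ℝ (e4 M a) p := by
  have hrad := (hasFDerivAt_rad hr).differentiableAt
  have hSig := (hasFDerivAt_Sig (a := a) hr).differentiableAt
  have hS := (Sig_pos a hr).ne'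
  have ht : DifferentiableAt ℝ (fun q => 2 * (rad q ^ 2 + a ^ 2) / Sig a q) p := by
    fun_prop (disch := assumption)
  have hφ : DifferentiableAt ℝ (fun q => 2 * a / Sig a q) p := by
    fun_prop (disch := assumption)
  rw [funext e4_eq]
  exact ((ht.smul (differentiableAt_const _)).add
    ((hasFDerivAt_quot hr).differentiableAt.smul (differentiableAt_dr hr))).add
    (hφ.smul differentiableAt_axial)

lemma differentiableAt_metric (μ ν : Fin 4) :
    DifferentiableAt ℝ (fun q => metric M a q μ ν) p := by
  have hrad := (hasFDerivAt_rad hr).differentiableAt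
  have hdr := differentiableAt_pi.1 (differentiableAt_dr hr)
  have hφ := differentiableAt_pi.1 (differentiableAt_sinSqdφ hr)
  have hSig := (hasFDerivAt_Sig (a := a) hr).differentiableAt
  have hS := (Sig_pos a hr).ne'
  have hr2 : rad p ^ 2 ≠ 0 := by positivity
  simp only [metric, roundMetric, Matrix.of_apply, dt]
  fun_prop (disch := assumption)

end Differentiability

/-! ### The metric -/

lemma metric_isSymm (p : Point) : (metric M a p).IsSymm := by
  refine Matrix.IsSymm.ext fun μ ν => ?_
  have h : (ν = μ ∧ ν ≠ 0) ↔ (μ = ν ∧ μ ≠ 0) := by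
    constructor <;> rintro ⟨rfl, h⟩ <;> exact ⟨rfl, h⟩
  simp only [metric, roundMetric, Matrix.of_apply, h]
  ring

/-- The spatial part of a vector. -/
def spatial (V : Fin 4 → ℝ) : Fin 4 → ℝ := ![0, V 1, V 2, V 3]

lemma roundMetric_mulVec (V : Fin 4 → ℝ) :
    (roundMetric p).mulVec V = (rad p ^ 2)⁻¹ • (spatial V - (dr p ⬝ᵥ V) • dr p) := by
  ext μ
  have h (ν) : (if μ = ν ∧ μ ≠ 0 then 1 else 0 : ℝ) * V ν = if μ = ν then spatial V ν else 0 := by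
    fin_cases μ <;> fin_cases ν <;> simp [spatial]
  simp only [Matrix.mulVec, dotProduct, roundMetric, Matrix.of_apply, div_mul_eq_mul_div, sub_mul,
    ← Finset.sum_div, Finset.sum_sub_distrib, h, mul_assoc, ← Finset.mul_sum]
  simp only [Finset.sum_ite_eq, Finset.mem_univ, if_true, Pi.smul_apply, Pi.sub_apply, smul_eq_mul]
  ring

lemma metric_mulVec (ha : |a| ≤ M) (hr : 0 < rad p) (V : Fin 4 → ℝ) :
    (metric M a p).mulVec V =
      (Sig a p / rad p ^ 2) • (spatial V - (dr p ⬝ᵥ V) • dr p)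
      - a • ((theta a p ⬝ᵥ V) • sinSqdφ p + (sinSqdφ p ⬝ᵥ V) • theta a p)
      + ((a ^ 2 * (1 - cosθ p ^ 2) / Sig a p - quot M a p) * (theta a p ⬝ᵥ V)) • theta a p
      + ((dr p ⬝ᵥ V) • theta a p + (theta a p ⬝ᵥ V) • dr p) := by
  have hS := (Sig_pos a hr).ne'
  have hquot : a ^ 2 * (1 - cosθ p ^ 2) / Sig a p - quot M a p = 2 * M * rad p / Sig a p - 1 := by
    rw [quot, Del_eq ha]
    field_simp
    unfold Sig
    ring
  ext μ
  have h := congrFun (roundMetric_mulVec (p := p) V) μ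
  simp only [hquot, Matrix.mulVec, dotProduct, metric, Matrix.of_apply, Fin.sum_univ_four, theta,
    Pi.add_apply, Pi.sub_apply, Pi.smul_apply, smul_eq_mul] at h ⊢
  linear_combination Sig a p * h

/-! ### The principal null vectors -/

lemma sin_sq_eq (hr : 0 < rad p) : (p 1 ^ 2 + p 2 ^ 2) / rad p ^ 2 = 1 - cosθ p ^ 2 := by
  unfold cosθ
  field_simp
  rw [rad_sq]; ring

section DotProducts

variable (hr : 0 < rad p)

lemma dr_dot_dt : dr p ⬝ᵥ dt p = 0 := by rw [dr_dot]; simp [dt]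

lemma sinSqdφ_dot_dt : sinSqdφ p ⬝ᵥ dt p = 0 := by rw [sinSqdφ_dot]; simp [dt]

lemma dr_dot_axial : dr p ⬝ᵥ axial p = 0 := by
  rw [dr_dot]
  simp only [axial, Matrix.cons_val]
  ring

lemma sinSqdφ_dot_dr : sinSqdφ p ⬝ᵥ dr p = 0 := by
  rw [sinSqdφ_dot]
  simp only [dr, Matrix.cons_val]
  ring

lemma sinSqdφ_dot_e3 : sinSqdφ p ⬝ᵥ e3 p = 0 := by
  rw [e3_eq, dotProduct_neg, sinSqdφ_dot_dr, neg_zero]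

lemma theta_dot_e3 : theta a p ⬝ᵥ e3 p = 0 := by
  rw [theta_dot, sinSqdφ_dot_e3]; simp [e3]

include hr

lemma sinSqdφ_dot_axial : sinSqdφ p ⬝ᵥ axial p = 1 - cosθ p ^ 2 := by
  rw [← sin_sq_eq hr, sinSqdφ_dot]
  simp only [axial, Matrix.cons_val]
  ring

lemma dr_dot_dr : dr p ⬝ᵥ dr p = 1 := by
  rw [dr_dot]
  simp only [dr, Matrix.cons_val]
  field_simp
  rw [rad_sq]

lemma dr_dot_e3 : dr p ⬝ᵥ e3 p = -1 := by
  rw [e3_eq, dotProduct_neg, dr_dot_dr hr]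

lemma dcos_dot_e3 : dcos p ⬝ᵥ e3 p = 0 := by
  rw [dcos_dot, dr_dot_e3 hr]
  simp [e3, cosθ]

lemma dr_dot_e4 : dr p ⬝ᵥ e4 M a p = quot M a p := by
  simp [e4_eq, dotProduct_add, dr_dot_dt, dr_dot_dr hr, dr_dot_axial]

lemma sinSqdφ_dot_e4 : sinSqdφ p ⬝ᵥ e4 M a p = 2 * a / Sig a p * (1 - cosθ p ^ 2) := by
  simp [e4_eq, dotProduct_add, sinSqdφ_dot_dt, sinSqdφ_dot_dr, sinSqdφ_dot_axial hr]

lemma theta_dot_e4 : theta a p ⬝ᵥ e4 M a p = 2 := by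
  have hS := (Sig_pos a hr).ne'
  have h0 : e4 M a p 0 = 2 * (rad p ^ 2 + a ^ 2) / Sig a p := by simp [e4]
  rw [theta_dot, sinSqdφ_dot_e4 hr, h0]
  field_simp
  unfold Sig
  ring

lemma dcos_dot_e4 : dcos p ⬝ᵥ e4 M a p = 0 := by
  have h3 : e4 M a p 3 = quot M a p * cosθ p := by simp [e4, cosθ, quot]
  rw [dcos_dot, dr_dot_e4 hr, h3]
  ring

end DotProducts

lemma lower_eq_mulVec (V : Field₁) : lower M a V p = (metric M a p).mulVec (V p) := rfl

lemma spatial_e3 : spatial (e3 p) = -dr p := by ext μ; fin_cases μ <;> simp [spatial, e3, dr]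

lemma spatial_e4 :
    spatial (e4 M a p) = quot M a p • dr p + (2 * a / Sig a p) • axial p := by
  ext μ
  fin_cases μ <;> simp [spatial, e4_eq, dr, dt, axial]

lemma axial_eq (hr : 0 < rad p) : axial p = rad p ^ 2 • sinSqdφ p := by
  have := hr.ne'
  ext μ
  fin_cases μ <;> simp [axial, sinSqdφ] <;> field_simp

lemma metric_mulVec_e3 (ha : |a| ≤ M) (hr : 0 < rad p) :
    (metric M a p).mulVec (e3 p) = -theta a p := by
  rw [metric_mulVec ha hr, theta_dot_e3, sinSqdφ_dot_e3, dr_dot_e3 hr, spatial_e3]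
  simp

lemma metric_mulVec_e4 (ha : |a| ≤ M) (hr : 0 < rad p) :
    (metric M a p).mulVec (e4 M a p) = (2 : ℝ) • dr p - quot M a p • theta a p := by
  have hS := (Sig_pos a hr).ne'
  rw [metric_mulVec ha hr, theta_dot_e4 hr, sinSqdφ_dot_e4 hr, dr_dot_e4 hr, spatial_e4,
    axial_eq hr]
  ext μ
  simp only [Pi.add_apply, Pi.sub_apply, Pi.smul_apply, smul_eq_mul]
  field_simp
  ring

/-! ### Null frames -/

/-- The vectors `K, L, X, Y` form a null frame of the metric `g` on `ℝ⁴`: `K`, `L` are null with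
`g(K, L) = -2`, and `X`, `Y` is an orthonormal basis of their orthogonal complement. -/
structure IsNullFrame (g : Matrix (Fin 4) (Fin 4) ℝ) (K L X Y : Fin 4 → ℝ) : Prop where
  isSymm : g.IsSymm
  KK : g.mulVec K ⬝ᵥ K = 0
  KL : g.mulVec K ⬝ᵥ L = -2
  KX : g.mulVec K ⬝ᵥ X = 0
  KY : g.mulVec K ⬝ᵥ Y = 0
  LL : g.mulVec L ⬝ᵥ L = 0
  LX : g.mulVec L ⬝ᵥ X = 0
  LY : g.mulVec L ⬝ᵥ Y = 0
  XX : g.mulVec X ⬝ᵥ X = 1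
  XY : g.mulVec X ⬝ᵥ Y = 0
  YY : g.mulVec Y ⬝ᵥ Y = 1

lemma mulVec_dot_comm {g : Matrix (Fin 4) (Fin 4) ℝ} (hg : g.IsSymm) (V W : Fin 4 → ℝ) :
    g.mulVec V ⬝ᵥ W = g.mulVec W ⬝ᵥ V := by
  rw [dotProduct_comm, Matrix.dotProduct_mulVec, ← Matrix.mulVec_transpose, hg.eq]

namespace IsNullFrame

variable {g : Matrix (Fin 4) (Fin 4) ℝ} {K L : Fin 4 → ℝ} (h : IsNullFrame g K L X Y)
include h

lemma LK : g.mulVec L ⬝ᵥ K = -2 := by rw [mulVec_dot_comm h.isSymm, h.KL]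

lemma XK : g.mulVec X ⬝ᵥ K = 0 := by rw [mulVec_dot_comm h.isSymm, h.KX]

lemma XL : g.mulVec X ⬝ᵥ L = 0 := by rw [mulVec_dot_comm h.isSymm, h.LX]

lemma YK : g.mulVec Y ⬝ᵥ K = 0 := by rw [mulVec_dot_comm h.isSymm, h.KY]

lemma YL : g.mulVec Y ⬝ᵥ L = 0 := by rw [mulVec_dot_comm h.isSymm, h.LY]

lemma YX : g.mulVec Y ⬝ᵥ X = 0 := by rw [mulVec_dot_comm h.isSymm, h.XY]

lemma gram : Matrix.of ![X, Y, K, L] * g * (Matrix.of ![X, Y, K, L]).transpose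
    = !![1, 0, 0, 0; 0, 1, 0, 0; 0, 0, 0, -2; 0, 0, -2, 0] := by
  have hv (i j) : (Matrix.of ![X, Y, K, L] * g * (Matrix.of ![X, Y, K, L]).transpose) i j
      = g.mulVec (![X, Y, K, L] j) ⬝ᵥ ![X, Y, K, L] i := by
    rw [Matrix.mul_assoc, Matrix.mul_apply, dotProduct_comm]
    rfl
  ext i j
  rw [hv]
  fin_cases i <;> fin_cases j <;>
    simp [h.KK, h.KL, h.KX, h.KY, h.LK, h.LL, h.LX, h.LY, h.XK, h.XL, h.XX, h.XY, h.YK, h.YL,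
      h.YX, h.YY]

lemma det_mul_sq : g.det * (Matrix.of ![X, Y, K, L]).det ^ 2 = -4 := by
  have hdet := congrArg Matrix.det h.gram
  rw [Matrix.det_mul, Matrix.det_mul, Matrix.det_transpose] at hdet
  rw [pow_two, ← mul_assoc, mul_comm g.det, hdet]
  simp [Matrix.det_succ_row_zero, Fin.sum_univ_succ, Fin.succAbove]
  norm_num

lemma isUnit_det : IsUnit g.det := by
  refine isUnit_iff_ne_zero.2 fun h0 => ?_
  have := h.det_mul_sq
  norm_num [h0] at this

lemma inv_apply (μ ν : Fin 4) :
    g⁻¹ μ ν = X μ * X ν + Y μ * Y ν - 1 / 2 * (K μ * L ν + L μ * K ν) := by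
  set E : Matrix (Fin 4) (Fin 4) ℝ := Matrix.of ![X, Y, K, L] with hE
  let η' : Matrix (Fin 4) (Fin 4) ℝ :=
    !![1, 0, 0, 0; 0, 1, 0, 0; 0, 0, 0, -(1 / 2); 0, 0, -(1 / 2), 0]
  have h1 : E * (g * E.transpose * η') = 1 := by
    rw [← Matrix.mul_assoc, ← Matrix.mul_assoc, h.gram]
    ext i j
    fin_cases i <;> fin_cases j <;> simp [η', Matrix.mul_apply, Fin.sum_univ_four]
  have h2 : g⁻¹ = E.transpose * η' * E := by
    refine Matrix.inv_eq_right_inv ?_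
    rw [← mul_eq_one_comm.1 h1]
    simp only [Matrix.mul_assoc]
  rw [h2]
  simp only [hE, η', Matrix.mul_apply, Fin.sum_univ_four, Matrix.transpose_apply, Matrix.of_apply,
    Matrix.cons_val]
  ring

lemma one_apply (μ ν : Fin 4) : (1 : Matrix (Fin 4) (Fin 4) ℝ) μ ν =
    X μ * g.mulVec X ν + Y μ * g.mulVec Y ν
      - 1 / 2 * (K μ * g.mulVec L ν + L μ * g.mulVec K ν) := by
  rw [← Matrix.nonsing_inv_mul g h.isUnit_det, Matrix.mul_apply]
  simp only [h.inv_apply, Matrix.mulVec, dotProduct, Fin.sum_univ_four, h.isSymm.apply ν]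
  ring

lemma form_expand (s : Fin 4 → ℝ) :
    s = (s ⬝ᵥ X) • g.mulVec X + (s ⬝ᵥ Y) • g.mulVec Y
      + (-(1 / 2) * (s ⬝ᵥ K)) • g.mulVec L + (-(1 / 2) * (s ⬝ᵥ L)) • g.mulVec K := by
  ext ν
  conv_lhs => rw [← Matrix.vecMul_one s]
  simp only [Matrix.vecMul, dotProduct, h.one_apply, Fin.sum_univ_four, Pi.add_apply,
    Pi.smul_apply, smul_eq_mul]
  ring

lemma vector_expand (V : Fin 4 → ℝ) :
    V = (g.mulVec X ⬝ᵥ V) • X + (g.mulVec Y ⬝ᵥ V) • Y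
      + (-(1 / 2) * (g.mulVec L ⬝ᵥ V)) • K + (-(1 / 2) * (g.mulVec K ⬝ᵥ V)) • L := by
  ext μ
  conv_lhs => rw [← Matrix.one_mulVec V]
  rw [Matrix.mulVec]
  simp only [dotProduct, h.one_apply, Fin.sum_univ_four, Pi.add_apply, Pi.smul_apply, smul_eq_mul]
  ring

lemma sqrt_abs_det (hE : 0 < (Matrix.of ![X, Y, K, L]).det) :
    √|g.det| = 2 / (Matrix.of ![X, Y, K, L]).det := by
  rw [eq_div_of_mul_eq (pow_pos hE 2).ne' h.det_mul_sq, abs_div, abs_of_pos (pow_pos hE 2),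
    show |(-4 : ℝ)| = 2 ^ 2 by norm_num, ← div_pow, Real.sqrt_sq (by positivity)]

lemma det_single_single (μ ν : Fin 4) :
    (Matrix.of ![Pi.single μ 1, Pi.single ν 1, K, L]).det =
      (g.mulVec X μ * g.mulVec Y ν - g.mulVec X ν * g.mulVec Y μ)
        * (Matrix.of ![X, Y, K, L]).det := by
  have hcoeff : Matrix.of ![Pi.single μ 1, Pi.single ν 1, K, L] =
      !![g.mulVec X μ, g.mulVec Y μ, -(1 / 2) * g.mulVec L μ, -(1 / 2) * g.mulVec K μ;
        g.mulVec X ν, g.mulVec Y ν, -(1 / 2) * g.mulVec L ν, -(1 / 2) * g.mulVec K ν;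
        0, 0, 1, 0; 0, 0, 0, 1] * Matrix.of ![X, Y, K, L] := by
    have hs (κ l : Fin 4) : (Pi.single κ (1 : ℝ) : Fin 4 → ℝ) l
        = (1 : Matrix (Fin 4) (Fin 4) ℝ) l κ := by
      rw [Pi.single_apply, Matrix.one_apply]
    ext i j
    fin_cases i <;> simp [Matrix.mul_apply, Fin.sum_univ_four, hs, h.one_apply] <;> ring
  rw [hcoeff, Matrix.det_mul]
  congr 1
  simp [Matrix.det_succ_row_zero, Fin.sum_univ_succ, Fin.succAbove]
  ring

end IsNullFrame

/-! ### Oriented orthonormal frames of the horizontal distribution -/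

/-- `V` is a vector at `p` orthogonal to `e₃` and `e₄`, which is to say annihilated by
`dt̄ - a sin² θ dφ̄` and `dr`. -/
structure IsHor (a : ℝ) (p : Point) (V : Fin 4 → ℝ) : Prop where
  theta_dot : theta a p ⬝ᵥ V = 0
  dr_dot : dr p ⬝ᵥ V = 0

namespace IsHor

variable (hV : IsHor a p V)
include hV

lemma p_dot (hr : 0 < rad p) : p 1 * V 1 + p 2 * V 2 + p 3 * V 3 = 0 := by
  simpa only [Kerr.dr_dot, div_eq_zero_iff, hr.ne', or_false] using hV.dr_dot

lemma dcos_dot : dcos p ⬝ᵥ V = V 3 / rad p := by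
  rw [Kerr.dcos_dot, hV.dr_dot, mul_zero, sub_zero]

end IsHor

/-- `X`, `Y` is a positively oriented orthonormal basis of the horizontal space at `p`: writing `x`
for the spatial part of `p`, the spatial part of `X` is orthogonal to `x` and that of `Y` is
`x × X / r`. -/
structure IsFrame (a : ℝ) (p : Point) (X Y : Fin 4 → ℝ) : Prop where
  rad_pos : 0 < rad p
  theta_X : theta a p ⬝ᵥ X = 0
  theta_Y : theta a p ⬝ᵥ Y = 0
  dr_X : dr p ⬝ᵥ X = 0
  norm_X : X 1 ^ 2 + X 2 ^ 2 + X 3 ^ 2 = rad p ^ 2 / Sig a p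
  Y_one : Y 1 = (p 2 * X 3 - p 3 * X 2) / rad p
  Y_two : Y 2 = (p 3 * X 1 - p 1 * X 3) / rad p
  Y_three : Y 3 = (p 1 * X 2 - p 2 * X 1) / rad p

lemma exists_unit_orthogonal (x y z : ℝ) :
    ∃ u v w : ℝ, u ^ 2 + v ^ 2 + w ^ 2 = 1 ∧ x * u + y * v + z * w = 0 := by
  by_cases h : x ^ 2 + y ^ 2 = 0
  · have hx : x = 0 := by nlinarith [sq_nonneg x, sq_nonneg y]
    exact ⟨1, 0, 0, by norm_num, by simp [hx]⟩
  · have h0 : 0 < x ^ 2 + y ^ 2 := lt_of_le_of_ne (by positivity) (Ne.symm h)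
    have hsq := Real.sq_sqrt h0.le
    refine ⟨-y / √(x ^ 2 + y ^ 2), x / √(x ^ 2 + y ^ 2), 0, ?_, ?_⟩
    · field_simp
      rw [hsq]; ring
    · ring

lemma exists_isFrame (a : ℝ) (hr : 0 < rad p) : ∃ X Y, IsFrame a p X Y := by
  obtain ⟨u, v, w, hunit, horth⟩ := exists_unit_orthogonal (p 1) (p 2) (p 3)
  have hS := Sig_pos a hr
  set k : ℝ := rad p / √(Sig a p) with hk
  have hk2 : k ^ 2 = rad p ^ 2 / Sig a p := by rw [hk, div_pow, Real.sq_sqrt hS.le]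
  have hD : p 1 * (k * u) + p 2 * (k * v) + p 3 * (k * w) = 0 := by linear_combination k * horth
  refine ⟨![a * ((p 1 * (k * v) - p 2 * (k * u)) / rad p ^ 2), k * u, k * v, k * w],
    ![-(a * ((k * w) / rad p)), (p 2 * (k * w) - p 3 * (k * v)) / rad p,
      (p 3 * (k * u) - p 1 * (k * w)) / rad p, (p 1 * (k * v) - p 2 * (k * u)) / rad p],
    hr, ?_, ?_, ?_, ?_, rfl, rfl, rfl⟩
  · rw [theta_dot, sinSqdφ_dot]
    simp only [Matrix.cons_val, sub_self]
  · rw [theta_dot, sinSqdφ_dot]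
    simp only [Matrix.cons_val]
    clear_value k
    field_simp
    linear_combination -a * p 3 * hD - a * (k * w) * rad_sq p
  · rw [dr_dot]
    simp only [Matrix.cons_val, hD, zero_div]
  · simp only [Matrix.cons_val]
    rw [← hk2]
    linear_combination k ^ 2 * hunit

namespace IsFrame

variable (h : IsFrame a p X Y)
include h

lemma Sig_ne_zero : Sig a p ≠ 0 := (Sig_pos a h.rad_pos).ne'

lemma isHor_X : IsHor a p X := ⟨h.theta_X, h.dr_X⟩

lemma dr_Y : dr p ⬝ᵥ Y = 0 := by
  rw [dr_dot, h.Y_one, h.Y_two, h.Y_three]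
  ring

lemma isHor_Y : IsHor a p Y := ⟨h.theta_Y, h.dr_Y⟩

lemma inner_XY : X 1 * Y 1 + X 2 * Y 2 + X 3 * Y 3 = 0 := by
  rw [h.Y_one, h.Y_two, h.Y_three]
  ring

lemma norm_Y : Y 1 ^ 2 + Y 2 ^ 2 + Y 3 ^ 2 = rad p ^ 2 / Sig a p := by
  have hr := h.rad_pos.ne'
  rw [← h.norm_X, h.Y_one, h.Y_two, h.Y_three]
  field_simp
  rw [rad_sq]
  linear_combination -(p 1 * X 1 + p 2 * X 2 + p 3 * X 3) * h.isHor_X.p_dot h.rad_pos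

lemma sinSqdφ_X : sinSqdφ p ⬝ᵥ X = Y 3 / rad p := by
  rw [sinSqdφ_dot, h.Y_three]
  ring

lemma sinSqdφ_Y : sinSqdφ p ⬝ᵥ Y = -(X 3 / rad p) := by
  have hr := h.rad_pos.ne'
  rw [sinSqdφ_dot, h.Y_one, h.Y_two]
  field_simp
  linear_combination p 3 * h.isHor_X.p_dot h.rad_pos + X 3 * rad_sq p

lemma third_sq : X 3 ^ 2 + Y 3 ^ 2 = rad p ^ 2 / Sig a p * (1 - cosθ p ^ 2) := by
  have hr := h.rad_pos.ne'
  rw [← h.norm_X, ← sin_sq_eq h.rad_pos, h.Y_three]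
  field_simp
  rw [rad_sq]
  linear_combination (p 3 * X 3 - p 1 * X 1 - p 2 * X 2) * h.isHor_X.p_dot h.rad_pos

lemma p_dot_cross : p 1 * (X 2 * Y 3 - X 3 * Y 2) + p 2 * (X 3 * Y 1 - X 1 * Y 3)
    + p 3 * (X 1 * Y 2 - X 2 * Y 1) = rad p ^ 3 / Sig a p := by
  have hr := h.rad_pos.ne'
  rw [pow_succ, mul_div_right_comm, ← h.norm_X, h.Y_one, h.Y_two, h.Y_three]
  field_simp
  rw [rad_sq]
  linear_combination -(p 1 * X 1 + p 2 * X 2 + p 3 * X 3) * h.isHor_X.p_dot h.rad_pos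

lemma det_frame : (Matrix.of ![X, Y, e3 p, e4 M a p]).det = 2 * rad p ^ 2 / Sig a p := by
  have hS := h.Sig_ne_zero
  have hr := h.rad_pos.ne'
  have hX0 : X 0 = a * (Y 3 / rad p) := by
    have := h.theta_X
    rw [theta_dot, h.sinSqdφ_X] at this
    linarith
  have hY0 : Y 0 = -(a * (X 3 / rad p)) := by
    have := h.theta_Y
    rw [theta_dot, h.sinSqdφ_Y] at this
    linarith
  have hX := h.isHor_X.p_dot h.rad_pos
  have hY := h.isHor_Y.p_dot h.rad_pos
  have hdet : (Matrix.of ![X, Y, e3 p, e4 M a p]).det =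
      e4 M a p 0 / rad p * (p 1 * (X 2 * Y 3 - X 3 * Y 2) + p 2 * (X 3 * Y 1 - X 1 * Y 3)
        + p 3 * (X 1 * Y 2 - X 2 * Y 1))
      - 2 * a / Sig a p / rad p *
        (X 0 * (rad p ^ 2 * Y 3 - p 3 * (p 1 * Y 1 + p 2 * Y 2 + p 3 * Y 3))
        - Y 0 * (rad p ^ 2 * X 3 - p 3 * (p 1 * X 1 + p 2 * X 2 + p 3 * X 3))) := by
    simp only [e3, rad_sq]
    simp [Matrix.det_succ_row_zero, Fin.sum_univ_succ, Fin.succAbove, e4_eq, dr, dt, axial]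
    ring
  have h0 : e4 M a p 0 = 2 * (rad p ^ 2 + a ^ 2) / Sig a p := by simp [e4]
  rw [hdet, h.p_dot_cross, hX, hY, hX0, hY0, h0]
  have h3 := h.third_sq
  have hS1 : Sig a p = rad p ^ 2 + a ^ 2 * cosθ p ^ 2 := rfl
  field_simp at h3 ⊢
  linear_combination -(a ^ 2 * rad p ^ 2) * h3 - rad p ^ 4 * hS1

end IsFrame

/-- The one-form metrically equivalent to a vector at `p`. -/
def flat (M a : ℝ) (p : Point) (V : Fin 4 → ℝ) : Fin 4 → ℝ := (metric M a p).mulVec V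

lemma flat_dot_comm (V W : Fin 4 → ℝ) : flat M a p V ⬝ᵥ W = flat M a p W ⬝ᵥ V :=
  mulVec_dot_comm (metric_isSymm p) V W

section Flat

variable (ha : |a| ≤ M) (hr : 0 < rad p)
include ha hr

lemma flat_e3_dot (V : Fin 4 → ℝ) : flat M a p (e3 p) ⬝ᵥ V = -(theta a p ⬝ᵥ V) := by
  rw [flat, metric_mulVec_e3 ha hr, neg_dotProduct]

lemma flat_e4_dot (V : Fin 4 → ℝ) :
    flat M a p (e4 M a p) ⬝ᵥ V = 2 * (dr p ⬝ᵥ V) - quot M a p * (theta a p ⬝ᵥ V) := by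
  rw [flat, metric_mulVec_e4 ha hr, sub_dotProduct, smul_dotProduct, smul_dotProduct, smul_eq_mul,
    smul_eq_mul]

lemma flat_dot (V W : Fin 4 → ℝ) : flat M a p V ⬝ᵥ W =
    Sig a p / rad p ^ 2 * (V 1 * W 1 + V 2 * W 2 + V 3 * W 3 - (dr p ⬝ᵥ V) * (dr p ⬝ᵥ W))
      - a * ((theta a p ⬝ᵥ V) * (sinSqdφ p ⬝ᵥ W) + (sinSqdφ p ⬝ᵥ V) * (theta a p ⬝ᵥ W))
      + (a ^ 2 * (1 - cosθ p ^ 2) / Sig a p - quot M a p) * ((theta a p ⬝ᵥ V) * (theta a p ⬝ᵥ W))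
      + ((dr p ⬝ᵥ V) * (theta a p ⬝ᵥ W) + (dr p ⬝ᵥ W) * (theta a p ⬝ᵥ V)) := by
  have h : spatial V ⬝ᵥ W = V 1 * W 1 + V 2 * W 2 + V 3 * W 3 := by
    simp [spatial, dotProduct, Fin.sum_univ_four]
  simp only [flat, metric_mulVec ha hr, add_dotProduct, sub_dotProduct, smul_dotProduct,
    smul_eq_mul, h]
  ring

lemma IsHor.flat_dot (hV : IsHor a p V) (W : Fin 4 → ℝ) : flat M a p V ⬝ᵥ W =
    Sig a p / rad p ^ 2 * (V 1 * W 1 + V 2 * W 2 + V 3 * W 3)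
      - a * (sinSqdφ p ⬝ᵥ V) * (theta a p ⬝ᵥ W) := by
  rw [Kerr.flat_dot ha hr, hV.theta_dot, hV.dr_dot]
  ring

end Flat

namespace IsFrame

variable (h : IsFrame a p X Y) (ha : |a| ≤ M)
include h ha

lemma isNullFrame : IsNullFrame (metric M a p) (e3 p) (e4 M a p) X Y where
  isSymm := metric_isSymm p
  KK := by rw [← flat, flat_e3_dot ha h.rad_pos, theta_dot_e3, neg_zero]
  KL := by rw [← flat, flat_e3_dot ha h.rad_pos, theta_dot_e4 h.rad_pos]
  KX := by rw [← flat, flat_e3_dot ha h.rad_pos, h.theta_X, neg_zero]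
  KY := by rw [← flat, flat_e3_dot ha h.rad_pos, h.theta_Y, neg_zero]
  LL := by
    rw [← flat, flat_e4_dot ha h.rad_pos, theta_dot_e4 h.rad_pos, dr_dot_e4 h.rad_pos]
    ring
  LX := by rw [← flat, flat_e4_dot ha h.rad_pos, h.theta_X, h.dr_X]; ring
  LY := by rw [← flat, flat_e4_dot ha h.rad_pos, h.theta_Y, h.dr_Y]; ring
  XX := by
    have hr := h.rad_pos.ne'
    have hS := h.Sig_ne_zero
    rw [← flat, h.isHor_X.flat_dot ha h.rad_pos, h.theta_X, ← pow_two, ← pow_two,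
      ← pow_two, h.norm_X]
    field_simp
    ring
  XY := by
    rw [← flat, h.isHor_X.flat_dot ha h.rad_pos, h.theta_Y, h.inner_XY]
    ring
  YY := by
    have hr := h.rad_pos.ne'
    have hS := h.Sig_ne_zero
    rw [← flat, h.isHor_Y.flat_dot ha h.rad_pos, h.theta_Y, ← pow_two, ← pow_two,
      ← pow_two, h.norm_Y]
    field_simp
    ring

lemma metricInv_apply (μ ν : Fin 4) : metricInv M a p μ ν =
    X μ * X ν + Y μ * Y ν - 1 / 2 * (e3 p μ * e4 M a p ν + e4 M a p μ * e3 p ν) :=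
  (h.isNullFrame ha).inv_apply μ ν

lemma hInv_apply (μ ν : Fin 4) : hInv M a p μ ν = X μ * X ν + Y μ * Y ν := by
  rw [hInv, Matrix.of_apply, h.metricInv_apply ha]
  ring

lemma proj_apply (μ ν : Fin 4) :
    proj M a p μ ν = X μ * flat M a p X ν + Y μ * flat M a p Y ν := by
  rw [proj, Matrix.of_apply, ← Matrix.one_apply, (h.isNullFrame ha).one_apply, lower_eq_mulVec,
    lower_eq_mulVec, flat, flat]
  ring

lemma hVol_apply (μ ν : Fin 4) :
    hVol M a p μ ν = flat M a p X μ * flat M a p Y ν - flat M a p X ν * flat M a p Y μ := by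
  have hN := h.isNullFrame ha
  have hE : 0 < (Matrix.of ![X, Y, e3 p, e4 M a p]).det := by
    have := Sig_pos a h.rad_pos
    have := h.rad_pos
    rw [h.det_frame]
    positivity
  rw [hVol, Matrix.of_apply, hN.sqrt_abs_det hE, hN.det_single_single, flat, flat]
  field_simp

end IsFrame

/-! ### The Levi-Civita connection -/

/-- The vector `Γ(Z, V)` given by the Christoffel symbols. -/
def Gam (M a : ℝ) (p : Point) (Z V : Fin 4 → ℝ) : Fin 4 → ℝ := fun κ =>
  ∑ μ, ∑ ν, Z μ * (V ν * christoffel M a p κ μ ν)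

/-- The vector `∇_Z e`. -/
def nab (M a : ℝ) (p : Point) (e : Field₁) (Z : Fin 4 → ℝ) : Fin 4 → ℝ :=
  der M a p e Z + Gam M a p Z (e p)

/-- The connection coefficient `g(∇_Z e, V)`. -/
def conn (M a : ℝ) (p : Point) (e : Field₁) (Z V : Fin 4 → ℝ) : ℝ :=
  flat M a p V ⬝ᵥ nab M a p e Z

/-- The derivative in the direction `Z` of the metric components, evaluated on `V`, `W`. -/
def derMetric (M a : ℝ) (p : Point) (Z V W : Fin 4 → ℝ) : ℝ :=
  der M a p (fun q => flat M a q V ⬝ᵥ W) Z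

/-- The covariant derivative `(∇_Z s)(V)` of a one-form. -/
def cov₁ (M a : ℝ) (p : Point) (s : Field₁) (Z V : Fin 4 → ℝ) : ℝ :=
  der M a p (fun q => s q ⬝ᵥ V) Z - s p ⬝ᵥ Gam M a p Z V

/-- The covariant derivative `(∇_Z F)(V, W)` of a two-tensor. -/
def cov₂ (M a : ℝ) (p : Point) (F : Field₂) (Z V W : Fin 4 → ℝ) : ℝ :=
  der M a p (fun q => (F q).mulVec W ⬝ᵥ V) Z - (F p).mulVec W ⬝ᵥ Gam M a p Z V
    - (F p).mulVec (Gam M a p Z W) ⬝ᵥ V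

lemma differentiableWithinAt_mulVec
    (hF : ∀ μ ν, DifferentiableWithinAt ℝ (fun q => F q μ ν) (exterior M a) p)
    (hs : DifferentiableWithinAt ℝ s (exterior M a) p) :
    DifferentiableWithinAt ℝ (fun q => (F q).mulVec (s q)) (exterior M a) p := by
  have hs' := differentiableWithinAt_pi.1 hs
  refine differentiableWithinAt_pi.2 fun μ => ?_
  simp only [Matrix.mulVec, dotProduct]
  exact .fun_sum fun ν _ => (hF μ ν).fun_mul (hs' ν)

lemma der_mulVec_dot (hu : UniqueDiffWithinAt ℝ (exterior M a) p)
    (hF : ∀ μ ν, DifferentiableWithinAt ℝ (fun q => F q μ ν) (exterior M a) p)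
    (Z V W : Fin 4 → ℝ) : der M a p (fun q => (F q).mulVec V ⬝ᵥ W) Z
      = ∑ μ, ∑ ν, ∑ l, Z μ * W ν * V l * pd M a (fun q => F q ν l) μ p := by
  have hFV := differentiableWithinAt_mulVec hF (differentiableWithinAt_const V)
  have hrow (ν) : der M a p (fun q => (F q).mulVec V ν) Z
      = ∑ l, der M a p (fun q => F q ν l) Z * V l := by
    rw [show (fun q => (F q).mulVec V ν) = fun q => (fun l => F q ν l) ⬝ᵥ V from rfl,
      der_dotProduct_const (s := fun q l => F q ν l) hu Z (differentiableWithinAt_pi.2 (hF ν)) V,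
      dotProduct]
    simp only [der_apply hu Z (differentiableWithinAt_pi.2 (hF ν))]
  rw [der_dotProduct_const hu Z hFV, dotProduct]
  simp only [der_apply hu Z hFV, hrow, ← sum_mul_pd, Fin.sum_univ_four]
  ring

lemma sum_mul_covVector (hu : UniqueDiffWithinAt ℝ (exterior M a) p)
    (he : DifferentiableWithinAt ℝ e (exterior M a) p) (Z : Fin 4 → ℝ) (ν : Fin 4) :
    ∑ μ, Z μ * covVector M a e p μ ν = nab M a p e Z ν := by
  rw [nab, Pi.add_apply, der_apply hu Z he, ← sum_mul_pd]
  simp only [covVector, Gam, Fin.sum_univ_four]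
  ring

lemma sum_mul_covForm (hu : UniqueDiffWithinAt ℝ (exterior M a) p)
    (hs : DifferentiableWithinAt ℝ s (exterior M a) p) (Z V : Fin 4 → ℝ) :
    ∑ μ, ∑ ν, Z μ * V ν * covForm M a s p μ ν = cov₁ M a p s Z V := by
  rw [cov₁, der_dotProduct_const hu Z hs]
  simp only [dotProduct, der_apply hu Z hs, ← sum_mul_pd, covForm, Gam, Fin.sum_univ_four]
  ring

lemma sum_mul_covTwo (hu : UniqueDiffWithinAt ℝ (exterior M a) p)
    (hF : ∀ μ ν, DifferentiableWithinAt ℝ (fun q => F q μ ν) (exterior M a) p)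
    (Z V W : Fin 4 → ℝ) :
    ∑ μ, ∑ ν, ∑ l, Z μ * V ν * W l * covTwo M a F p μ ν l = cov₂ M a p F Z V W := by
  rw [cov₂, der_mulVec_dot hu hF]
  simp only [covTwo, Gam, Matrix.mulVec, dotProduct, Fin.sum_univ_four]
  ring

lemma christoffel_symm (κ μ ν : Fin 4) : christoffel M a p κ μ ν = christoffel M a p κ ν μ := by
  have h : (fun q => metric M a q μ ν) = fun q => metric M a q ν μ :=
    funext fun q => (metric_isSymm q).apply ν μ
  simp only [christoffel, h, add_comm]

lemma Gam_comm (Z V : Fin 4 → ℝ) : Gam M a p Z V = Gam M a p V Z := by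
  funext κ
  rw [Gam, Gam, Finset.sum_comm]
  refine Finset.sum_congr rfl fun μ _ => Finset.sum_congr rfl fun ν _ => ?_
  rw [christoffel_symm]
  ring

lemma derMetric_comm (Z V W : Fin 4 → ℝ) : derMetric M a p Z V W = derMetric M a p Z W V := by
  simp only [derMetric, flat_dot_comm]

lemma conn_sub_conn_eq_bracket (V : Fin 4 → ℝ) :
    conn M a p e' (e p) V - conn M a p e (e' p) V
      = flat M a p V ⬝ᵥ (der M a p e' (e p) - der M a p e (e' p)) := by
  rw [conn, conn, nab, nab, Gam_comm (e' p), ← dotProduct_sub]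
  congr 1
  abel

section Koszul

variable (hM : 0 < M) (ha : |a| ≤ M) (hp : p ∈ exterior M a)
include hM hp

lemma differentiableWithinAt_lower (he : DifferentiableWithinAt ℝ e (exterior M a) p) :
    DifferentiableWithinAt ℝ (lower M a e) (exterior M a) p :=
  differentiableWithinAt_mulVec
    (fun μ ν => (differentiableAt_metric (rad_pos hM hp) μ ν).differentiableWithinAt) he

lemma derMetric_eq_sum (Z V W : Fin 4 → ℝ) : derMetric M a p Z V W
    = ∑ μ, ∑ ν, ∑ l, Z μ * W ν * V l * pd M a (fun q => metric M a q ν l) μ p :=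
  der_mulVec_dot (uniqueDiffWithinAt_exterior hM hp)
    (fun μ ν => (differentiableAt_metric (rad_pos hM hp) μ ν).differentiableWithinAt) Z V W

include ha

lemma sum_metric_mul_christoffel (l μ ν : Fin 4) :
    ∑ κ, metric M a p l κ * christoffel M a p κ μ ν = 1 / 2 *
      (pd M a (fun q => metric M a q l ν) μ p + pd M a (fun q => metric M a q l μ) ν p
        - pd M a (fun q => metric M a q μ ν) l p) := by
  obtain ⟨X, Y, hXY⟩ := exists_isFrame a (rad_pos hM hp)
  let k : Fin 4 → ℝ := fun l => pd M a (fun q => metric M a q l ν) μ p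
    + pd M a (fun q => metric M a q l μ) ν p - pd M a (fun q => metric M a q μ ν) l p
  have hk : (metric M a p).mulVec ((1 / 2 : ℝ) • (metricInv M a p).mulVec k) = (1 / 2 : ℝ) • k := by
    rw [Matrix.mulVec_smul, Matrix.mulVec_mulVec, metricInv,
      Matrix.mul_nonsing_inv _ (hXY.isNullFrame ha).isUnit_det, Matrix.one_mulVec]
  exact congrFun hk l

lemma flat_dot_Gam (Z V W : Fin 4 → ℝ) : flat M a p W ⬝ᵥ Gam M a p Z V =
    1 / 2 * (derMetric M a p Z V W + derMetric M a p V Z W - derMetric M a p W Z V) := by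
  have h : flat M a p W ⬝ᵥ Gam M a p Z V
      = ∑ l, ∑ μ, ∑ ν, W l * Z μ * V ν * ∑ κ, metric M a p l κ * christoffel M a p κ μ ν := by
    rw [flat_dot_comm, flat]
    simp only [Matrix.mulVec, dotProduct, Gam, Fin.sum_univ_four]
    ring
  rw [h, derMetric_comm W]
  simp only [sum_metric_mul_christoffel hM ha hp, derMetric_eq_sum hM hp, Fin.sum_univ_four]
  ring

lemma conn_eq (Z V : Fin 4 → ℝ) : conn M a p e Z V = flat M a p V ⬝ᵥ der M a p e Z
    + 1 / 2 * (derMetric M a p Z (e p) V + derMetric M a p (e p) Z V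
      - derMetric M a p V Z (e p)) := by
  rw [conn, nab, dotProduct_add, flat_dot_Gam hM ha hp]

lemma conn_add_conn (Z V : Fin 4 → ℝ) : conn M a p e Z V + conn M a p e V Z =
    derMetric M a p (e p) Z V + flat M a p V ⬝ᵥ der M a p e Z
      + flat M a p Z ⬝ᵥ der M a p e V := by
  rw [conn_eq hM ha hp, conn_eq hM ha hp, derMetric_comm Z (e p), derMetric_comm V (e p),
    derMetric_comm (e p) V]
  ring

section Differentiable

variable (he : DifferentiableWithinAt ℝ e (exterior M a) p)
include he

lemma cov₁_lower (Z V : Fin 4 → ℝ) : cov₁ M a p (lower M a e) Z V = conn M a p e Z V := by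
  have hder : der M a p (fun q => lower M a e q ⬝ᵥ V) Z
      = derMetric M a p Z V (e p) + flat M a p V ⬝ᵥ der M a p e Z := by
    rw [show (fun q => lower M a e q ⬝ᵥ V) = fun q => flat M a q V ⬝ᵥ e q from
      funext fun q => flat_dot_comm (e q) V]
    have hu := uniqueDiffWithinAt_exterior hM hp
    have hV := differentiableWithinAt_lower hM hp (differentiableWithinAt_const V)
    rw [derMetric, der_dotProduct_const (s := fun q => flat M a q V) hu Z hV]
    exact der_dotProduct hu Z hV he
  rw [cov₁, hder, lower_eq_mulVec, ← flat, flat_dot_Gam hM ha hp, conn_eq hM ha hp,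
    derMetric_comm Z V, derMetric_comm V Z]
  ring

lemma conn_sub_conn (Z V : Fin 4 → ℝ) : conn M a p e Z V - conn M a p e V Z =
    der M a p (fun q => lower M a e q ⬝ᵥ V) Z - der M a p (fun q => lower M a e q ⬝ᵥ Z) V := by
  rw [← cov₁_lower hM ha hp he, ← cov₁_lower hM ha hp he, cov₁, cov₁, Gam_comm]
  ring

omit ha in
lemma cov₁_of_dot_const {c : ℝ} (hs : DifferentiableWithinAt ℝ s (exterior M a) p)
    (h : ∀ q ∈ exterior M a, s q ⬝ᵥ e q = c) (Z : Fin 4 → ℝ) :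
    cov₁ M a p s Z (e p) = -(s p ⬝ᵥ nab M a p e Z) := by
  have hu := uniqueDiffWithinAt_exterior hM hp
  have hder := der_dotProduct hu Z hs he
  rw [der_congr h hp, der_const] at hder
  rw [cov₁, der_dotProduct_const hu Z hs, nab, dotProduct_add]
  linarith

lemma conn_of_dot_const {c : ℝ} (he' : DifferentiableWithinAt ℝ e' (exterior M a) p)
    (h : ∀ q ∈ exterior M a, flat M a q (e q) ⬝ᵥ e' q = c) (Z : Fin 4 → ℝ) :
    conn M a p e Z (e' p) = -conn M a p e' Z (e p) := by
  rw [← cov₁_lower hM ha hp he, cov₁_of_dot_const hM hp he' (differentiableWithinAt_lower hM hp he)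
    h, conn, lower_eq_mulVec, flat]

end Differentiable

end Koszul

/-! ### Derivatives of the null vectors and of the metric -/

/-- The exterior derivative of the one-form `sin² θ dφ̄`. -/
def dSin (p : Point) (Z V : Fin 4 → ℝ) : ℝ :=
  2 * (Z 1 * V 2 - Z 2 * V 1) / rad p ^ 2
    - 2 / rad p * ((dr p ⬝ᵥ Z) * (sinSqdφ p ⬝ᵥ V) - (dr p ⬝ᵥ V) * (sinSqdφ p ⬝ᵥ Z))

lemma dSin_comm (Z V : Fin 4 → ℝ) : dSin p Z V = -dSin p V Z := by unfold dSin; ring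

lemma dSin_e3 (hr : 0 < rad p) (V : Fin 4 → ℝ) : dSin p (e3 p) V = 0 := by
  rw [dSin, dr_dot_e3 hr, sinSqdφ_dot_e3, sinSqdφ_dot]
  simp only [e3, Matrix.cons_val]
  field_simp
  ring

lemma IsHor.dSin_eq (hU : IsHor a p U) (hV : IsHor a p V) :
    dSin p U V = 2 * (U 1 * V 2 - U 2 * V 1) / rad p ^ 2 := by
  rw [dSin, hU.dr_dot, hV.dr_dot]; ring

lemma IsHor.dSin_e4 (hU : IsHor a p U) (hr : 0 < rad p) :
    dSin p (e4 M a p) U = 4 * a * cosθ p / Sig a p * (U 3 / rad p) := by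
  have hS := (Sig_pos a hr).ne'
  rw [dSin, dr_dot_e4 hr, hU.dr_dot, sinSqdφ_dot]
  simp only [e4_eq, dt, dr, axial, cosθ, Pi.add_apply, Pi.smul_apply, smul_eq_mul, Matrix.cons_val]
  field_simp
  linear_combination -4 * a * rad p * hU.p_dot hr

lemma differentiableAt_dotProduct_const (hs : DifferentiableAt ℝ s p) (V : Fin 4 → ℝ) :
    DifferentiableAt ℝ (fun q => s q ⬝ᵥ V) p := by
  simp only [dotProduct_comm _ V]
  exact (covector V).differentiableAt.comp p hs

section Derivatives

variable (hu : UniqueDiffWithinAt ℝ (exterior M a) p) (hr : 0 < rad p)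
include hu

lemma der_axial (Z : Fin 4 → ℝ) : der M a p axial Z = axial Z := by
  have hc (μ : Fin 4) : der M a p (fun q => q μ) Z = Z μ :=
    der_of_hasFDerivAt hu Z (hasFDerivAt_apply μ p)
  have hn : der M a p (fun q => -q 2) Z = -Z 2 :=
    der_of_hasFDerivAt hu Z (hasFDerivAt_apply 2 p).neg
  ext ν
  rw [der_apply hu Z differentiableAt_axial.differentiableWithinAt]
  fin_cases ν <;> simp [axial, hc, hn] <;> simp [der]

include hr

lemma der_sinSqdφ_dot (Z V : Fin 4 → ℝ) : der M a p (fun q => sinSqdφ q ⬝ᵥ V) Z = 1 / 2 * dSin p Z V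
    - 1 / rad p * ((dr p ⬝ᵥ Z) * (sinSqdφ p ⬝ᵥ V) + (dr p ⬝ᵥ V) * (sinSqdφ p ⬝ᵥ Z)) := by
  have hc (μ : Fin 4) : HasFDerivAt (fun q : Point => q μ) (.proj μ : Point →L[ℝ] ℝ) p :=
    hasFDerivAt_apply μ p
  simp only [sinSqdφ_dot, dSin]
  rw [der_of_hasFDerivAt hu Z (hasFDerivAt_div
    (((hc 1).mul_const (V 2)).fun_sub ((hc 2).mul_const (V 1)))
    (g := fun q => rad q ^ 2) ((hasFDerivAt_rad hr).pow 2)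
    (pow_ne_zero 2 hr.ne'))]
  simp only [smul_apply, sub_apply, ContinuousLinearMap.proj_apply, covector_apply, smul_eq_mul]
  field_simp
  ring

lemma der_theta_dot (Z V : Fin 4 → ℝ) : der M a p (fun q => theta a q ⬝ᵥ V) Z
    = -a * der M a p (fun q => sinSqdφ q ⬝ᵥ V) Z := by
  have hs := (differentiableAt_dotProduct_const (differentiableAt_sinSqdφ hr) V).hasFDerivAt
  simp only [theta_dot]
  rw [der_of_hasFDerivAt hu Z ((hs.const_mul a).const_sub _), der_of_hasFDerivAt hu Z hs]
  simp

lemma der_dr (Z : Fin 4 → ℝ) :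
    der M a p dr Z = (1 / rad p) • (spatial Z - (dr p ⬝ᵥ Z) • dr p) := by
  have key (i : Fin 4) : der M a p (fun q => q i / rad q) Z
      = 1 / rad p * (Z i - (dr p ⬝ᵥ Z) * (p i / rad p)) := by
    rw [der_of_hasFDerivAt hu Z (hasFDerivAt_div (hasFDerivAt_apply i p) (hasFDerivAt_rad hr)
      hr.ne')]
    simp only [smul_apply, sub_apply, ContinuousLinearMap.proj_apply, covector_apply, smul_eq_mul]
    ring
  ext ν
  rw [der_apply hu Z (differentiableAt_dr hr).differentiableWithinAt]
  fin_cases ν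
  · simp [dr, spatial, der]
  · exact key 1
  · exact key 2
  · exact key 3

lemma der_e3 (Z : Fin 4 → ℝ) : der M a p e3 Z = -der M a p dr Z := by
  have h := (differentiableAt_dr hr).hasFDerivAt
  rw [funext e3_eq, der_of_hasFDerivAt hu Z h.fun_neg, der_of_hasFDerivAt hu Z h]
  rfl

lemma der_e4 (Z : Fin 4 → ℝ) : der M a p (e4 M a) Z
    = (4 * rad p / Sig a p * (dr p ⬝ᵥ Z)
        - 2 * (rad p ^ 2 + a ^ 2) / Sig a p ^ 2 * der M a p (Sig a) Z) • dt p
      + (der M a p (quot M a) Z • dr p + quot M a p • der M a p dr Z)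
      + (2 * a / Sig a p) • axial Z
      - (2 * a / Sig a p ^ 2 * der M a p (Sig a) Z) • axial p := by
  have hS := (Sig_pos a hr).ne'
  have hSig := hasFDerivAt_Sig (a := a) hr
  have hq := hasFDerivAt_quot (M := M) (a := a) hr
  have hd := (differentiableAt_dr hr).hasFDerivAt
  have hx := (differentiableAt_axial (p := p)).hasFDerivAt
  have hT := hasFDerivAt_div (f := fun q => 2 * (rad q ^ 2 + a ^ 2))
    ((((hasFDerivAt_rad hr).pow 2).add_const _).const_mul 2) hSig hS
  have hB := hasFDerivAt_div (hasFDerivAt_const (2 * a) p) hSig hS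
  have h := ((hT.fun_smul (hasFDerivAt_const (dt p) p)).fun_add (hq.fun_smul hd)).fun_add
    (hB.fun_smul hx)
  rw [show e4 M a = _ from funext e4_eq]
  refine (der_of_hasFDerivAt hu Z h).trans ?_
  have hxZ : fderiv ℝ axial p Z = axial Z :=
    (der_of_hasFDerivAt hu Z hx).symm.trans (der_axial hu Z)
  rw [der_of_hasFDerivAt hu Z hSig, der_of_hasFDerivAt hu Z hq, der_of_hasFDerivAt hu Z hd]
  ext ν
  simp only [smul_zero, Nat.add_one_sub_one, pow_one, nsmul_eq_mul, Nat.cast_ofNat, zero_add,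
    zero_sub, smul_neg, add_apply, ContinuousLinearMap.smulRight_apply, smul_apply, sub_apply,
    covector_apply, smul_eq_mul, add_dotProduct, smul_dotProduct, sub_dotProduct, hxZ, neg_apply,
    neg_smul, Pi.add_apply, Pi.smul_apply, Pi.neg_apply, Pi.sub_apply]
  field_simp
  ring

end Derivatives

section Metric

variable (ha : |a| ≤ M) (hr : 0 < rad p)
include ha hr

namespace IsHor

variable (hU : IsHor a p U)
include hU

lemma flat_dot_dt : flat M a p U ⬝ᵥ dt p = -(a * (sinSqdφ p ⬝ᵥ U)) := by
  rw [hU.flat_dot ha hr, Kerr.theta_dot, sinSqdφ_dot_dt]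
  simp [dt]

lemma flat_dot_dr : flat M a p U ⬝ᵥ dr p = 0 := by
  rw [hU.flat_dot ha hr, Kerr.theta_dot, sinSqdφ_dot_dr]
  simp only [dr, Matrix.cons_val]
  field_simp
  linear_combination Sig a p * hU.p_dot hr

lemma flat_dot_spatial (V : Fin 4 → ℝ) : flat M a p U ⬝ᵥ spatial V
    = Sig a p / rad p ^ 2 * (U 1 * V 1 + U 2 * V 2 + U 3 * V 3)
      + a ^ 2 * ((sinSqdφ p ⬝ᵥ U) * (sinSqdφ p ⬝ᵥ V)) := by
  rw [hU.flat_dot ha hr, Kerr.theta_dot, sinSqdφ_dot (spatial V), sinSqdφ_dot V]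
  simp only [spatial, Matrix.cons_val]
  ring

lemma flat_dot_axial (V : Fin 4 → ℝ) : flat M a p U ⬝ᵥ axial V
    = Sig a p / rad p ^ 2 * (U 2 * V 1 - U 1 * V 2)
      + a ^ 2 * ((sinSqdφ p ⬝ᵥ U) * (sinSqdφ p ⬝ᵥ axial V)) := by
  rw [hU.flat_dot ha hr, Kerr.theta_dot]
  simp only [axial, Matrix.cons_val]
  ring

lemma flat_dot_axial_self :
    flat M a p U ⬝ᵥ axial p = (rad p ^ 2 + a ^ 2) * (sinSqdφ p ⬝ᵥ U) := by
  rw [hU.flat_dot_axial ha hr, sinSqdφ_dot_axial hr, Sig, sinSqdφ_dot]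
  field_simp
  ring

end IsHor

end Metric

section Derivatives

variable (hM : 0 < M) (ha : |a| ≤ M) (hp : p ∈ exterior M a)
include hM ha hp

lemma d_lower_e3 (Z V : Fin 4 → ℝ) : der M a p (fun q => lower M a e3 q ⬝ᵥ V) Z
    - der M a p (fun q => lower M a e3 q ⬝ᵥ Z) V = a * dSin p Z V := by
  have hr := rad_pos hM hp
  have hu := uniqueDiffWithinAt_exterior hM hp
  have key (Z V) : der M a p (fun q => lower M a e3 q ⬝ᵥ V) Z
      = a * der M a p (fun q => sinSqdφ q ⬝ᵥ V) Z := by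
    refine (der_congr (fun q hq => flat_e3_dot ha (rad_pos hM hq) V) hp Z).trans ?_
    have ht :=
      (differentiableAt_dotProduct_const (differentiableAt_theta (a := a) hr) V).hasFDerivAt
    rw [der_of_hasFDerivAt hu Z ht.fun_neg, neg_apply,
      ← der_of_hasFDerivAt hu Z ht, der_theta_dot hu hr]
    ring
  rw [key, key, der_sinSqdφ_dot hu hr, der_sinSqdφ_dot hu hr, dSin_comm V]
  ring

lemma d_lower_e4 (Z V : Fin 4 → ℝ) : der M a p (fun q => lower M a (e4 M a) q ⬝ᵥ V) Z
    - der M a p (fun q => lower M a (e4 M a) q ⬝ᵥ Z) V = quot M a p * a * dSin p Z V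
      - (der M a p (quot M a) Z * (theta a p ⬝ᵥ V)
        - der M a p (quot M a) V * (theta a p ⬝ᵥ Z)) := by
  have hr := rad_pos hM hp
  have hu := uniqueDiffWithinAt_exterior hM hp
  have key (Z V) : der M a p (fun q => lower M a (e4 M a) q ⬝ᵥ V) Z
      = 2 * (der M a p dr Z ⬝ᵥ V) - quot M a p * (-a * der M a p (fun q => sinSqdφ q ⬝ᵥ V) Z)
        - (theta a p ⬝ᵥ V) * der M a p (quot M a) Z := by
    have hd := (differentiableAt_dotProduct_const (differentiableAt_dr hr) V).hasFDerivAt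
    have ht :=
      (differentiableAt_dotProduct_const (differentiableAt_theta (a := a) hr) V).hasFDerivAt
    have hq := (hasFDerivAt_quot (M := M) (a := a) hr)
    refine (der_congr (fun q hq => flat_e4_dot ha (rad_pos hM hq) V) hp Z).trans ?_
    rw [der_of_hasFDerivAt hu Z ((hd.const_mul 2).fun_sub (hq.fun_mul ht)), ← der_theta_dot hu hr,
      ← der_dotProduct_const hu Z (differentiableAt_dr hr).differentiableWithinAt,
      der_of_hasFDerivAt hu Z hd, der_of_hasFDerivAt hu Z ht, der_of_hasFDerivAt hu Z hq]
    simp only [sub_apply, smul_apply, smul_eq_mul, add_apply, covector_apply, sub_dotProduct,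
      smul_dotProduct]
    ring
  have hsymm : der M a p dr Z ⬝ᵥ V = der M a p dr V ⬝ᵥ Z := by
    rw [der_dr hu hr, der_dr hu hr]
    simp only [smul_dotProduct, sub_dotProduct, smul_eq_mul]
    simp only [spatial, dotProduct, Fin.sum_univ_four, Matrix.cons_val]
    ring
  rw [key, key, der_sinSqdφ_dot hu hr, der_sinSqdφ_dot hu hr, dSin_comm V, hsymm]
  ring

namespace IsHor

variable (hU : IsHor a p U)
include hU

lemma flat_dot_der_e3 (Z : Fin 4 → ℝ) : flat M a p U ⬝ᵥ der M a p e3 Z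
    = -(1 / rad p * (flat M a p U ⬝ᵥ spatial Z)) := by
  have hr := rad_pos hM hp
  have hu := uniqueDiffWithinAt_exterior hM hp
  rw [der_e3 hu hr, der_dr hu hr, dotProduct_neg, dotProduct_smul, dotProduct_sub, dotProduct_smul,
    hU.flat_dot_dr ha hr, smul_zero, sub_zero, smul_eq_mul]

lemma flat_dot_der_e4 (Z : Fin 4 → ℝ) : flat M a p U ⬝ᵥ der M a p (e4 M a) Z
    = -(4 * a * rad p / Sig a p * (dr p ⬝ᵥ Z) * (sinSqdφ p ⬝ᵥ U))
      + quot M a p / rad p * (flat M a p U ⬝ᵥ spatial Z)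
      + 2 * a / Sig a p * (flat M a p U ⬝ᵥ axial Z) := by
  have hr := rad_pos hM hp
  have hu := uniqueDiffWithinAt_exterior hM hp
  have hS := (Sig_pos a hr).ne'
  rw [der_e4 hu hr]
  simp only [dotProduct_add, dotProduct_smul, smul_eq_mul, hU.flat_dot_dt ha hr,
    hU.flat_dot_dr ha hr, hU.flat_dot_axial_self ha hr, der_dr hu hr, dotProduct_sub]
  field_simp
  ring

lemma derMetric_eq (hV : IsHor a p V) (Z : Fin 4 → ℝ) : derMetric M a p Z U V
    = (der M a p (Sig a) Z - 2 * Sig a p / rad p * (dr p ⬝ᵥ Z)) / rad p ^ 2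
        * (U 1 * V 1 + U 2 * V 2 + U 3 * V 3)
      + a ^ 2 * ((sinSqdφ p ⬝ᵥ U) * der M a p (fun q => sinSqdφ q ⬝ᵥ V) Z
        + (sinSqdφ p ⬝ᵥ V) * der M a p (fun q => sinSqdφ q ⬝ᵥ U) Z) := by
  have hr := rad_pos hM hp
  have hu := uniqueDiffWithinAt_exterior hM hp
  have hS := (Sig_pos a hr).ne'
  have hSig := hasFDerivAt_Sig (a := a) hr
  have hd (W) := (differentiableAt_dotProduct_const (differentiableAt_dr hr) W).hasFDerivAt
  have hs (W) := (differentiableAt_dotProduct_const (differentiableAt_sinSqdφ hr) W).hasFDerivAt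
  have ht (W) :=
    (differentiableAt_dotProduct_const (differentiableAt_theta (a := a) hr) W).hasFDerivAt
  have hk : DifferentiableAt ℝ (fun q => a ^ 2 * (1 - cosθ q ^ 2) / Sig a q - quot M a q) p := by
    have := (hasFDerivAt_cosθ hr).differentiableAt
    have := hSig.differentiableAt
    have := (hasFDerivAt_quot (M := M) (a := a) hr).differentiableAt
    fun_prop (disch := assumption)
  have h := (((hasFDerivAt_div hSig (g := fun q => rad q ^ 2) ((hasFDerivAt_rad hr).pow 2)
    (pow_ne_zero 2 hr.ne')).fun_mul (((hd U).fun_mul (hd V)).const_sub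
    (U 1 * V 1 + U 2 * V 2 + U 3 * V 3))).fun_sub
    ((((ht U).fun_mul (hs V)).fun_add ((hs U).fun_mul (ht V))).const_mul a)).fun_add
    (hk.hasFDerivAt.fun_mul ((ht U).fun_mul (ht V))) |>.fun_add
    (((hd U).fun_mul (ht V)).fun_add ((hd V).fun_mul (ht U)))
  rw [derMetric, der_congr (fun q hq => Kerr.flat_dot ha (rad_pos hM hq) U V) hp,
    der_of_hasFDerivAt hu Z h, der_of_hasFDerivAt hu Z hSig]
  simp only [hU.theta_dot, hU.dr_dot, hV.theta_dot, hV.dr_dot]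
  simp only [zero_smul, add_zero, neg_zero, smul_zero, mul_zero, sub_zero, Nat.add_one_sub_one,
    pow_one, nsmul_eq_mul, Nat.cast_ofNat, zero_add, smul_add, sub_apply, smul_apply,
    covector_apply, add_dotProduct, smul_dotProduct, smul_eq_mul, add_apply,
    ← der_of_hasFDerivAt hu Z (ht _), der_theta_dot hu hr, neg_mul, mul_neg]
  field_simp
  ring

end IsHor

omit ha in
lemma der_sinSqdφ_dot_e3 (V : Fin 4 → ℝ) :
    der M a p (fun q => sinSqdφ q ⬝ᵥ V) (e3 p) = (sinSqdφ p ⬝ᵥ V) / rad p := by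
  have hr := rad_pos hM hp
  rw [der_sinSqdφ_dot (uniqueDiffWithinAt_exterior hM hp) hr, dSin_e3 hr, dr_dot_e3 hr,
    sinSqdφ_dot_e3]
  ring

omit ha in
lemma IsHor.der_sinSqdφ_dot_e4 (hU : IsHor a p U) :
    der M a p (fun q => sinSqdφ q ⬝ᵥ U) (e4 M a p) = 2 * a * cosθ p / Sig a p * (U 3 / rad p)
      - quot M a p / rad p * (sinSqdφ p ⬝ᵥ U) := by
  have hr := rad_pos hM hp
  rw [der_sinSqdφ_dot (uniqueDiffWithinAt_exterior hM hp) hr, hU.dSin_e4 hr, dr_dot_e4 hr,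
    hU.dr_dot]
  ring

end Derivatives

/-! ### The connection coefficients of the null vectors -/

lemma flat_e3_dot_e3 (ha : |a| ≤ M) (hr : 0 < rad p) : flat M a p (e3 p) ⬝ᵥ e3 p = 0 := by
  rw [flat_e3_dot ha hr, theta_dot_e3, neg_zero]

lemma flat_e4_dot_e4 (ha : |a| ≤ M) (hr : 0 < rad p) :
    flat M a p (e4 M a p) ⬝ᵥ e4 M a p = 0 := by
  rw [flat_e4_dot ha hr, theta_dot_e4 hr, dr_dot_e4 hr]; ring

lemma flat_e4_dot_e3 (ha : |a| ≤ M) (hr : 0 < rad p) :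
    flat M a p (e4 M a p) ⬝ᵥ e3 p = -2 := by
  rw [flat_dot_comm, flat_e3_dot ha hr, theta_dot_e4 hr]

lemma IsHor.sinSqdφ_dot_axial (hU : IsHor a p U) (hr : 0 < rad p) :
    sinSqdφ p ⬝ᵥ axial U = -(cosθ p * (U 3 / rad p)) := by
  rw [sinSqdφ_dot, cosθ]
  simp only [axial, Matrix.cons_val]
  field_simp
  linear_combination hU.p_dot hr

section Connection

variable (hM : 0 < M) (ha : |a| ≤ M) (hp : p ∈ exterior M a)
include hM ha hp

lemma conn_e3_to_e3 (Z : Fin 4 → ℝ) : conn M a p e3 Z (e3 p) = 0 := by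
  have he := (differentiableAt_e3 (rad_pos hM hp)).differentiableWithinAt (s := exterior M a)
  linarith [conn_of_dot_const hM ha hp he he (fun q hq => flat_e3_dot_e3 ha (rad_pos hM hq)) Z]

lemma conn_e4_to_e4 (Z : Fin 4 → ℝ) : conn M a p (e4 M a) Z (e4 M a p) = 0 := by
  have he := (differentiableAt_e4 (M := M) (a := a) (rad_pos hM hp)).differentiableWithinAt
    (s := exterior M a)
  linarith [conn_of_dot_const hM ha hp he he (fun q hq => flat_e4_dot_e4 ha (rad_pos hM hq)) Z]

lemma conn_e4_to_e3 (Z : Fin 4 → ℝ) :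
    conn M a p (e4 M a) Z (e3 p) = -conn M a p e3 Z (e4 M a p) :=
  conn_of_dot_const hM ha hp (differentiableAt_e4 (rad_pos hM hp)).differentiableWithinAt
    (differentiableAt_e3 (rad_pos hM hp)).differentiableWithinAt
    (fun _ hq => flat_e4_dot_e3 ha (rad_pos hM hq)) Z

lemma conn_e3_sub_conn (Z V : Fin 4 → ℝ) :
    conn M a p e3 Z V - conn M a p e3 V Z = a * dSin p Z V := by
  rw [conn_sub_conn hM ha hp (differentiableAt_e3 (rad_pos hM hp)).differentiableWithinAt,
    d_lower_e3 hM ha hp]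

lemma conn_e4_sub_conn (Z V : Fin 4 → ℝ) :
    conn M a p (e4 M a) Z V - conn M a p (e4 M a) V Z = quot M a p * a * dSin p Z V
      - (der M a p (quot M a) Z * (theta a p ⬝ᵥ V)
        - der M a p (quot M a) V * (theta a p ⬝ᵥ Z)) := by
  rw [conn_sub_conn hM ha hp (differentiableAt_e4 (rad_pos hM hp)).differentiableWithinAt,
    d_lower_e4 hM ha hp]

lemma conn_e3_along_e3 (V : Fin 4 → ℝ) : conn M a p e3 (e3 p) V = 0 := by
  have h := conn_e3_sub_conn hM ha hp (e3 p) V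
  rwa [dSin_e3 (rad_pos hM hp), conn_e3_to_e3 hM ha hp, sub_zero, mul_zero] at h

omit ha in
lemma der_Sig (Z : Fin 4 → ℝ) :
    der M a p (Sig a) Z = 2 * rad p * (dr p ⬝ᵥ Z) + 2 * a ^ 2 * cosθ p * (dcos p ⬝ᵥ Z) := by
  rw [der_of_hasFDerivAt (uniqueDiffWithinAt_exterior hM hp) Z (hasFDerivAt_Sig (rad_pos hM hp)),
    covector_apply, add_dotProduct, smul_dotProduct, smul_dotProduct, smul_eq_mul, smul_eq_mul]

omit ha in
lemma der_quot (Z : Fin 4 → ℝ) : der M a p (quot M a) Z = quotR M a p * (dr p ⬝ᵥ Z)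
    - 2 * a ^ 2 * cosθ p * quot M a p / Sig a p * (dcos p ⬝ᵥ Z) := by
  rw [der_of_hasFDerivAt (uniqueDiffWithinAt_exterior hM hp) Z (hasFDerivAt_quot (rad_pos hM hp)),
    covector_apply, sub_dotProduct, smul_dotProduct, smul_dotProduct, smul_eq_mul, smul_eq_mul]

lemma conn_e3_e4_e4 : conn M a p e3 (e4 M a p) (e4 M a p) = 2 * quotR M a p := by
  have hr := rad_pos hM hp
  have h := conn_e4_sub_conn hM ha hp (e4 M a p) (e3 p)
  rw [dSin_comm, dSin_e3 hr, conn_e4_to_e4 hM ha hp, conn_e4_to_e3 hM ha hp, theta_dot_e3,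
    theta_dot_e4 hr, der_quot hM hp (e3 p), dcos_dot_e3 hr, dr_dot_e3 hr] at h
  linarith

namespace IsHor

variable (hU : IsHor a p U)
include hU

lemma conn_e4_e4 : conn M a p (e4 M a) (e4 M a p) U = 0 := by
  have hr := rad_pos hM hp
  have h := conn_e4_sub_conn hM ha hp (e4 M a p) U
  rw [hU.dSin_e4 hr, conn_e4_to_e4 hM ha hp, hU.theta_dot, theta_dot_e4 hr, der_quot hM hp U,
    hU.dcos_dot, hU.dr_dot] at h
  linear_combination h

lemma conn_e3 (hV : IsHor a p V) : conn M a p e3 U V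
    = -(U 1 * V 1 + U 2 * V 2 + U 3 * V 3) / rad p + a * (U 1 * V 2 - U 2 * V 1) / rad p ^ 2 := by
  have hr := rad_pos hM hp
  have hskew := conn_e3_sub_conn hM ha hp U V
  have hsymm := conn_add_conn (e := e3) hM ha hp U V
  rw [hU.dSin_eq hV] at hskew
  rw [hU.derMetric_eq hM ha hp hV, der_sinSqdφ_dot_e3 hM hp, der_sinSqdφ_dot_e3 hM hp,
    der_Sig hM hp, dr_dot_e3 hr, dcos_dot_e3 hr, hU.flat_dot_der_e3 hM ha hp,
    hV.flat_dot_der_e3 hM ha hp, hU.flat_dot_spatial ha hr, hV.flat_dot_spatial ha hr] at hsymm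
  field_simp at hskew hsymm ⊢
  refine mul_left_cancel₀ hr.ne' ?_
  linear_combination rad p / 2 * hskew + 1 / 2 * hsymm

lemma conn_e4 (hV : IsHor a p V) : conn M a p (e4 M a) U V
    = quot M a p * (U 1 * V 1 + U 2 * V 2 + U 3 * V 3) / rad p
      + quot M a p * a * (U 1 * V 2 - U 2 * V 1) / rad p ^ 2 := by
  have hr := rad_pos hM hp
  have hS := (Sig_pos a hr).ne'
  have hskew := conn_e4_sub_conn hM ha hp U V
  have hsymm := conn_add_conn (e := e4 M a) hM ha hp U V
  rw [hU.dSin_eq hV, hU.theta_dot, hV.theta_dot] at hskew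
  rw [hU.derMetric_eq hM ha hp hV, hU.der_sinSqdφ_dot_e4 hM hp, hV.der_sinSqdφ_dot_e4 hM hp,
    der_Sig hM hp, dr_dot_e4 hr, dcos_dot_e4 hr, hU.flat_dot_der_e4 hM ha hp,
    hV.flat_dot_der_e4 hM ha hp, hU.flat_dot_spatial ha hr, hV.flat_dot_spatial ha hr,
    hU.flat_dot_axial ha hr, hV.flat_dot_axial ha hr, hU.sinSqdφ_dot_axial hr, hU.dr_dot,
    hV.sinSqdφ_dot_axial hr, hV.dr_dot] at hsymm
  field_simp at hskew hsymm ⊢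
  refine mul_left_cancel₀ (mul_ne_zero hr.ne' hS) ?_
  linear_combination rad p * Sig a p / 2 * hskew + 1 / 2 * hsymm

lemma conn_e4_e3 : conn M a p (e4 M a) (e3 p) U = -conn M a p e3 U (e4 M a p) := by
  have h := conn_e4_sub_conn hM ha hp (e3 p) U
  rw [dSin_e3 (rad_pos hM hp), conn_e4_to_e3 hM ha hp, hU.theta_dot, theta_dot_e3] at h
  linarith

lemma conn_e3_e4 : conn M a p e3 (e4 M a p) U = conn M a p e3 U (e4 M a p)
    + 4 * a ^ 2 * cosθ p / Sig a p * (U 3 / rad p) := by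
  have h := conn_e3_sub_conn hM ha hp (e4 M a p) U
  rw [hU.dSin_e4 (rad_pos hM hp)] at h
  linear_combination h

lemma conn_e3_to_e4 : conn M a p e3 U (e4 M a p) = -(2 * a ^ 2 * cosθ p / Sig a p * (U 3 / rad p))
    - 2 * a * rad p / Sig a p * (sinSqdφ p ⬝ᵥ U) := by
  have hr := rad_pos hM hp
  have hS := (Sig_pos a hr).ne'
  have h := conn_sub_conn_eq_bracket (M := M) (a := a) (p := p) (e := e3) (e' := e4 M a) U
  have haxial : axial (e3 p) = -(1 / rad p) • axial p := by
    ext μ; fin_cases μ <;> simp [axial, e3] <;> ring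
  rw [hU.conn_e4_e3 hM ha hp, hU.conn_e3_e4 hM ha hp, dotProduct_sub, hU.flat_dot_der_e4 hM ha hp,
    hU.flat_dot_der_e3 hM ha hp, spatial_e3, spatial_e4, haxial, dr_dot_e3 hr] at h
  simp only [dotProduct_add, dotProduct_smul, smul_eq_mul, dotProduct_neg, hU.flat_dot_dr ha hr,
    hU.flat_dot_axial_self ha hr] at h
  field_simp at h ⊢
  linear_combination -1 / 2 * h

end IsHor

end Connection

/-! ### Differentiability of the horizontal tensors -/

lemma differentiableWithinAt_det {E ι : Type*} [NormedAddCommGroup E] [NormedSpace ℝ E] [Fintype ι]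
    [DecidableEq ι] {S : Set E} {x : E} {A : E → Matrix ι ι ℝ}
    (hA : ∀ i j, DifferentiableWithinAt ℝ (fun y => A y i j) S x) :
    DifferentiableWithinAt ℝ (fun y => (A y).det) S x := by
  simp only [Matrix.det_apply']
  exact .fun_sum fun g _ => .const_mul (HasFDerivWithinAt.finsetProd fun i _ =>
    (hA (g i) i).hasFDerivWithinAt).differentiableWithinAt _

lemma differentiableWithinAt_inv {E ι : Type*} [NormedAddCommGroup E] [NormedSpace ℝ E] [Fintype ι]
    [DecidableEq ι] {S : Set E} {x : E} {A : E → Matrix ι ι ℝ}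
    (hA : ∀ i j, DifferentiableWithinAt ℝ (fun y => A y i j) S x) (hdet : (A x).det ≠ 0) (i j : ι) :
    DifferentiableWithinAt ℝ (fun y => (A y)⁻¹ i j) S x := by
  simp only [Matrix.inv_def, Matrix.smul_apply, Matrix.adjugate_apply, Ring.inverse_eq_inv',
    smul_eq_mul]
  refine ((differentiableWithinAt_det hA).fun_inv hdet).fun_mul
    (differentiableWithinAt_det fun k l => ?_)
  simp only [Matrix.updateRow_apply]
  split_ifs
  · exact differentiableWithinAt_const _
  · exact hA k l

section Exterior

variable (hM : 0 < M) (hp : p ∈ exterior M a)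

include hM hp

lemma differentiableWithinAt_e3 : DifferentiableWithinAt ℝ e3 (exterior M a) p :=
  (differentiableAt_e3 (rad_pos hM hp)).differentiableWithinAt

lemma differentiableWithinAt_e4 : DifferentiableWithinAt ℝ (e4 M a) (exterior M a) p :=
  (differentiableAt_e4 (rad_pos hM hp)).differentiableWithinAt

lemma differentiableWithinAt_lower_e3 :
    DifferentiableWithinAt ℝ (lower M a e3) (exterior M a) p :=
  differentiableWithinAt_lower hM hp (differentiableWithinAt_e3 hM hp)

lemma differentiableWithinAt_lower_e4 :
    DifferentiableWithinAt ℝ (lower M a (e4 M a)) (exterior M a) p :=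
  differentiableWithinAt_lower hM hp (differentiableWithinAt_e4 hM hp)

lemma differentiableWithinAt_e3_apply (μ : Fin 4) :
    DifferentiableWithinAt ℝ (fun q => e3 q μ) (exterior M a) p :=
  differentiableWithinAt_pi.1 (differentiableWithinAt_e3 hM hp) μ

lemma differentiableWithinAt_e4_apply (μ : Fin 4) :
    DifferentiableWithinAt ℝ (fun q => e4 M a q μ) (exterior M a) p :=
  differentiableWithinAt_pi.1 (differentiableWithinAt_e4 hM hp) μ

lemma differentiableWithinAt_metric (μ ν : Fin 4) :
    DifferentiableWithinAt ℝ (fun q => metric M a q μ ν) (exterior M a) p :=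
  (differentiableAt_metric (rad_pos hM hp) μ ν).differentiableWithinAt

lemma differentiableWithinAt_proj (μ ν : Fin 4) :
    DifferentiableWithinAt ℝ (fun q => proj M a q μ ν) (exterior M a) p := by
  have h3 := differentiableWithinAt_e3_apply hM hp
  have h4 := differentiableWithinAt_e4_apply hM hp
  have h3' := differentiableWithinAt_pi.1 (differentiableWithinAt_lower_e3 hM hp) ν
  have h4' := differentiableWithinAt_pi.1 (differentiableWithinAt_lower_e4 hM hp) ν
  exact .const_add _ (.const_mul (((h3 μ).fun_mul h4').fun_add ((h4 μ).fun_mul h3')) _)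

section TwoForm

variable (hF : ∀ μ ν, DifferentiableWithinAt ℝ (fun q => F q μ ν) (exterior M a) p)

include hF

lemma differentiableWithinAt_alpha :
    DifferentiableWithinAt ℝ (alpha M a F) (exterior M a) p :=
  differentiableWithinAt_pi.2 fun ν => .fun_sum fun μ _ => .fun_sum fun l _ =>
    ((differentiableWithinAt_proj hM hp μ ν).fun_mul (hF μ l)).fun_mul
      (differentiableWithinAt_e4_apply hM hp l)

lemma differentiableWithinAt_alphaBar :
    DifferentiableWithinAt ℝ (alphaBar M a F) (exterior M a) p :=
  differentiableWithinAt_pi.2 fun ν => .fun_sum fun μ _ => .fun_sum fun l _ =>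
    ((differentiableWithinAt_proj hM hp μ ν).fun_mul (hF μ l)).fun_mul
      (differentiableWithinAt_e3_apply hM hp l)

lemma differentiableWithinAt_rho : DifferentiableWithinAt ℝ (rho M a F) (exterior M a) p :=
  .const_mul (.fun_sum fun μ _ => .fun_sum fun ν _ =>
    ((hF μ ν).fun_mul (differentiableWithinAt_e3_apply hM hp μ)).fun_mul
      (differentiableWithinAt_e4_apply hM hp ν)) _

end TwoForm

variable (ha : |a| ≤ M)

include ha

lemma det_metric_ne_zero : (metric M a p).det ≠ 0 := by
  obtain ⟨X, Y, h⟩ := exists_isFrame (a := a) (rad_pos hM hp)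
  exact (h.isNullFrame ha).isUnit_det.ne_zero

lemma differentiableWithinAt_hInv (μ ν : Fin 4) :
    DifferentiableWithinAt ℝ (fun q => hInv M a q μ ν) (exterior M a) p := by
  have h3 := differentiableWithinAt_e3_apply hM hp
  have h4 := differentiableWithinAt_e4_apply hM hp
  exact (differentiableWithinAt_inv (differentiableWithinAt_metric hM hp)
    (det_metric_ne_zero hM hp ha) μ ν).fun_add
      (.const_mul (((h3 μ).fun_mul (h4 ν)).fun_add ((h4 μ).fun_mul (h3 ν))) _)

lemma differentiableWithinAt_hVol (μ ν : Fin 4) :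
    DifferentiableWithinAt ℝ (fun q => hVol M a q μ ν) (exterior M a) p := by
  have hdet := det_metric_ne_zero hM hp ha
  have hsqrt : DifferentiableWithinAt ℝ (fun q => √|(metric M a q).det|) (exterior M a) p :=
    ((differentiableWithinAt_det (differentiableWithinAt_metric hM hp)).abs hdet).sqrt
      (abs_ne_zero.2 hdet)
  refine .const_mul (hsqrt.fun_mul (differentiableWithinAt_det
    (A := fun q => Matrix.of ![Pi.single μ 1, Pi.single ν 1, e3 q, e4 M a q]) fun i j => ?_)) _
  fin_cases i
  · exact differentiableWithinAt_const _
  · exact differentiableWithinAt_const _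
  · exact differentiableWithinAt_e3_apply hM hp j
  · exact differentiableWithinAt_e4_apply hM hp j

lemma differentiableWithinAt_hVolUp (μ ν : Fin 4) :
    DifferentiableWithinAt ℝ (fun q => hVolUp M a q μ ν) (exterior M a) p := by
  simp only [hVolUp, Matrix.of_apply]
  exact .fun_sum fun κ _ => .fun_sum fun l _ => ((differentiableWithinAt_hInv hM hp ha μ κ).fun_mul
    (differentiableWithinAt_hInv hM hp ha ν l)).fun_mul (differentiableWithinAt_hVol hM hp ha κ l)

lemma differentiableWithinAt_sigma
    (hF : ∀ μ ν, DifferentiableWithinAt ℝ (fun q => F q μ ν) (exterior M a) p) :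
    DifferentiableWithinAt ℝ (sigma M a F) (exterior M a) p :=
  .const_mul (.fun_sum fun μ _ => .fun_sum fun ν _ =>
    (differentiableWithinAt_hVolUp hM hp ha μ ν).fun_mul (hF μ ν)) _

end Exterior

/-! ### The null decomposition of a two-form -/

/-- The two-form `s ∧ t`. -/
def wedge (s t : Fin 4 → ℝ) : Matrix (Fin 4) (Fin 4) ℝ :=
  Matrix.vecMulVec s t - Matrix.vecMulVec t s

lemma wedge_mulVec_dot (s t V W : Fin 4 → ℝ) :
    (wedge s t).mulVec W ⬝ᵥ V = (s ⬝ᵥ V) * (t ⬝ᵥ W) - (s ⬝ᵥ W) * (t ⬝ᵥ V) := by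
  simp only [wedge, Matrix.sub_mulVec, Matrix.vecMulVec_mulVec, sub_dotProduct, op_smul_eq_smul,
    smul_dotProduct, smul_eq_mul]
  ring

lemma eq_of_mulVec_dot_eq {A B : Matrix (Fin 4) (Fin 4) ℝ}
    (h : ∀ V W, A.mulVec W ⬝ᵥ V = B.mulVec W ⬝ᵥ V) : A = B :=
  Matrix.mulVec_injective (funext fun W => dotProduct_eq _ _ fun V => h V W)

lemma mulVec_dot_skew {A : Matrix (Fin 4) (Fin 4) ℝ} (hA : ∀ μ ν, A μ ν = -A ν μ)
    (V W : Fin 4 → ℝ) : A.mulVec W ⬝ᵥ V = -(A.mulVec V ⬝ᵥ W) := by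
  have hT : A.transpose = -A := Matrix.ext fun μ ν => hA ν μ
  rw [dotProduct_comm, Matrix.dotProduct_mulVec, ← Matrix.mulVec_transpose, hT, Matrix.neg_mulVec,
    neg_dotProduct]

lemma mulVec_dot_self {A : Matrix (Fin 4) (Fin 4) ℝ} (hA : ∀ μ ν, A μ ν = -A ν μ)
    (V : Fin 4 → ℝ) : A.mulVec V ⬝ᵥ V = 0 :=
  self_eq_neg.1 (mulVec_dot_skew hA V V)

lemma IsNullFrame.skew_expand {g A : Matrix (Fin 4) (Fin 4) ℝ} {K L : Fin 4 → ℝ}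
    (h : IsNullFrame g K L X Y) (hA : ∀ μ ν, A μ ν = -A ν μ) : A =
      -(1 / 2 : ℝ) • wedge (A.mulVec L) (g.mulVec K)
        + -(1 / 2 : ℝ) • wedge (A.mulVec K) (g.mulVec L)
        + (1 / 4 * (A.mulVec L ⬝ᵥ K)) • wedge (g.mulVec K) (g.mulVec L)
        + (A.mulVec Y ⬝ᵥ X) • wedge (g.mulVec X) (g.mulVec Y) := by
  have expand (V) : ∃ x y k l : ℝ, V = x • X + y • Y + k • K + l • L :=
    ⟨_, _, _, _, h.vector_expand V⟩
  refine eq_of_mulVec_dot_eq fun V W => ?_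
  obtain ⟨x, y, k, l, rfl⟩ := expand V
  obtain ⟨x', y', k', l', rfl⟩ := expand W
  simp only [Matrix.add_mulVec, Matrix.smul_mulVec, add_dotProduct, smul_dotProduct,
    wedge_mulVec_dot, Matrix.mulVec_add, Matrix.mulVec_smul, dotProduct_add, dotProduct_smul,
    smul_eq_mul, h.KK, h.KL, h.KX, h.KY, h.LK, h.LL, h.LX, h.LY, h.XK, h.XL, h.XX, h.XY, h.YK, h.YL,
    h.YX, h.YY, mulVec_dot_self hA]
  rw [mulVec_dot_skew hA L K, mulVec_dot_skew hA Y X, mulVec_dot_skew hA K X,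
    mulVec_dot_skew hA L X, mulVec_dot_skew hA K Y, mulVec_dot_skew hA L Y]
  ring

lemma mulVec_e4_dot_e3 (F : Field₂) (p : Point) :
    (F p).mulVec (e4 M a p) ⬝ᵥ e3 p = 2 * rho M a F p := by
  simp only [rho, Matrix.mulVec, dotProduct, Fin.sum_univ_four]
  ring

lemma proj_contract (s : Fin 4 → ℝ) (ν : Fin 4) : ∑ μ, proj M a p μ ν * s μ =
    s ν + 1 / 2 * ((s ⬝ᵥ e3 p) * flat M a p (e4 M a p) ν
      + (s ⬝ᵥ e4 M a p) * flat M a p (e3 p) ν) := by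
  simp only [proj, Matrix.of_apply, lower_eq_mulVec, flat, add_mul, Finset.sum_add_distrib,
    ite_mul, one_mul, zero_mul, Finset.sum_ite_eq', Finset.mem_univ, if_true]
  simp only [dotProduct, Fin.sum_univ_four]
  ring

lemma alpha_eq_sum (ν : Fin 4) :
    alpha M a F p ν = ∑ μ, proj M a p μ ν * (F p).mulVec (e4 M a p) μ := by
  simp only [alpha, Matrix.mulVec, dotProduct, Finset.mul_sum, mul_assoc]

lemma alphaBar_eq_sum (ν : Fin 4) :
    alphaBar M a F p ν = ∑ μ, proj M a p μ ν * (F p).mulVec (e3 p) μ := by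
  simp only [alphaBar, Matrix.mulVec, dotProduct, Finset.mul_sum, mul_assoc]

section Skew

variable (hA : ∀ μ ν, F p μ ν = -F p ν μ)
include hA

lemma mulVec_e3_dot_e4 : (F p).mulVec (e3 p) ⬝ᵥ e4 M a p = -(2 * rho M a F p) := by
  rw [mulVec_dot_skew hA, mulVec_e4_dot_e3]

lemma mulVec_e4 : (F p).mulVec (e4 M a p)
    = alpha M a F p - rho M a F p • flat M a p (e4 M a p) := by
  ext ν
  rw [Pi.sub_apply, Pi.smul_apply, smul_eq_mul, alpha_eq_sum, proj_contract, mulVec_e4_dot_e3,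
    mulVec_dot_self hA]
  ring

lemma mulVec_e3 : (F p).mulVec (e3 p)
    = alphaBar M a F p + rho M a F p • flat M a p (e3 p) := by
  ext ν
  rw [Pi.add_apply, Pi.smul_apply, smul_eq_mul, alphaBar_eq_sum, proj_contract,
    mulVec_e3_dot_e4 hA, mulVec_dot_self hA]
  ring

variable (ha : |a| ≤ M) (hr : 0 < rad p)
include ha hr

lemma alpha_dot_e3 : alpha M a F p ⬝ᵥ e3 p = 0 := by
  rw [← sub_add_cancel (alpha M a F p) (rho M a F p • flat M a p (e4 M a p)), ← mulVec_e4 hA,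
    add_dotProduct, smul_dotProduct, mulVec_e4_dot_e3, flat_e4_dot_e3 ha hr, smul_eq_mul]
  ring

lemma alphaBar_dot_e3 : alphaBar M a F p ⬝ᵥ e3 p = 0 := by
  rw [← add_sub_cancel_right (alphaBar M a F p) (rho M a F p • flat M a p (e3 p)), ← mulVec_e3 hA,
    sub_dotProduct, smul_dotProduct, mulVec_dot_self hA, flat_e3_dot_e3 ha hr, smul_zero, sub_zero]

lemma alphaBar_dot_e4 : alphaBar M a F p ⬝ᵥ e4 M a p = 0 := by
  rw [← add_sub_cancel_right (alphaBar M a F p) (rho M a F p • flat M a p (e3 p)), ← mulVec_e3 hA,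
    sub_dotProduct, smul_dotProduct, mulVec_e3_dot_e4 hA, flat_dot_comm, flat_e4_dot_e3 ha hr,
    smul_eq_mul]
  ring

lemma IsHor.mulVec_e4_dot {V : Fin 4 → ℝ} (hV : IsHor a p V) :
    (F p).mulVec (e4 M a p) ⬝ᵥ V = alpha M a F p ⬝ᵥ V := by
  rw [mulVec_e4 hA, sub_dotProduct, smul_dotProduct, flat_e4_dot ha hr, hV.theta_dot, hV.dr_dot,
    smul_eq_mul]
  ring

lemma IsHor.mulVec_e3_dot {V : Fin 4 → ℝ} (hV : IsHor a p V) :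
    (F p).mulVec (e3 p) ⬝ᵥ V = alphaBar M a F p ⬝ᵥ V := by
  rw [mulVec_e3 (M := M) hA, add_dotProduct, smul_dotProduct, flat_e3_dot ha hr, hV.theta_dot,
    neg_zero, smul_zero, add_zero]

end Skew

namespace IsFrame

variable (h : IsFrame a p X Y) (ha : |a| ≤ M)
include h ha

lemma hVol_eq_wedge : hVol M a p = wedge (flat M a p X) (flat M a p Y) := by
  ext μ ν
  rw [h.hVol_apply ha, wedge, Matrix.sub_apply, Matrix.vecMulVec_apply, Matrix.vecMulVec_apply]
  ring

lemma sum_hInv_mul (s : Fin 4 → ℝ) (μ : Fin 4) :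
    ∑ ν, hInv M a p μ ν * s ν = (s ⬝ᵥ X) * X μ + (s ⬝ᵥ Y) * Y μ := by
  simp only [h.hInv_apply ha, dotProduct, Fin.sum_univ_four]
  ring

lemma hVolUp_apply (μ ν : Fin 4) : hVolUp M a p μ ν = X μ * Y ν - X ν * Y μ := by
  have hN := h.isNullFrame ha
  have hXX : flat M a p X ⬝ᵥ X = 1 := hN.XX
  have hXY : flat M a p X ⬝ᵥ Y = 0 := hN.XY
  have hYX : flat M a p Y ⬝ᵥ X = 0 := hN.YX
  have hYY : flat M a p Y ⬝ᵥ Y = 1 := hN.YY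
  have hsum : hVolUp M a p μ ν
      = (∑ κ, hInv M a p μ κ * flat M a p X κ) * (∑ l, hInv M a p ν l * flat M a p Y l)
        - (∑ κ, hInv M a p μ κ * flat M a p Y κ) * (∑ l, hInv M a p ν l * flat M a p X l) := by
    simp only [hVolUp, Matrix.of_apply, h.hVol_apply ha, Fin.sum_univ_four]
    ring
  rw [hsum]
  simp only [h.sum_hInv_mul ha, hXX, hXY, hYX, hYY]
  ring

lemma hTr_eq (T : Field₂) : hTr M a T p = (T p).mulVec X ⬝ᵥ X + (T p).mulVec Y ⬝ᵥ Y := by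
  simp only [hTr, h.hInv_apply ha, Matrix.mulVec, dotProduct, Fin.sum_univ_four]
  ring

lemma hAtr_eq (T : Field₂) : hAtr M a T p = (T p).mulVec Y ⬝ᵥ X - (T p).mulVec X ⬝ᵥ Y := by
  simp only [hAtr, h.hVolUp_apply ha, Matrix.mulVec, dotProduct, Fin.sum_univ_four]
  ring

variable (hA : ∀ μ ν, F p μ ν = -F p ν μ)
include hA

lemma mulVec_Y_dot_X : (F p).mulVec Y ⬝ᵥ X = sigma M a F p := by
  rw [sigma, h.hAtr_eq ha, mulVec_dot_skew hA Y X]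
  ring

end IsFrame

lemma twoForm_eq (hA : ∀ μ ν, F p μ ν = -F p ν μ) (ha : |a| ≤ M) (hr : 0 < rad p) : F p =
    -(1 / 2 : ℝ) • wedge ((F p).mulVec (e4 M a p)) (flat M a p (e3 p))
      + -(1 / 2 : ℝ) • wedge ((F p).mulVec (e3 p)) (flat M a p (e4 M a p))
      + (1 / 2 * rho M a F p) • wedge (flat M a p (e3 p)) (flat M a p (e4 M a p))
      + sigma M a F p • hVol M a p := by
  obtain ⟨X, Y, h⟩ := exists_isFrame a hr
  rw [h.hVol_eq_wedge ha, ← h.mulVec_Y_dot_X ha hA]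
  refine ((h.isNullFrame ha).skew_expand hA).trans ?_
  rw [mulVec_e4_dot_e3]
  simp only [flat]
  module

/-! ### Covariant derivatives of two-tensors -/

lemma cov₁_congr (h : ∀ q ∈ exterior M a, s q = t q) (hp : p ∈ exterior M a) (Z V : Fin 4 → ℝ) :
    cov₁ M a p s Z V = cov₁ M a p t Z V := by
  rw [cov₁, cov₁, h p hp, der_congr (fun q hq => by rw [h q hq]) hp]

lemma cov₂_congr (h : ∀ q ∈ exterior M a, F q = G q) (hp : p ∈ exterior M a) (Z V W : Fin 4 → ℝ) :
    cov₂ M a p F Z V W = cov₂ M a p G Z V W := by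
  rw [cov₂, cov₂, h p hp, der_congr (fun q hq => by rw [h q hq]) hp]

lemma cov₂_skew (h : ∀ q ∈ exterior M a, ∀ μ ν, F q μ ν = -F q ν μ) (hp : p ∈ exterior M a)
    (hu : UniqueDiffWithinAt ℝ (exterior M a) p) (Z V W : Fin 4 → ℝ) :
    cov₂ M a p F Z V W = -cov₂ M a p F Z W V := by
  have hneg : der M a p (fun q => (F q).mulVec W ⬝ᵥ V) Z
      = -der M a p (fun q => (F q).mulVec V ⬝ᵥ W) Z := by
    rw [der_congr (fun q hq => mulVec_dot_skew (h q hq) V W) hp, der, fderivWithin_fun_neg hu]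
    rfl
  rw [cov₂, cov₂, hneg, mulVec_dot_skew (h p hp) _ W, mulVec_dot_skew (h p hp) V]
  ring

lemma cov₂_self (h : ∀ q ∈ exterior M a, ∀ μ ν, F q μ ν = -F q ν μ) (hp : p ∈ exterior M a)
    (hu : UniqueDiffWithinAt ℝ (exterior M a) p) (Z V : Fin 4 → ℝ) : cov₂ M a p F Z V V = 0 := by
  linarith [cov₂_skew h hp hu Z V V]

lemma differentiableWithinAt_dotProduct_const (hs : DifferentiableWithinAt ℝ s (exterior M a) p)
    (V : Fin 4 → ℝ) : DifferentiableWithinAt ℝ (fun q => s q ⬝ᵥ V) (exterior M a) p := by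
  simp only [dotProduct_comm _ V]
  exact (covector V).differentiableAt.comp_differentiableWithinAt p hs

lemma differentiableWithinAt_wedge (hs : DifferentiableWithinAt ℝ s (exterior M a) p)
    (ht : DifferentiableWithinAt ℝ t (exterior M a) p) (μ ν : Fin 4) :
    DifferentiableWithinAt ℝ (fun q => wedge (s q) (t q) μ ν) (exterior M a) p := by
  have hs' := differentiableWithinAt_pi.1 hs
  have ht' := differentiableWithinAt_pi.1 ht
  exact ((hs' μ).fun_mul (ht' ν)).fun_sub ((ht' μ).fun_mul (hs' ν))

lemma differentiableWithinAt_smul_apply (hf : DifferentiableWithinAt ℝ f (exterior M a) p)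
    (hF : ∀ μ ν, DifferentiableWithinAt ℝ (fun q => F q μ ν) (exterior M a) p) (μ ν : Fin 4) :
    DifferentiableWithinAt ℝ (fun q => (f q • F q) μ ν) (exterior M a) p :=
  hf.fun_mul (hF μ ν)

lemma differentiableWithinAt_add_apply
    (hF : ∀ μ ν, DifferentiableWithinAt ℝ (fun q => F q μ ν) (exterior M a) p)
    (hG : ∀ μ ν, DifferentiableWithinAt ℝ (fun q => G q μ ν) (exterior M a) p) (μ ν : Fin 4) :
    DifferentiableWithinAt ℝ (fun q => (F q + G q) μ ν) (exterior M a) p :=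
  (hF μ ν).fun_add (hG μ ν)

section Leibniz

variable (hu : UniqueDiffWithinAt ℝ (exterior M a) p)
include hu

lemma cov₂_wedge (hs : DifferentiableWithinAt ℝ s (exterior M a) p)
    (ht : DifferentiableWithinAt ℝ t (exterior M a) p) :
    cov₂ M a p (fun q => wedge (s q) (t q)) Z V W =
      cov₁ M a p s Z V * (t p ⬝ᵥ W) + (s p ⬝ᵥ V) * cov₁ M a p t Z W
        - (cov₁ M a p s Z W * (t p ⬝ᵥ V) + (s p ⬝ᵥ W) * cov₁ M a p t Z V) := by
  have hs' := differentiableWithinAt_dotProduct_const hs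
  have ht' := differentiableWithinAt_dotProduct_const ht
  simp only [cov₂, cov₁, wedge_mulVec_dot]
  rw [der_sub hu Z ((hs' V).fun_mul (ht' W)) ((hs' W).fun_mul (ht' V)),
    der_mul hu Z (hs' V) (ht' W), der_mul hu Z (hs' W) (ht' V)]
  ring

lemma cov₁_add (hs : DifferentiableWithinAt ℝ s (exterior M a) p)
    (ht : DifferentiableWithinAt ℝ t (exterior M a) p) :
    cov₁ M a p (fun q => s q + t q) Z V = cov₁ M a p s Z V + cov₁ M a p t Z V := by
  simp only [cov₁, add_dotProduct]
  rw [der_add hu Z (differentiableWithinAt_dotProduct_const hs V)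
    (differentiableWithinAt_dotProduct_const ht V)]
  ring

lemma cov₁_sub (hs : DifferentiableWithinAt ℝ s (exterior M a) p)
    (ht : DifferentiableWithinAt ℝ t (exterior M a) p) :
    cov₁ M a p (fun q => s q - t q) Z V = cov₁ M a p s Z V - cov₁ M a p t Z V := by
  simp only [cov₁, sub_dotProduct]
  rw [der_sub hu Z (differentiableWithinAt_dotProduct_const hs V)
    (differentiableWithinAt_dotProduct_const ht V)]
  ring

lemma cov₁_smul (hf : DifferentiableWithinAt ℝ f (exterior M a) p)
    (hs : DifferentiableWithinAt ℝ s (exterior M a) p) :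
    cov₁ M a p (fun q => f q • s q) Z V
      = der M a p f Z * (s p ⬝ᵥ V) + f p * cov₁ M a p s Z V := by
  simp only [cov₁, smul_dotProduct, smul_eq_mul]
  rw [der_mul hu Z hf (differentiableWithinAt_dotProduct_const hs V)]
  ring

section Tensor

variable (hF : ∀ μ ν, DifferentiableWithinAt ℝ (fun q => F q μ ν) (exterior M a) p)
include hF

lemma cov₂_smul (hf : DifferentiableWithinAt ℝ f (exterior M a) p) :
    cov₂ M a p (fun q => f q • F q) Z V W
      = der M a p f Z * ((F p).mulVec W ⬝ᵥ V) + f p * cov₂ M a p F Z V W := by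
  have hFVW := differentiableWithinAt_dotProduct_const
    (differentiableWithinAt_mulVec hF (differentiableWithinAt_const W)) V
  simp only [cov₂, Matrix.smul_mulVec, smul_dotProduct, smul_eq_mul]
  rw [der_mul hu Z hf hFVW]
  ring

lemma cov₂_add (hG : ∀ μ ν, DifferentiableWithinAt ℝ (fun q => G q μ ν) (exterior M a) p) :
    cov₂ M a p (fun q => F q + G q) Z V W = cov₂ M a p F Z V W + cov₂ M a p G Z V W := by
  have hFVW := differentiableWithinAt_dotProduct_const
    (differentiableWithinAt_mulVec hF (differentiableWithinAt_const W)) V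
  have hGVW := differentiableWithinAt_dotProduct_const
    (differentiableWithinAt_mulVec hG (differentiableWithinAt_const W)) V
  simp only [cov₂, Matrix.add_mulVec, add_dotProduct]
  rw [der_add hu Z hFVW hGVW]
  ring

lemma cov₂_contract (he : DifferentiableWithinAt ℝ e (exterior M a) p) :
    cov₂ M a p F Z V (e p)
      = cov₁ M a p (fun q => (F q).mulVec (e q)) Z V - (F p).mulVec (nab M a p e Z) ⬝ᵥ V := by
  have hF' (W) := differentiableWithinAt_mulVec hF (differentiableWithinAt_const W)
  have hFe := differentiableWithinAt_mulVec hF he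
  have hrow (W : Fin 4 → ℝ) (μ : Fin 4) : der M a p (fun q => (F q).mulVec W) Z μ
      = ∑ ν, der M a p (fun q => F q μ ν) Z * W ν := by
    rw [der_apply hu Z (hF' W)]
    exact (der_dotProduct_const (s := fun q => F q μ) hu Z
      (differentiableWithinAt_pi.2 (hF μ)) W).trans
      (by simp only [dotProduct, der_apply hu Z (differentiableWithinAt_pi.2 (hF μ))])
  have hder : der M a p (fun q => (F q).mulVec (e q)) Z
      = der M a p (fun q => (F q).mulVec (e p)) Z + (F p).mulVec (der M a p e Z) := by
    ext μ
    rw [Pi.add_apply, hrow, der_apply hu Z hFe]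
    exact (der_dotProduct (s := fun q => F q μ) hu Z (differentiableWithinAt_pi.2 (hF μ)) he).trans
      (by simp only [dotProduct, der_apply hu Z (differentiableWithinAt_pi.2 (hF μ)),
            Matrix.mulVec])
  rw [cov₂, cov₁, der_dotProduct_const hu Z (hF' _), der_dotProduct_const hu Z hFe, hder, nab,
    Matrix.mulVec_add, add_dotProduct, add_dotProduct]
  ring

end Tensor

end Leibniz

/-! ### The covariant derivative of a two-form in the null frame -/

/-- The degenerate extension by zero of the horizontal metric to all vectors. -/
def hMetric (M a : ℝ) (p : Point) (V W : Fin 4 → ℝ) : ℝ :=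
  flat M a p V ⬝ᵥ W + 1 / 2 * ((lower M a e3 p ⬝ᵥ V) * (lower M a (e4 M a) p ⬝ᵥ W)
    + (lower M a e3 p ⬝ᵥ W) * (lower M a (e4 M a) p ⬝ᵥ V))

lemma IsFrame.hMetric_eq (h : IsFrame a p X Y) (ha : |a| ≤ M) (V W : Fin 4 → ℝ) : hMetric M a p V W
    = (flat M a p X ⬝ᵥ V) * (flat M a p X ⬝ᵥ W) + (flat M a p Y ⬝ᵥ V) * (flat M a p Y ⬝ᵥ W) := by
  have hV := congrArg (flat M a p V ⬝ᵥ ·) ((h.isNullFrame ha).vector_expand W)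
  simp only [dotProduct_add, dotProduct_smul, smul_eq_mul] at hV
  rw [hMetric, hV, lower_eq_mulVec, lower_eq_mulVec, ← flat, ← flat, flat_dot_comm V X,
    flat_dot_comm V Y, flat_dot_comm V (e3 p), flat_dot_comm V (e4 M a p)]
  simp only [flat]
  ring

lemma hVol_sq (ha : |a| ≤ M) (hr : 0 < rad p) (V W : Fin 4 → ℝ) :
    ((hVol M a p).mulVec W ⬝ᵥ V) * ((hVol M a p).mulVec W ⬝ᵥ V)
      = hMetric M a p V V * hMetric M a p W W - hMetric M a p V W * hMetric M a p V W := by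
  obtain ⟨X, Y, h⟩ := exists_isFrame a hr
  simp only [h.hVol_eq_wedge ha, wedge_mulVec_dot, h.hMetric_eq ha]
  ring

section Exterior

variable (hM : 0 < M) (ha : |a| ≤ M) (hp : p ∈ exterior M a)
include hM hp

lemma differentiableWithinAt_hMetric (V W : Fin 4 → ℝ) :
    DifferentiableWithinAt ℝ (fun q => hMetric M a q V W) (exterior M a) p := by
  have h3 := differentiableWithinAt_dotProduct_const (differentiableWithinAt_lower_e3 hM hp)
  have h4 := differentiableWithinAt_dotProduct_const (differentiableWithinAt_lower_e4 hM hp)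
  have hV := differentiableWithinAt_dotProduct_const
    (differentiableWithinAt_lower hM hp (differentiableWithinAt_const V))
  exact (hV W).fun_add ((((h3 V).fun_mul (h4 W)).fun_add ((h3 W).fun_mul (h4 V))).const_mul _)

include ha

lemma der_hMetric {V : Fin 4 → ℝ} (hV : IsHor a p V) (Z : Fin 4 → ℝ) :
    der M a p (fun q => hMetric M a q V V) Z = derMetric M a p Z V V := by
  have hr := rad_pos hM hp
  have hu := uniqueDiffWithinAt_exterior hM hp
  have h3 := differentiableWithinAt_dotProduct_const (differentiableWithinAt_lower_e3 hM hp) V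
  have h4 := differentiableWithinAt_dotProduct_const (differentiableWithinAt_lower_e4 hM hp) V
  have hVV := differentiableWithinAt_dotProduct_const
    (differentiableWithinAt_lower hM hp (differentiableWithinAt_const V)) V
  have h34 := h3.fun_mul h4
  have hE3 : lower M a e3 p ⬝ᵥ V = 0 := (flat_e3_dot ha hr V).trans (by rw [hV.theta_dot, neg_zero])
  have hE4 : lower M a (e4 M a) p ⬝ᵥ V = 0 :=
    (flat_e4_dot ha hr V).trans (by rw [hV.theta_dot, hV.dr_dot]; ring)
  simp only [hMetric]
  refine (der_add hu Z hVV ((h34.fun_add h34).const_mul _)).trans ?_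
  rw [der_const_mul hu Z (h34.fun_add h34), der_add hu Z h34 h34, der_mul hu Z h3 h4, hE3, hE4,
    derMetric]
  simp only [zero_mul, add_zero, mul_zero, flat]
  rfl

end Exterior

namespace IsFrame

variable (h : IsFrame a p X Y) (hM : 0 < M) (ha : |a| ≤ M) (hp : p ∈ exterior M a) (Z : Fin 4 → ℝ)
include h

section Algebra

include ha

lemma hVol_mulVec_dot : (hVol M a p).mulVec Y ⬝ᵥ X = 1 := by
  have hN := h.isNullFrame ha
  rw [h.hVol_eq_wedge ha, wedge_mulVec_dot, flat, flat, hN.XX, hN.XY, hN.YX, hN.YY]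
  ring

end Algebra

include hM ha hp

-- Differentiating `hVol_sq` leaves only the metric derivatives, which the Christoffel terms cancel.
lemma cov₂_hVol : cov₂ M a p (hVol M a) Z X Y = 0 := by
  have hN := h.isNullFrame ha
  have hu := uniqueDiffWithinAt_exterior hM hp
  have hXX := differentiableWithinAt_hMetric hM hp X X
  have hYY := differentiableWithinAt_hMetric hM hp Y Y
  have hXY := differentiableWithinAt_hMetric hM hp X Y
  have hvol := differentiableWithinAt_dotProduct_const (differentiableWithinAt_mulVec
    (differentiableWithinAt_hVol hM hp ha) (differentiableWithinAt_const Y)) X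
  have hsq := der_congr (Z := Z) (fun q hq => hVol_sq ha (Kerr.rad_pos hM hq) X Y) hp
  rw [der_mul hu Z hvol hvol, der_sub hu Z (hXX.fun_mul hYY) (hXY.fun_mul hXY),
    der_mul hu Z hXX hYY, der_mul hu Z hXY hXY, h.hVol_mulVec_dot ha,
    der_hMetric hM ha hp h.isHor_X, der_hMetric hM ha hp h.isHor_Y] at hsq
  simp only [h.hMetric_eq ha, flat, hN.XX, hN.XY, hN.YX, hN.YY] at hsq
  have hGX := flat_dot_Gam hM ha hp Z X X
  have hGY := flat_dot_Gam hM ha hp Z Y Y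
  rw [cov₂, h.hVol_eq_wedge ha, wedge_mulVec_dot, wedge_mulVec_dot, hGX, hGY]
  simp only [flat, hN.XX, hN.XY, hN.YX, hN.YY]
  linarith

lemma nab_e3 : nab M a p e3 Z = conn M a p e3 Z X • X + conn M a p e3 Z Y • Y
    - (1 / 2 * conn M a p e3 Z (e4 M a p)) • e3 p := by
  refine ((h.isNullFrame ha).vector_expand _).trans ?_
  change conn M a p e3 Z X • X + conn M a p e3 Z Y • Y
    + (-(1 / 2) * conn M a p e3 Z (e4 M a p)) • e3 p
    + (-(1 / 2) * conn M a p e3 Z (e3 p)) • e4 M a p = _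
  rw [conn_e3_to_e3 hM ha hp]
  module

lemma nab_e4 : nab M a p (e4 M a) Z = conn M a p (e4 M a) Z X • X + conn M a p (e4 M a) Z Y • Y
    + (1 / 2 * conn M a p e3 Z (e4 M a p)) • e4 M a p := by
  refine ((h.isNullFrame ha).vector_expand _).trans ?_
  change conn M a p (e4 M a) Z X • X + conn M a p (e4 M a) Z Y • Y
    + (-(1 / 2) * conn M a p (e4 M a) Z (e4 M a p)) • e3 p
    + (-(1 / 2) * conn M a p (e4 M a) Z (e3 p)) • e4 M a p = _
  rw [conn_e4_to_e4 hM ha hp, conn_e4_to_e3 hM ha hp]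
  module

end IsFrame

section Components

variable (hM : 0 < M) (ha : |a| ≤ M) (hp : p ∈ exterior M a)
  (hF : ∀ μ ν, DifferentiableWithinAt ℝ (fun q => F q μ ν) (exterior M a) p)
  (hskew : ∀ q ∈ exterior M a, ∀ μ ν, F q μ ν = -F q ν μ) (Z V : Fin 4 → ℝ)
include hM ha hp hF hskew

lemma cov₁_mulVec_e3 : cov₁ M a p (fun q => (F q).mulVec (e3 q)) Z V
    = cov₁ M a p (alphaBar M a F) Z V + (der M a p (rho M a F) Z * (flat M a p (e3 p) ⬝ᵥ V)
      + rho M a F p * conn M a p e3 Z V) := by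
  have hu := uniqueDiffWithinAt_exterior hM hp
  have hρ := differentiableWithinAt_rho hM hp hF
  have h3 := differentiableWithinAt_lower_e3 hM hp
  refine (cov₁_congr (fun q hq => mulVec_e3 (M := M) (a := a) (hskew q hq)) hp Z V).trans ?_
  refine (cov₁_add hu (differentiableWithinAt_alphaBar hM hp hF) (hρ.fun_smul h3)).trans ?_
  rw [cov₁_smul hu hρ h3, cov₁_lower hM ha hp (differentiableWithinAt_e3 hM hp)]
  rfl

lemma cov₁_mulVec_e4 : cov₁ M a p (fun q => (F q).mulVec (e4 M a q)) Z V
    = cov₁ M a p (alpha M a F) Z V - (der M a p (rho M a F) Z * (flat M a p (e4 M a p) ⬝ᵥ V)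
      + rho M a F p * conn M a p (e4 M a) Z V) := by
  have hu := uniqueDiffWithinAt_exterior hM hp
  have hρ := differentiableWithinAt_rho hM hp hF
  have h4 := differentiableWithinAt_lower_e4 hM hp
  refine (cov₁_congr (fun q hq => mulVec_e4 (hskew q hq)) hp Z V).trans ?_
  refine (cov₁_sub hu (differentiableWithinAt_alpha hM hp hF) (hρ.fun_smul h4)).trans ?_
  rw [cov₁_smul hu hρ h4, cov₁_lower hM ha hp (differentiableWithinAt_e4 hM hp)]
  rfl

namespace IsFrame

variable (h : IsFrame a p X Y)
include h

lemma cov₂_X_e3 : cov₂ M a p F Z X (e3 p) = cov₁ M a p (alphaBar M a F) Z X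
    + rho M a F p * conn M a p e3 Z X - sigma M a F p * conn M a p e3 Z Y
    + 1 / 2 * conn M a p e3 Z (e4 M a p) * (alphaBar M a F p ⬝ᵥ X) := by
  have hA := hskew p hp
  rw [cov₂_contract (uniqueDiffWithinAt_exterior hM hp) hF (differentiableWithinAt_e3 hM hp),
    cov₁_mulVec_e3 hM ha hp hF hskew, h.nab_e3 hM ha hp, Matrix.mulVec_sub, Matrix.mulVec_add,
    flat_e3_dot ha h.rad_pos, h.theta_X]
  simp only [Matrix.mulVec_smul, sub_dotProduct, add_dotProduct, smul_dotProduct, smul_eq_mul,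
    mulVec_dot_self hA, h.mulVec_Y_dot_X ha hA, h.isHor_X.mulVec_e3_dot hA ha h.rad_pos]
  ring

lemma cov₂_X_e4 : cov₂ M a p F Z X (e4 M a p) = cov₁ M a p (alpha M a F) Z X
    - rho M a F p * conn M a p (e4 M a) Z X - sigma M a F p * conn M a p (e4 M a) Z Y
    - 1 / 2 * conn M a p e3 Z (e4 M a p) * (alpha M a F p ⬝ᵥ X) := by
  have hA := hskew p hp
  rw [cov₂_contract (uniqueDiffWithinAt_exterior hM hp) hF (differentiableWithinAt_e4 hM hp),
    cov₁_mulVec_e4 hM ha hp hF hskew, h.nab_e4 hM ha hp, Matrix.mulVec_add, Matrix.mulVec_add,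
    flat_e4_dot ha h.rad_pos, h.theta_X, h.dr_X]
  simp only [Matrix.mulVec_smul, add_dotProduct, smul_dotProduct, smul_eq_mul,
    mulVec_dot_self hA, h.mulVec_Y_dot_X ha hA, h.isHor_X.mulVec_e4_dot hA ha h.rad_pos]
  ring

lemma cov₂_e3_e4 : cov₂ M a p F Z (e3 p) (e4 M a p) = 2 * der M a p (rho M a F) Z
    - ((alpha M a F p ⬝ᵥ X) * conn M a p e3 Z X + (alpha M a F p ⬝ᵥ Y) * conn M a p e3 Z Y)
    + ((alphaBar M a F p ⬝ᵥ X) * conn M a p (e4 M a) Z X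
      + (alphaBar M a F p ⬝ᵥ Y) * conn M a p (e4 M a) Z Y) := by
  have hr := h.rad_pos
  have hA := hskew p hp
  have hα := cov₁_of_dot_const hM hp (differentiableWithinAt_e3 hM hp)
    (differentiableWithinAt_alpha hM hp hF)
    (fun q hq => alpha_dot_e3 (hskew q hq) ha (Kerr.rad_pos hM hq)) Z
  rw [h.nab_e3 hM ha hp, dotProduct_sub, dotProduct_add] at hα
  simp only [dotProduct_smul, smul_eq_mul, alpha_dot_e3 hA ha hr] at hα
  rw [cov₂_contract (uniqueDiffWithinAt_exterior hM hp) hF (differentiableWithinAt_e4 hM hp),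
    cov₁_mulVec_e4 hM ha hp hF hskew, hα, h.nab_e4 hM ha hp, Matrix.mulVec_add, Matrix.mulVec_add,
    flat_e4_dot_e3 ha hr, conn_e4_to_e3 hM ha hp]
  simp only [Matrix.mulVec_smul, add_dotProduct, smul_dotProduct, smul_eq_mul,
    mulVec_dot_skew hA (e3 p), mulVec_e3_dot_e4 hA,
    h.isHor_X.mulVec_e3_dot hA ha hr, h.isHor_Y.mulVec_e3_dot hA ha hr]
  ring

lemma cov₂_XY : cov₂ M a p F Z X Y = der M a p (sigma M a F) Z
    - 1 / 2 * ((alpha M a F p ⬝ᵥ X) * conn M a p e3 Z Y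
      - (alpha M a F p ⬝ᵥ Y) * conn M a p e3 Z X)
    - 1 / 2 * ((alphaBar M a F p ⬝ᵥ X) * conn M a p (e4 M a) Z Y
      - (alphaBar M a F p ⬝ᵥ Y) * conn M a p (e4 M a) Z X) := by
  have hr := h.rad_pos
  have hA := hskew p hp
  have hu := uniqueDiffWithinAt_exterior hM hp
  have hN := h.isNullFrame ha
  have h3 := differentiableWithinAt_e3 hM hp
  have h4 := differentiableWithinAt_e4 hM hp
  have h3' := differentiableWithinAt_lower_e3 hM hp
  have h4' := differentiableWithinAt_lower_e4 hM hp
  have hF3 := differentiableWithinAt_mulVec hF h3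
  have hF4 := differentiableWithinAt_mulVec hF h4
  have hc : DifferentiableWithinAt ℝ (fun _ => -(1 / 2 : ℝ)) (exterior M a) p :=
    differentiableWithinAt_const _
  have hρ := (differentiableWithinAt_rho hM hp hF).const_mul (1 / 2)
  have hσ := differentiableWithinAt_sigma hM hp ha hF
  have hvol := differentiableWithinAt_hVol hM hp ha
  have h43 := differentiableWithinAt_wedge hF4 h3'
  have h34 := differentiableWithinAt_wedge hF3 h4'
  have hlow := differentiableWithinAt_wedge h3' h4'
  have hc43 := differentiableWithinAt_smul_apply hc h43
  have hc34 := differentiableWithinAt_smul_apply hc h34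
  have hρlow := differentiableWithinAt_smul_apply hρ hlow
  have hadd := differentiableWithinAt_add_apply hc43 hc34
  have hsplit := cov₂_add (Z := Z) (V := X) (W := Y) hu
    (differentiableWithinAt_add_apply hadd hρlow) (differentiableWithinAt_smul_apply hσ hvol)
  rw [cov₂_add hu hadd hρlow, cov₂_add hu hc43 hc34, cov₂_smul hu h43 hc, cov₂_smul hu h34 hc,
    cov₂_smul hu hlow hρ, cov₂_smul hu hvol hσ, cov₂_wedge hu hF4 h3', cov₂_wedge hu hF3 h4',
    cov₂_wedge hu h3' h4', h.cov₂_hVol hM ha hp, h.hVol_mulVec_dot ha, der_const,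
    cov₁_lower hM ha hp h3, cov₁_lower hM ha hp h3, cov₁_lower hM ha hp h4,
    cov₁_lower hM ha hp h4] at hsplit
  simp only [wedge_mulVec_dot, lower_eq_mulVec, hN.KX, hN.KY, hN.LX, hN.LY,
    h.isHor_X.mulVec_e4_dot hA ha hr, h.isHor_Y.mulVec_e4_dot hA ha hr,
    h.isHor_X.mulVec_e3_dot hA ha hr, h.isHor_Y.mulVec_e3_dot hA ha hr] at hsplit
  refine (cov₂_congr (fun q hq => twoForm_eq (hskew q hq) ha (Kerr.rad_pos hM hq)) hp Z X Y).trans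
    (hsplit.trans ?_)
  ring

end IsFrame

end Components

/-! ### Horizontal operators in an adapted frame -/

lemma along_eq_der (e : Field₁) (f : Point → ℝ) : along M a e f p = der M a p f (e p) :=
  sum_mul_pd f (e p)

lemma mulVec_dot_eq_sum (T : Matrix (Fin 4) (Fin 4) ℝ) (V W : Fin 4 → ℝ) :
    T.mulVec W ⬝ᵥ V = (fun ν => ∑ μ, V μ * T μ ν) ⬝ᵥ W := by
  simp only [Matrix.mulVec, dotProduct, Fin.sum_univ_four]
  ring

lemma sum_mul_covVector_eq_conn (hu : UniqueDiffWithinAt ℝ (exterior M a) p)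
    (he : DifferentiableWithinAt ℝ e (exterior M a) p) (V W : Fin 4 → ℝ) :
    ∑ μ, ∑ κ, ∑ l, V μ * W κ * metric M a p κ l * covVector M a e p μ l = conn M a p e V W := by
  rw [conn, flat, mulVec_dot_comm (metric_isSymm p), dotProduct_comm]
  simp only [Matrix.mulVec, dotProduct, ← sum_mul_covVector hu he, Fin.sum_univ_four]
  ring

lemma omegaHat_eq (hM : 0 < M) (ha : |a| ≤ M) (hp : p ∈ exterior M a) :
    omegaHat M a p = quotR M a p := by
  have h : omegaHat M a p = 1 / 2 * conn M a p e3 (e4 M a p) (e4 M a p) := by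
    rw [omegaHat, conn, lower_eq_mulVec, flat, dotProduct_comm]
    simp only [dotProduct, Finset.sum_mul, ← sum_mul_covVector (uniqueDiffWithinAt_exterior hM hp)
      (differentiableWithinAt_e3 hM hp)]
    rw [Finset.sum_comm]
  rw [h, conn_e3_e4_e4 hM ha hp]
  ring

namespace IsFrame

variable (h : IsFrame a p X Y) (ha : |a| ≤ M)
include h ha

lemma flat_X_dot_X : flat M a p X ⬝ᵥ X = 1 := (h.isNullFrame ha).XX

lemma flat_X_dot_Y : flat M a p X ⬝ᵥ Y = 0 := (h.isNullFrame ha).XY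

lemma flat_Y_dot_X : flat M a p Y ⬝ᵥ X = 0 := (h.isNullFrame ha).YX

lemma flat_Y_dot_Y : flat M a p Y ⬝ᵥ Y = 1 := (h.isNullFrame ha).YY

lemma smul_flat_add_inj {x y x' y' : ℝ} :
    x • flat M a p X + y • flat M a p Y = x' • flat M a p X + y' • flat M a p Y
      ↔ x = x' ∧ y = y' := by
  refine ⟨fun H => ⟨?_, ?_⟩, fun ⟨hx, hy⟩ => by rw [hx, hy]⟩
  · simpa only [add_dotProduct, smul_dotProduct, h.flat_X_dot_X ha, h.flat_Y_dot_X ha, smul_eq_mul,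
      mul_one, mul_zero, add_zero] using congrArg (· ⬝ᵥ X) H
  · simpa only [add_dotProduct, smul_dotProduct, h.flat_X_dot_Y ha, h.flat_Y_dot_Y ha, smul_eq_mul,
      mul_one, mul_zero, zero_add] using congrArg (· ⬝ᵥ Y) H

lemma form_eq_of_dot_eq_zero {s : Fin 4 → ℝ} (h3 : s ⬝ᵥ e3 p = 0) (h4 : s ⬝ᵥ e4 M a p = 0) :
    s = (s ⬝ᵥ X) • flat M a p X + (s ⬝ᵥ Y) • flat M a p Y := by
  refine ((h.isNullFrame ha).form_expand s).trans ?_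
  rw [h3, h4, flat, flat, mul_zero, zero_smul, zero_smul, add_zero, add_zero]

lemma hGrad_eq (f : Point → ℝ) :
    hGrad M a f p = der M a p f X • flat M a p X + der M a p f Y • flat M a p Y := by
  ext ν
  simp only [Pi.add_apply, Pi.smul_apply, smul_eq_mul, ← sum_mul_pd, hGrad, h.proj_apply ha,
    Finset.sum_mul, ← Finset.sum_add_distrib]
  exact Finset.sum_congr rfl fun μ _ => by ring

lemma hStar_eq (s : Field₁) :
    hStar M a s p = (s p ⬝ᵥ Y) • flat M a p X - (s p ⬝ᵥ X) • flat M a p Y := by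
  have hdot (ν) : hStar M a s p ν = ∑ l, hVol M a p ν l * ∑ κ, hInv M a p l κ * s p κ := by
    simp only [hStar, Finset.mul_sum, mul_assoc]
  have hmul : hStar M a s p = (hVol M a p).mulVec ((s p ⬝ᵥ X) • X + (s p ⬝ᵥ Y) • Y) := by
    ext ν
    simp only [hdot, h.sum_hInv_mul ha, Matrix.mulVec, dotProduct, Pi.add_apply, Pi.smul_apply,
      smul_eq_mul]
  rw [hmul, h.hVol_eq_wedge ha]
  refine dotProduct_eq _ _ fun V => ?_
  rw [wedge_mulVec_dot]
  simp only [dotProduct_add, dotProduct_smul, sub_dotProduct, smul_dotProduct, smul_eq_mul,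
    h.flat_X_dot_X ha, h.flat_X_dot_Y ha, h.flat_Y_dot_X ha, h.flat_Y_dot_Y ha]
  ring

section Derivative

variable (hu : UniqueDiffWithinAt ℝ (exterior M a) p)
include hu

section Form

variable (hs : DifferentiableWithinAt ℝ s (exterior M a) p)
include hs

lemma sum_mul_hCov (Z : Fin 4 → ℝ) : (fun ν => ∑ μ, Z μ * hCov M a s p μ ν)
    = cov₁ M a p s Z X • flat M a p X + cov₁ M a p s Z Y • flat M a p Y := by
  ext ν
  simp only [Pi.add_apply, Pi.smul_apply, smul_eq_mul, ← sum_mul_covForm hu hs, hCov,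
    Matrix.of_apply, h.proj_apply ha, Finset.mul_sum, Finset.sum_mul, ← Finset.sum_add_distrib]
  exact Finset.sum_congr rfl fun μ _ => Finset.sum_congr rfl fun l _ => by ring

lemma hDiv_eq : hDiv M a s p = cov₁ M a p s X X + cov₁ M a p s Y Y := by
  simp only [hDiv, h.hTr_eq ha, mulVec_dot_eq_sum, h.sum_mul_hCov ha hu hs, add_dotProduct,
    smul_dotProduct, smul_eq_mul, h.flat_X_dot_X ha, h.flat_X_dot_Y ha, h.flat_Y_dot_X ha,
    h.flat_Y_dot_Y ha, mul_one, mul_zero, add_zero, zero_add]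

lemma hCurl_eq : hCurl M a s p = cov₁ M a p s X Y - cov₁ M a p s Y X := by
  simp only [hCurl, h.hAtr_eq ha, mulVec_dot_eq_sum, h.sum_mul_hCov ha hu hs, add_dotProduct,
    smul_dotProduct, smul_eq_mul, h.flat_X_dot_X ha, h.flat_X_dot_Y ha, h.flat_Y_dot_X ha,
    h.flat_Y_dot_Y ha, mul_one, mul_zero, add_zero, zero_add]

end Form

variable (he : DifferentiableWithinAt ℝ e (exterior M a) p)
include he

lemma secondForm_mulVec (V : Fin 4 → ℝ) : (secondForm M a e p).mulVec V =
    (conn M a p e X X * (flat M a p X ⬝ᵥ V) + conn M a p e X Y * (flat M a p Y ⬝ᵥ V))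
        • flat M a p X
      + (conn M a p e Y X * (flat M a p X ⬝ᵥ V) + conn M a p e Y Y * (flat M a p Y ⬝ᵥ V))
        • flat M a p Y := by
  have happ (μ ν) : secondForm M a e p μ ν =
      (conn M a p e X X * flat M a p X ν + conn M a p e X Y * flat M a p Y ν) * flat M a p X μ
      + (conn M a p e Y X * flat M a p X ν + conn M a p e Y Y * flat M a p Y ν)
        * flat M a p Y μ := by
    simp only [← sum_mul_covVector_eq_conn hu he, secondForm, Matrix.of_apply, h.proj_apply ha,
      Finset.sum_mul, ← Finset.sum_add_distrib]
    exact Finset.sum_congr rfl fun κ _ => Finset.sum_congr rfl fun l _ =>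
      Finset.sum_congr rfl fun i _ => by ring
  ext μ
  simp only [Matrix.mulVec, dotProduct, happ, Pi.add_apply, Pi.smul_apply, smul_eq_mul,
    Fin.sum_univ_four]
  ring

lemma sharpDot_secondForm : sharpDot M a (secondForm M a e) s p =
    (conn M a p e X X * (s p ⬝ᵥ X) + conn M a p e X Y * (s p ⬝ᵥ Y)) • flat M a p X
      + (conn M a p e Y X * (s p ⬝ᵥ X) + conn M a p e Y Y * (s p ⬝ᵥ Y)) • flat M a p Y := by
  have hmul : sharpDot M a (secondForm M a e) s p
      = (secondForm M a e p).mulVec ((s p ⬝ᵥ X) • X + (s p ⬝ᵥ Y) • Y) := by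
    ext μ
    simp only [sharpDot, h.hInv_apply ha, Matrix.mulVec, dotProduct, Pi.add_apply, Pi.smul_apply,
      smul_eq_mul, Fin.sum_univ_four]
    ring
  rw [hmul, h.secondForm_mulVec ha hu he]
  simp only [dotProduct_add, dotProduct_smul, smul_eq_mul, h.flat_X_dot_X ha, h.flat_X_dot_Y ha,
    h.flat_Y_dot_X ha, h.flat_Y_dot_Y ha, mul_one, mul_zero, add_zero, zero_add]

lemma hTr_secondForm : hTr M a (secondForm M a e) p = conn M a p e X X + conn M a p e Y Y := by
  simp only [h.hTr_eq ha, h.secondForm_mulVec ha hu he, add_dotProduct, smul_dotProduct,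
    smul_eq_mul, h.flat_X_dot_X ha, h.flat_X_dot_Y ha, h.flat_Y_dot_X ha, h.flat_Y_dot_Y ha,
    mul_one, mul_zero, add_zero, zero_add]

lemma hAtr_secondForm : hAtr M a (secondForm M a e) p = conn M a p e X Y - conn M a p e Y X := by
  simp only [h.hAtr_eq ha, h.secondForm_mulVec ha hu he, add_dotProduct, smul_dotProduct,
    smul_eq_mul, h.flat_X_dot_X ha, h.flat_X_dot_Y ha, h.flat_Y_dot_X ha, h.flat_Y_dot_Y ha,
    mul_one, mul_zero, add_zero, zero_add]

end Derivative

section Transport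

omit ha
variable (hM : 0 < M) (ha : |a| ≤ M) (hp : p ∈ exterior M a)
  (hs : DifferentiableWithinAt ℝ s (exterior M a) p)
include hM ha hp hs

lemma frakT_eq : frakT M a s p =
    (1 / 2 * Sig a p * (cov₁ M a p s (e3 p) X + conn M a p e3 X X * (s p ⬝ᵥ X)
        + conn M a p e3 X Y * (s p ⬝ᵥ Y))) • flat M a p X
      + (1 / 2 * Sig a p * (cov₁ M a p s (e3 p) Y + conn M a p e3 Y X * (s p ⬝ᵥ X)
        + conn M a p e3 Y Y * (s p ⬝ᵥ Y))) • flat M a p Y := by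
  have hu := uniqueDiffWithinAt_exterior hM hp
  change (1 / 2 * Sig a p) • ((fun ν => ∑ μ, e3 p μ * hCov M a s p μ ν)
    + sharpDot M a (secondForm M a e3) s p) = _
  rw [h.sum_mul_hCov ha hu hs, h.sharpDot_secondForm ha hu (differentiableWithinAt_e3 hM hp)]
  module

lemma frakTBar_eq (h3 : s p ⬝ᵥ e3 p = 0) (h4 : s p ⬝ᵥ e4 M a p = 0) : frakTBar M a s p =
    (1 / 2 * Sig a p * (cov₁ M a p s (e4 M a p) X + conn M a p (e4 M a) X X * (s p ⬝ᵥ X)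
        + conn M a p (e4 M a) X Y * (s p ⬝ᵥ Y) + quotR M a p * (s p ⬝ᵥ X))) • flat M a p X
      + (1 / 2 * Sig a p * (cov₁ M a p s (e4 M a p) Y + conn M a p (e4 M a) Y X * (s p ⬝ᵥ X)
        + conn M a p (e4 M a) Y Y * (s p ⬝ᵥ Y) + quotR M a p * (s p ⬝ᵥ Y))) • flat M a p Y := by
  have hu := uniqueDiffWithinAt_exterior hM hp
  change (1 / 2 * Sig a p) • ((fun ν => ∑ μ, e4 M a p μ * hCov M a s p μ ν)
    + sharpDot M a (secondForm M a (e4 M a)) s p + omegaHat M a p • s p) = _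
  rw [h.sum_mul_hCov ha hu hs, h.sharpDot_secondForm ha hu (differentiableWithinAt_e4 hM hp),
    omegaHat_eq hM ha hp,
    congrArg (quotR M a p • ·) (h.form_eq_of_dot_eq_zero ha h3 h4)]
  module

end Transport

end IsFrame

/-! ### The Maxwell equations in a null frame -/

/-- The source-free Maxwell equations at the point `p`. -/
def MaxwellAt (M a : ℝ) (F : Field₂) (p : Point) : Prop :=
  (∀ i j k, covTwo M a F p i j k + covTwo M a F p j k i + covTwo M a F p k i j = 0) ∧
    ∀ i, ∑ j, ∑ k, metricInv M a p j k * covTwo M a F p j k i = 0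

/-- The exterior derivative `dF(U, V, W)` of a two-form, as the cyclic sum of `∇F`. -/
def extDer (M a : ℝ) (p : Point) (F : Field₂) (U V W : Fin 4 → ℝ) : ℝ :=
  cov₂ M a p F U V W + cov₂ M a p F V W U + cov₂ M a p F W U V

/-- The divergence `g^{JK} (∇_J F)_{KI} W^I`. -/
def divForm (M a : ℝ) (p : Point) (F : Field₂) (W : Fin 4 → ℝ) : ℝ :=
  (fun i => ∑ j, ∑ k, metricInv M a p j k * covTwo M a F p j k i) ⬝ᵥ W

lemma extDer_rotate (U V W : Fin 4 → ℝ) : extDer M a p F U V W = extDer M a p F V W U := by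
  unfold extDer
  ring

lemma divForm_neg (W : Fin 4 → ℝ) : divForm M a p F (-W) = -divForm M a p F W :=
  dotProduct_neg _ _

section Form

variable (hu : UniqueDiffWithinAt ℝ (exterior M a) p)
  (hF : ∀ μ ν, DifferentiableWithinAt ℝ (fun q => F q μ ν) (exterior M a) p)
include hu hF

lemma extDer_eq_sum (U V W : Fin 4 → ℝ) : extDer M a p F U V W = ∑ μ, ∑ ν, ∑ l, U μ * V ν * W l *
    (covTwo M a F p μ ν l + covTwo M a F p ν l μ + covTwo M a F p l μ ν) := by
  rw [extDer, ← sum_mul_covTwo hu hF, ← sum_mul_covTwo hu hF, ← sum_mul_covTwo hu hF]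
  simp only [mul_add, Finset.sum_add_distrib]
  refine congrArg₂ (· + ·) (congrArg₂ (· + ·) rfl ?_) ?_
  · rw [Finset.sum_comm_cycle (f := fun ν l μ => V ν * W l * U μ * covTwo M a F p ν l μ)]
    exact Finset.sum_congr rfl fun μ _ => Finset.sum_congr rfl fun ν _ =>
      Finset.sum_congr rfl fun l _ => by ring
  · rw [← Finset.sum_comm_cycle (f := fun μ ν l => W l * U μ * V ν * covTwo M a F p l μ ν)]
    exact Finset.sum_congr rfl fun μ _ => Finset.sum_congr rfl fun ν _ =>
      Finset.sum_congr rfl fun l _ => by ring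

lemma maxwellAt_iff_forall : MaxwellAt M a F p ↔
    (∀ U V W, extDer M a p F U V W = 0) ∧ ∀ W, divForm M a p F W = 0 := by
  refine and_congr ⟨fun H U V W => ?_, fun H i j k => ?_⟩ ⟨fun H W => ?_, fun H i => ?_⟩
  · simp only [extDer_eq_sum hu hF, H, mul_zero, Finset.sum_const_zero]
  · have := H (Pi.single i 1) (Pi.single j 1) (Pi.single k 1)
    simpa only [extDer_eq_sum hu hF, Pi.single_apply, ite_mul, mul_ite, one_mul, mul_one, zero_mul,
      mul_zero, Finset.sum_ite_eq', Finset.mem_univ, if_true, Finset.sum_const_zero] using this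
  · simp only [divForm, H, dotProduct, zero_mul, Finset.sum_const_zero]
  · simpa only [divForm, dotProduct_single_one] using H (Pi.single i 1)

lemma extDer_eq_dotProduct (U V W : Fin 4 → ℝ) : extDer M a p F U V W = (fun μ => ∑ ν, ∑ l,
    V ν * W l * (covTwo M a F p μ ν l + covTwo M a F p ν l μ + covTwo M a F p l μ ν)) ⬝ᵥ U := by
  rw [extDer_eq_sum hu hF, dotProduct_comm, dotProduct]
  simp only [Finset.mul_sum, mul_assoc]

end Form

lemma alternating_eq_zero {C : Fin 4 → Fin 4 → Fin 4 → ℝ} (hswap : ∀ i j k, C i j k = -C j i k)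
    (hrot : ∀ i j k, C i j k = C j k i) (h012 : C 0 1 2 = 0) (h013 : C 0 1 3 = 0)
    (h023 : C 0 2 3 = 0) (h123 : C 1 2 3 = 0) (i j k : Fin 4) : C i j k = 0 := by
  have h1 := hrot i j k
  have h2 := hrot j k i
  have h3 := hswap i j k
  have h4 := hswap j k i
  have h5 := hswap k i j
  fin_cases i <;> fin_cases j <;> fin_cases k <;>
    simp only [Fin.zero_eta, Fin.mk_one, Fin.reduceFinMk] at * <;> linarith

lemma IsNullFrame.form_dot_eq_zero {g : Matrix (Fin 4) (Fin 4) ℝ} {K L s : Fin 4 → ℝ}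
    (h : IsNullFrame g K L X Y) (hs : ∀ i, s ⬝ᵥ ![X, Y, K, L] i = 0) (V : Fin 4 → ℝ) :
    s ⬝ᵥ V = 0 := by
  have hX : s ⬝ᵥ X = 0 := hs 0
  have hY : s ⬝ᵥ Y = 0 := hs 1
  have hK : s ⬝ᵥ K = 0 := hs 2
  have hL : s ⬝ᵥ L = 0 := hs 3
  rw [h.form_expand s, hX, hY, hK, hL]
  simp only [mul_zero, zero_smul, add_zero, zero_dotProduct]

namespace IsFrame

section Exterior

variable (h : IsFrame a p X Y) (hM : 0 < M) (ha : |a| ≤ M) (hp : p ∈ exterior M a)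
  (hF : ∀ μ ν, DifferentiableWithinAt ℝ (fun q => F q μ ν) (exterior M a) p)
include h hM ha hp hF

lemma divForm_eq (W : Fin 4 → ℝ) : divForm M a p F W = cov₂ M a p F X X W + cov₂ M a p F Y Y W
    - 1 / 2 * (cov₂ M a p F (e3 p) (e4 M a p) W + cov₂ M a p F (e4 M a p) (e3 p) W) := by
  simp only [divForm, ← sum_mul_covTwo (uniqueDiffWithinAt_exterior hM hp) hF, dotProduct,
    Finset.sum_mul, h.metricInv_apply ha, Finset.mul_sum, mul_add, ← Finset.sum_add_distrib,
    ← Finset.sum_sub_distrib]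
  rw [← Finset.sum_comm_cycle]
  exact Finset.sum_congr rfl fun μ _ => Finset.sum_congr rfl fun ν _ =>
    Finset.sum_congr rfl fun l _ => by ring

lemma extDer_eq_zero_of_frame {V W : Fin 4 → ℝ}
    (H : ∀ i, extDer M a p F (![X, Y, e3 p, e4 M a p] i) V W = 0) (U : Fin 4 → ℝ) :
    extDer M a p F U V W = 0 := by
  have hu := uniqueDiffWithinAt_exterior hM hp
  simp only [extDer_eq_dotProduct hu hF] at H ⊢
  exact (h.isNullFrame ha).form_dot_eq_zero H U

variable (hskew : ∀ q ∈ exterior M a, ∀ μ ν, F q μ ν = -F q ν μ)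
include hskew

lemma extDer_eq_zero (hX : extDer M a p F (e3 p) (e4 M a p) X = 0)
    (hY : extDer M a p F (e3 p) (e4 M a p) Y = 0) (h3 : extDer M a p F (e3 p) X Y = 0)
    (h4 : extDer M a p F (e4 M a p) X Y = 0) (U V W : Fin 4 → ℝ) : extDer M a p F U V W = 0 := by
  have hu := uniqueDiffWithinAt_exterior hM hp
  have hswap (U V W) : extDer M a p F U V W = -extDer M a p F V U W := by
    unfold extDer
    rw [cov₂_skew hskew hp hu U V W, cov₂_skew hskew hp hu V W U, cov₂_skew hskew hp hu W U V]
    ring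
  have hframe := alternating_eq_zero (C := fun i j k => extDer M a p F (![X, Y, e3 p, e4 M a p] i)
    (![X, Y, e3 p, e4 M a p] j) (![X, Y, e3 p, e4 M a p] k)) (fun _ _ _ => hswap _ _ _)
    (fun _ _ _ => extDer_rotate _ _ _) ((extDer_rotate _ _ _).symm.trans h3)
    ((extDer_rotate _ _ _).symm.trans h4) ((extDer_rotate _ _ _).trans hX)
    ((extDer_rotate _ _ _).trans hY)
  refine h.extDer_eq_zero_of_frame hM ha hp hF (fun i => ?_) U
  rw [extDer_rotate]
  refine h.extDer_eq_zero_of_frame hM ha hp hF (fun j => ?_) V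
  rw [extDer_rotate]
  exact h.extDer_eq_zero_of_frame hM ha hp hF (fun k => hframe k i j) W

lemma maxwellAt_iff : MaxwellAt M a F p ↔
    (extDer M a p F (e3 p) X Y = 0 ∧ divForm M a p F (e3 p) = 0) ∧
    (extDer M a p F (e4 M a p) X Y = 0 ∧ divForm M a p F (e4 M a p) = 0) ∧
    (extDer M a p F (e3 p) (e4 M a p) X = 0 ∧ divForm M a p F Y = 0) ∧
    (extDer M a p F (e3 p) (e4 M a p) Y = 0 ∧ divForm M a p F X = 0) := by
  rw [maxwellAt_iff_forall (uniqueDiffWithinAt_exterior hM hp) hF]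
  constructor
  · rintro ⟨hd, hdiv⟩
    exact ⟨⟨hd _ _ _, hdiv _⟩, ⟨hd _ _ _, hdiv _⟩, ⟨hd _ _ _, hdiv _⟩, ⟨hd _ _ _, hdiv _⟩⟩
  · rintro ⟨⟨d3, div3⟩, ⟨d4, div4⟩, ⟨dX, divY⟩, ⟨dY, divX⟩⟩
    refine ⟨h.extDer_eq_zero hM ha hp hF hskew dX dY d3 d4,
      (h.isNullFrame ha).form_dot_eq_zero fun i => ?_⟩
    fin_cases i
    exacts [divX, divY, div3, div4]

end Exterior

end IsFrame

/-! ### Connection coefficients in an adapted frame -/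

lemma conn_neg (Z V : Fin 4 → ℝ) : conn M a p e Z (-V) = -conn M a p e Z V := by
  rw [conn, flat, Matrix.mulVec_neg, neg_dotProduct, ← flat, conn]

namespace IsFrame

section Algebra

variable (h : IsFrame a p X Y)
include h

lemma cross_three : X 1 * Y 2 - X 2 * Y 1 = rad p ^ 2 / Sig a p * cosθ p := by
  have hr := h.rad_pos.ne'
  rw [← h.norm_X, h.Y_one, h.Y_two, cosθ]
  field_simp
  linear_combination -X 3 * h.isHor_X.p_dot h.rad_pos

/-- By this symmetry every formula for `X` yields one for `Y`. -/
lemma rotate : IsFrame a p Y (-X) where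
  rad_pos := h.rad_pos
  theta_X := h.theta_Y
  theta_Y := by rw [dotProduct_neg, h.theta_X, neg_zero]
  dr_X := h.dr_Y
  norm_X := h.norm_Y
  Y_one := by
    have hr := h.rad_pos.ne'
    rw [Pi.neg_apply, h.Y_two, h.Y_three]
    field_simp
    linear_combination -X 1 * rad_sq p - p 1 * h.isHor_X.p_dot h.rad_pos
  Y_two := by
    have hr := h.rad_pos.ne'
    rw [Pi.neg_apply, h.Y_one, h.Y_three]
    field_simp
    linear_combination -X 2 * rad_sq p - p 2 * h.isHor_X.p_dot h.rad_pos
  Y_three := by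
    have hr := h.rad_pos.ne'
    rw [Pi.neg_apply, h.Y_one, h.Y_two]
    field_simp
    linear_combination -X 3 * rad_sq p - p 3 * h.isHor_X.p_dot h.rad_pos

end Algebra

variable (h : IsFrame a p X Y) (hM : 0 < M) (ha : |a| ≤ M) (hp : p ∈ exterior M a)
include h hM ha hp

lemma conn_e3_X_X : conn M a p e3 X X = -(rad p / Sig a p) := by
  have hr := h.rad_pos.ne'
  have hS := h.Sig_ne_zero
  rw [h.isHor_X.conn_e3 hM ha hp h.isHor_X, ← sq, ← sq, ← sq, h.norm_X]
  field_simp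
  ring

lemma conn_e3_X_Y : conn M a p e3 X Y = a * cosθ p / Sig a p := by
  have hr := h.rad_pos.ne'
  rw [h.isHor_X.conn_e3 hM ha hp h.isHor_Y, h.inner_XY, h.cross_three]
  field_simp
  ring

lemma conn_e3_Y_Y : conn M a p e3 Y Y = -(rad p / Sig a p) := h.rotate.conn_e3_X_X hM ha hp

lemma conn_e3_Y_X : conn M a p e3 Y X = -(a * cosθ p / Sig a p) := by
  rw [← h.rotate.conn_e3_X_Y hM ha hp, conn_neg, neg_neg]

lemma conn_e4_X_X : conn M a p (e4 M a) X X = quot M a p * rad p / Sig a p := by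
  have hr := h.rad_pos.ne'
  rw [h.isHor_X.conn_e4 hM ha hp h.isHor_X, ← sq, ← sq, ← sq, h.norm_X]
  field_simp
  ring

lemma conn_e4_X_Y : conn M a p (e4 M a) X Y = quot M a p * a * cosθ p / Sig a p := by
  have hr := h.rad_pos.ne'
  rw [h.isHor_X.conn_e4 hM ha hp h.isHor_Y, h.inner_XY, h.cross_three]
  field_simp
  ring

lemma conn_e4_Y_Y : conn M a p (e4 M a) Y Y = quot M a p * rad p / Sig a p :=
  h.rotate.conn_e4_X_X hM ha hp

lemma conn_e4_Y_X : conn M a p (e4 M a) Y X = -(quot M a p * a * cosθ p / Sig a p) := by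
  rw [← h.rotate.conn_e4_X_Y hM ha hp, conn_neg, neg_neg]

lemma conn_e3_X_e4 : conn M a p e3 X (e4 M a p)
    = -(2 * a ^ 2 * cosθ p / Sig a p * (X 3 / rad p))
      - 2 * a * rad p / Sig a p * (Y 3 / rad p) := by
  rw [h.isHor_X.conn_e3_to_e4 hM ha hp, h.sinSqdφ_X]

lemma conn_e3_Y_e4 : conn M a p e3 Y (e4 M a p)
    = -(2 * a ^ 2 * cosθ p / Sig a p * (Y 3 / rad p))
      + 2 * a * rad p / Sig a p * (X 3 / rad p) := by
  rw [h.rotate.conn_e3_X_e4 hM ha hp, Pi.neg_apply]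
  ring

lemma trChiBar_eq : trChiBar M a p = -(2 * rad p / Sig a p) := by
  rw [trChiBar, chiBar, h.hTr_secondForm ha (uniqueDiffWithinAt_exterior hM hp)
    (differentiableWithinAt_e3 hM hp), h.conn_e3_X_X hM ha hp, h.conn_e3_Y_Y hM ha hp]
  ring

lemma atrChiBar_eq : atrChiBar M a p = 2 * a * cosθ p / Sig a p := by
  rw [atrChiBar, chiBar, h.hAtr_secondForm ha (uniqueDiffWithinAt_exterior hM hp)
    (differentiableWithinAt_e3 hM hp), h.conn_e3_X_Y hM ha hp, h.conn_e3_Y_X hM ha hp]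
  ring

end IsFrame

/-- The real part of `(r + i a cos θ)²`. -/
def reSq (a : ℝ) (p : Point) : ℝ := rad p ^ 2 - a ^ 2 * cosθ p ^ 2

/-- The imaginary part of `(r + i a cos θ)²`. -/
def imSq (a : ℝ) (p : Point) : ℝ := 2 * a * rad p * cosθ p

lemma reSq_sq_add_imSq_sq (a : ℝ) (p : Point) : reSq a p ^ 2 + imSq a p ^ 2 = Sig a p ^ 2 := by
  rw [reSq, imSq, Sig]
  ring

lemma hasFDerivAt_reSq (hr : 0 < rad p) : HasFDerivAt (reSq a)
    (covector ((2 * rad p) • dr p - (2 * a ^ 2 * cosθ p) • dcos p)) p := by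
  refine (((hasFDerivAt_rad hr).pow 2).sub
    (((hasFDerivAt_cosθ hr).pow 2).const_mul (a ^ 2))).congr_fderiv ?_
  ext Z
  simp only [covector_apply, sub_dotProduct, smul_dotProduct]
  simp only [Nat.add_one_sub_one, pow_one, nsmul_eq_mul, Nat.cast_ofNat, sub_apply, smul_apply,
    covector_apply, smul_eq_mul]
  ring

lemma hasFDerivAt_imSq (hr : 0 < rad p) : HasFDerivAt (imSq a)
    (covector ((2 * a * cosθ p) • dr p + (2 * a * rad p) • dcos p)) p := by
  refine (((hasFDerivAt_rad hr).const_mul (2 * a)).mul (hasFDerivAt_cosθ hr)).congr_fderiv ?_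
  ext Z
  simp only [covector_apply, add_dotProduct, smul_dotProduct]
  simp only [add_apply, smul_apply, covector_apply, smul_eq_mul]
  ring

section Exterior

variable (hM : 0 < M) (hp : p ∈ exterior M a)
include hM hp

lemma der_reSq (Z : Fin 4 → ℝ) : der M a p (reSq a) Z
    = 2 * rad p * (dr p ⬝ᵥ Z) - 2 * a ^ 2 * cosθ p * (dcos p ⬝ᵥ Z) := by
  rw [der_of_hasFDerivAt (uniqueDiffWithinAt_exterior hM hp) Z (hasFDerivAt_reSq (rad_pos hM hp)),
    covector_apply, sub_dotProduct, smul_dotProduct, smul_dotProduct, smul_eq_mul, smul_eq_mul]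

lemma der_imSq (Z : Fin 4 → ℝ) : der M a p (imSq a) Z
    = 2 * a * cosθ p * (dr p ⬝ᵥ Z) + 2 * a * rad p * (dcos p ⬝ᵥ Z) := by
  rw [der_of_hasFDerivAt (uniqueDiffWithinAt_exterior hM hp) Z (hasFDerivAt_imSq (rad_pos hM hp)),
    covector_apply, add_dotProduct, smul_dotProduct, smul_dotProduct, smul_eq_mul, smul_eq_mul]

variable (ha : |a| ≤ M)
include ha

lemma trChiBar_sq_sub_atrChiBar_sq :
    1 / 4 * Sig a p * (trChiBar M a p ^ 2 - atrChiBar M a p ^ 2) = reSq a p / Sig a p := by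
  obtain ⟨X, Y, h⟩ := exists_isFrame a (rad_pos hM hp)
  have hS := h.Sig_ne_zero
  rw [h.trChiBar_eq hM ha hp, h.atrChiBar_eq hM ha hp, reSq]
  field_simp
  ring

lemma atrChiBar_mul_trChiBar :
    1 / 2 * Sig a p * (atrChiBar M a p * trChiBar M a p) = -(imSq a p / Sig a p) := by
  obtain ⟨X, Y, h⟩ := exists_isFrame a (rad_pos hM hp)
  have hS := h.Sig_ne_zero
  rw [h.trChiBar_eq hM ha hp, h.atrChiBar_eq hM ha hp, imSq]
  field_simp

variable (hF : ∀ μ ν, DifferentiableWithinAt ℝ (fun q => F q μ ν) (exterior M a) p)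
  (Z : Fin 4 → ℝ)
include hF

lemma der_rhoHat : der M a p (rhoHat M a F) Z
    = reSq a p * der M a p (rho M a F) Z - imSq a p * der M a p (sigma M a F) Z
      + (rho M a F p * der M a p (reSq a) Z - sigma M a F p * der M a p (imSq a) Z) := by
  have hu := uniqueDiffWithinAt_exterior hM hp
  have hre := (hasFDerivAt_reSq (a := a) (rad_pos hM hp)).differentiableAt.differentiableWithinAt
    (s := exterior M a)
  have him := (hasFDerivAt_imSq (a := a) (rad_pos hM hp)).differentiableAt.differentiableWithinAt
    (s := exterior M a)
  have hρ := differentiableWithinAt_rho hM hp hF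
  have hσ := differentiableWithinAt_sigma hM hp ha hF
  refine (der_sub hu Z (hre.fun_mul hρ) (him.fun_mul hσ)).trans ?_
  rw [der_mul hu Z hre hρ, der_mul hu Z him hσ]
  ring

lemma der_sigmaHat : der M a p (sigmaHat M a F) Z
    = imSq a p * der M a p (rho M a F) Z + reSq a p * der M a p (sigma M a F) Z
      + (rho M a F p * der M a p (imSq a) Z + sigma M a F p * der M a p (reSq a) Z) := by
  have hu := uniqueDiffWithinAt_exterior hM hp
  have hre := (hasFDerivAt_reSq (a := a) (rad_pos hM hp)).differentiableAt.differentiableWithinAt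
    (s := exterior M a)
  have him := (hasFDerivAt_imSq (a := a) (rad_pos hM hp)).differentiableAt.differentiableWithinAt
    (s := exterior M a)
  have hρ := differentiableWithinAt_rho hM hp hF
  have hσ := differentiableWithinAt_sigma hM hp ha hF
  refine (der_add hu Z (him.fun_mul hρ) (hre.fun_mul hσ)).trans ?_
  rw [der_mul hu Z hre hσ, der_mul hu Z him hρ]
  ring

end Exterior

/-! ### The components of the Maxwell equations -/

namespace IsFrame

variable (h : IsFrame a p X Y)
include h

section Algebra

variable (ha : |a| ≤ M)
include ha

lemma dot_of_eq_smul_flat_add {s : Fin 4 → ℝ} {x y : ℝ}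
    (hs : s = x • flat M a p X + y • flat M a p Y) : s ⬝ᵥ X = x ∧ s ⬝ᵥ Y = y := by
  constructor
  · rw [hs, add_dotProduct, smul_dotProduct, smul_dotProduct, h.flat_X_dot_X ha,
      h.flat_Y_dot_X ha, smul_eq_mul, smul_eq_mul, mul_one, mul_zero, add_zero]
  · rw [hs, add_dotProduct, smul_dotProduct, smul_dotProduct, h.flat_X_dot_Y ha,
      h.flat_Y_dot_Y ha, smul_eq_mul, smul_eq_mul, mul_one, mul_zero, zero_add]

lemma hGrad_eq_iff {s t : Field₁} {A B : ℝ}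
    (hs : s p = (s p ⬝ᵥ X) • flat M a p X + (s p ⬝ᵥ Y) • flat M a p Y)
    (ht : t p = (t p ⬝ᵥ X) • flat M a p X + (t p ⬝ᵥ Y) • flat M a p Y) :
    (∀ ν, hGrad M a f p ν = A * (s p ν - t p ν) - B * (hStar M a s p ν + hStar M a t p ν)) ↔
      der M a p f X = A * (s p ⬝ᵥ X - t p ⬝ᵥ X) - B * (s p ⬝ᵥ Y + t p ⬝ᵥ Y) ∧
      der M a p f Y = A * (s p ⬝ᵥ Y - t p ⬝ᵥ Y) + B * (s p ⬝ᵥ X + t p ⬝ᵥ X) := by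
  rw [← h.smul_flat_add_inj ha, ← h.hGrad_eq ha, funext_iff]
  refine forall_congr' fun ν => ?_
  rw [h.hStar_eq ha, h.hStar_eq ha]
  have hsν := congrFun hs ν
  have htν := congrFun ht ν
  simp only [Pi.add_apply, Pi.sub_apply, Pi.smul_apply, smul_eq_mul] at hsν htν ⊢
  rw [← sub_eq_zero, ← sub_eq_zero (a := hGrad M a f p ν)]
  refine Eq.congr_left ?_
  linear_combination A * (htν - hsν)

end Algebra

variable (hM : 0 < M) (ha : |a| ≤ M) (hp : p ∈ exterior M a)
include hM ha hp

section Form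

variable (hs : DifferentiableWithinAt ℝ s (exterior M a) p)
include hs

lemma hDiv_smul (hf : DifferentiableWithinAt ℝ f (exterior M a) p) :
    hDiv M a (fun q => f q • s q) p = f p * hDiv M a s p
      + (der M a p f X * (s p ⬝ᵥ X) + der M a p f Y * (s p ⬝ᵥ Y)) := by
  have hu := uniqueDiffWithinAt_exterior hM hp
  rw [h.hDiv_eq ha hu (hf.fun_smul hs), cov₁_smul hu hf hs, cov₁_smul hu hf hs,
    h.hDiv_eq ha hu hs]
  ring

lemma hCurl_smul (hf : DifferentiableWithinAt ℝ f (exterior M a) p) :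
    hCurl M a (fun q => f q • s q) p = f p * hCurl M a s p
      + (der M a p f X * (s p ⬝ᵥ Y) - der M a p f Y * (s p ⬝ᵥ X)) := by
  have hu := uniqueDiffWithinAt_exterior hM hp
  rw [h.hCurl_eq ha hu (hf.fun_smul hs), cov₁_smul hu hf hs, cov₁_smul hu hf hs,
    h.hCurl_eq ha hu hs]
  ring

lemma frakT_dot_X : frakT M a s p ⬝ᵥ X = 1 / 2 * Sig a p * cov₁ M a p s (e3 p) X
    - 1 / 2 * (rad p * (s p ⬝ᵥ X) - a * cosθ p * (s p ⬝ᵥ Y)) := by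
  have hS := h.Sig_ne_zero
  rw [(h.dot_of_eq_smul_flat_add ha (h.frakT_eq ha hM hp hs)).1, h.conn_e3_X_X hM ha hp,
    h.conn_e3_X_Y hM ha hp]
  field_simp
  ring

lemma frakT_expand : frakT M a s p
    = (frakT M a s p ⬝ᵥ X) • flat M a p X + (frakT M a s p ⬝ᵥ Y) • flat M a p Y := by
  obtain ⟨hX, hY⟩ := h.dot_of_eq_smul_flat_add ha (h.frakT_eq ha hM hp hs)
  rw [hX, hY, ← h.frakT_eq ha hM hp hs]

variable (h3 : s p ⬝ᵥ e3 p = 0) (h4 : s p ⬝ᵥ e4 M a p = 0)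
include h3 h4

lemma frakTBar_dot_X : frakTBar M a s p ⬝ᵥ X = 1 / 2 * Sig a p * cov₁ M a p s (e4 M a p) X
    + 1 / 2 * quot M a p * (rad p * (s p ⬝ᵥ X) + a * cosθ p * (s p ⬝ᵥ Y))
    + 1 / 2 * Sig a p * quotR M a p * (s p ⬝ᵥ X) := by
  have hS := h.Sig_ne_zero
  rw [(h.dot_of_eq_smul_flat_add ha (h.frakTBar_eq ha hM hp hs h3 h4)).1, h.conn_e4_X_X hM ha hp,
    h.conn_e4_X_Y hM ha hp]
  field_simp
  ring

lemma frakTBar_expand : frakTBar M a s p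
    = (frakTBar M a s p ⬝ᵥ X) • flat M a p X + (frakTBar M a s p ⬝ᵥ Y) • flat M a p Y := by
  obtain ⟨hX, hY⟩ := h.dot_of_eq_smul_flat_add ha (h.frakTBar_eq ha hM hp hs h3 h4)
  rw [hX, hY, ← h.frakTBar_eq ha hM hp hs h3 h4]

end Form

variable (hF : ∀ μ ν, DifferentiableWithinAt ℝ (fun q => F q μ ν) (exterior M a) p)
  (hskew : ∀ q ∈ exterior M a, ∀ μ ν, F q μ ν = -F q ν μ)
include hF hskew

lemma extDer_e3_X_Y : extDer M a p F (e3 p) X Y = der M a p (sigma M a F) (e3 p)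
    + hCurl M a (alphaBar M a F) p
    + 2 * (a * cosθ p * rho M a F p - rad p * sigma M a F p) / Sig a p := by
  have hu := uniqueDiffWithinAt_exterior hM hp
  rw [extDer, cov₂_skew hskew hp hu Y, h.cov₂_XY hM ha hp hF hskew,
    h.cov₂_X_e3 hM ha hp hF hskew, h.rotate.cov₂_X_e3 hM ha hp hF hskew,
    h.hCurl_eq ha hu (differentiableWithinAt_alphaBar hM hp hF), conn_neg,
    conn_e3_along_e3 hM ha hp, conn_e3_along_e3 hM ha hp, h.isHor_X.conn_e4_e3 hM ha hp,
    h.isHor_Y.conn_e4_e3 hM ha hp, h.conn_e3_X_X hM ha hp, h.conn_e3_X_Y hM ha hp,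
    h.conn_e3_Y_X hM ha hp, h.conn_e3_Y_Y hM ha hp]
  ring

lemma divForm_e3 : divForm M a p F (e3 p) = der M a p (rho M a F) (e3 p)
    + hDiv M a (alphaBar M a F) p
    - 2 * (rad p * rho M a F p + a * cosθ p * sigma M a F p) / Sig a p := by
  have hu := uniqueDiffWithinAt_exterior hM hp
  rw [h.divForm_eq hM ha hp hF, cov₂_self hskew hp hu,
    cov₂_skew hskew hp hu (e3 p), h.cov₂_e3_e4 hM ha hp hF hskew,
    h.cov₂_X_e3 hM ha hp hF hskew, h.rotate.cov₂_X_e3 hM ha hp hF hskew,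
    h.hDiv_eq ha hu (differentiableWithinAt_alphaBar hM hp hF), conn_neg,
    conn_e3_along_e3 hM ha hp, conn_e3_along_e3 hM ha hp, h.isHor_X.conn_e4_e3 hM ha hp,
    h.isHor_Y.conn_e4_e3 hM ha hp, h.conn_e3_X_X hM ha hp, h.conn_e3_X_Y hM ha hp,
    h.conn_e3_Y_X hM ha hp, h.conn_e3_Y_Y hM ha hp]
  ring

lemma extDer_e4_X_Y : extDer M a p F (e4 M a p) X Y = der M a p (sigma M a F) (e4 M a p)
    + hCurl M a (fun q => Sig a q • alpha M a F q) p / Sig a p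
    - 2 * quot M a p * (a * cosθ p * rho M a F p - rad p * sigma M a F p) / Sig a p := by
  have hu := uniqueDiffWithinAt_exterior hM hp
  have hS := h.Sig_ne_zero
  have hα := differentiableWithinAt_alpha hM hp hF
  have hSig := (hasFDerivAt_Sig (a := a) h.rad_pos).differentiableAt.differentiableWithinAt
    (s := exterior M a)
  rw [extDer, cov₂_skew hskew hp hu Y, h.cov₂_XY hM ha hp hF hskew,
    h.cov₂_X_e4 hM ha hp hF hskew, h.rotate.cov₂_X_e4 hM ha hp hF hskew,
    h.hCurl_smul hM ha hp hα hSig, h.hCurl_eq ha hu hα, conn_neg,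
    der_Sig hM hp, der_Sig hM hp, h.isHor_X.dr_dot, h.isHor_Y.dr_dot, h.isHor_X.dcos_dot,
    h.isHor_Y.dcos_dot, h.isHor_X.conn_e3_e4 hM ha hp, h.isHor_Y.conn_e3_e4 hM ha hp,
    h.isHor_X.conn_e4_e4 hM ha hp, h.isHor_Y.conn_e4_e4 hM ha hp,
    h.conn_e3_X_e4 hM ha hp, h.conn_e3_Y_e4 hM ha hp, h.conn_e4_X_X hM ha hp,
    h.conn_e4_X_Y hM ha hp, h.conn_e4_Y_X hM ha hp, h.conn_e4_Y_Y hM ha hp]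
  field_simp
  ring

lemma divForm_e4 : divForm M a p F (e4 M a p) = -der M a p (rho M a F) (e4 M a p)
    + hDiv M a (fun q => Sig a q • alpha M a F q) p / Sig a p
    - 2 * quot M a p * (rad p * rho M a F p + a * cosθ p * sigma M a F p) / Sig a p := by
  have hu := uniqueDiffWithinAt_exterior hM hp
  have hS := h.Sig_ne_zero
  have hα := differentiableWithinAt_alpha hM hp hF
  have hSig := (hasFDerivAt_Sig (a := a) h.rad_pos).differentiableAt.differentiableWithinAt
    (s := exterior M a)
  rw [h.divForm_eq hM ha hp hF, cov₂_self hskew hp hu, h.cov₂_e3_e4 hM ha hp hF hskew,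
    h.cov₂_X_e4 hM ha hp hF hskew, h.rotate.cov₂_X_e4 hM ha hp hF hskew,
    h.hDiv_smul hM ha hp hα hSig, h.hDiv_eq ha hu hα, conn_neg,
    der_Sig hM hp, der_Sig hM hp, h.isHor_X.dr_dot, h.isHor_Y.dr_dot, h.isHor_X.dcos_dot,
    h.isHor_Y.dcos_dot, h.isHor_X.conn_e3_e4 hM ha hp, h.isHor_Y.conn_e3_e4 hM ha hp,
    h.isHor_X.conn_e4_e4 hM ha hp, h.isHor_Y.conn_e4_e4 hM ha hp,
    h.conn_e3_X_e4 hM ha hp, h.conn_e3_Y_e4 hM ha hp, h.conn_e4_X_X hM ha hp,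
    h.conn_e4_X_Y hM ha hp, h.conn_e4_Y_X hM ha hp, h.conn_e4_Y_Y hM ha hp]
  field_simp
  ring

lemma extDer_e3_e4_X : extDer M a p F (e3 p) (e4 M a p) X = 2 * der M a p (rho M a F) X
    - 2 * (frakT M a (alpha M a F) p ⬝ᵥ X - frakTBar M a (alphaBar M a F) p ⬝ᵥ X) / Sig a p
    + 4 * a * (a * cosθ p * rho M a F p - rad p * sigma M a F p) / Sig a p * (X 3 / rad p) := by
  have hu := uniqueDiffWithinAt_exterior hM hp
  have hS := h.Sig_ne_zero
  have hA := hskew p hp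
  rw [extDer, cov₂_skew hskew hp hu (e3 p), h.cov₂_X_e4 hM ha hp hF hskew,
    h.cov₂_X_e3 hM ha hp hF hskew, h.cov₂_e3_e4 hM ha hp hF hskew,
    h.frakT_dot_X hM ha hp (differentiableWithinAt_alpha hM hp hF),
    h.frakTBar_dot_X hM ha hp (differentiableWithinAt_alphaBar hM hp hF)
      (alphaBar_dot_e3 hA ha h.rad_pos) (alphaBar_dot_e4 hA ha h.rad_pos),
    conn_e3_along_e3 hM ha hp, h.isHor_X.conn_e4_e3 hM ha hp, h.isHor_Y.conn_e4_e3 hM ha hp,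
    h.isHor_X.conn_e3_e4 hM ha hp, h.isHor_Y.conn_e3_e4 hM ha hp, conn_e3_e4_e4 hM ha hp,
    h.conn_e3_X_e4 hM ha hp, h.conn_e3_Y_e4 hM ha hp, h.conn_e3_X_X hM ha hp,
    h.conn_e3_X_Y hM ha hp, h.conn_e4_X_X hM ha hp, h.conn_e4_X_Y hM ha hp]
  field_simp
  ring

lemma divForm_Y : divForm M a p F Y = der M a p (sigma M a F) X
    + (frakT M a (alpha M a F) p ⬝ᵥ Y + frakTBar M a (alphaBar M a F) p ⬝ᵥ Y) / Sig a p
    + 2 * a * (rad p * rho M a F p + a * cosθ p * sigma M a F p) / Sig a p * (X 3 / rad p) := by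
  have hu := uniqueDiffWithinAt_exterior hM hp
  have hS := h.Sig_ne_zero
  have hA := hskew p hp
  rw [h.divForm_eq hM ha hp hF, cov₂_self hskew hp hu, cov₂_skew hskew hp hu (e3 p),
    cov₂_skew hskew hp hu (e4 M a p), h.cov₂_XY hM ha hp hF hskew,
    h.rotate.cov₂_X_e3 hM ha hp hF hskew, h.rotate.cov₂_X_e4 hM ha hp hF hskew,
    h.rotate.frakT_dot_X hM ha hp (differentiableWithinAt_alpha hM hp hF),
    h.rotate.frakTBar_dot_X hM ha hp (differentiableWithinAt_alphaBar hM hp hF)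
      (alphaBar_dot_e3 hA ha h.rad_pos) (alphaBar_dot_e4 hA ha h.rad_pos),
    conn_neg, conn_neg, dotProduct_neg, dotProduct_neg,
    conn_e3_along_e3 hM ha hp, conn_e3_e4_e4 hM ha hp,
    h.isHor_X.conn_e4_e3 hM ha hp, h.isHor_Y.conn_e4_e3 hM ha hp,
    h.isHor_X.conn_e3_e4 hM ha hp, h.isHor_Y.conn_e3_e4 hM ha hp,
    h.conn_e3_X_e4 hM ha hp, h.conn_e3_Y_e4 hM ha hp, h.conn_e3_X_X hM ha hp,
    h.conn_e3_X_Y hM ha hp, h.conn_e4_X_X hM ha hp, h.conn_e4_X_Y hM ha hp]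
  field_simp
  ring

end IsFrame

/-! ### The modified Maxwell equations -/

section Exterior

variable (hM : 0 < M) (hp : p ∈ exterior M a) (ha : |a| ≤ M)
include hM hp ha

lemma rhoHat_eq (F : Field₂) : rhoHat M a F p =
    1 / 4 * Sig a p * (trChiBar M a p ^ 2 - atrChiBar M a p ^ 2) * (Sig a p * rho M a F p)
      + 1 / 2 * Sig a p * (atrChiBar M a p * trChiBar M a p) * (Sig a p * sigma M a F p) := by
  have hS := (Sig_pos a (rad_pos hM hp)).ne'
  rw [trChiBar_sq_sub_atrChiBar_sq hM hp ha, atrChiBar_mul_trChiBar hM hp ha, rhoHat, reSq, imSq]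
  field_simp
  ring

lemma sigmaHat_eq (F : Field₂) : sigmaHat M a F p =
    -(1 / 2) * Sig a p * (atrChiBar M a p * trChiBar M a p) * (Sig a p * rho M a F p)
      + 1 / 4 * Sig a p * (trChiBar M a p ^ 2 - atrChiBar M a p ^ 2)
        * (Sig a p * sigma M a F p) := by
  have hS := (Sig_pos a (rad_pos hM hp)).ne'
  rw [neg_mul, neg_mul, trChiBar_sq_sub_atrChiBar_sq hM hp ha, atrChiBar_mul_trChiBar hM hp ha,
    sigmaHat, reSq, imSq]
  field_simp

end Exterior

lemma rotated_eq_iff {x y u v l₁ r₁ l₂ r₂ : ℝ} (h : x ^ 2 + y ^ 2 ≠ 0)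
    (h₁ : l₁ - r₁ = x * u + y * v) (h₂ : l₂ - r₂ = x * v - y * u) :
    l₁ = r₁ ∧ l₂ = r₂ ↔ u = 0 ∧ v = 0 := by
  rw [← sub_eq_zero, h₁, ← sub_eq_zero (a := l₂), h₂]
  refine ⟨fun ⟨e₁, e₂⟩ => ⟨?_, ?_⟩, fun ⟨hu, hv⟩ => by simp [hu, hv]⟩
  · exact (mul_eq_zero.1 (by linear_combination x * e₁ - y * e₂ :
      (x ^ 2 + y ^ 2) * u = 0)).resolve_left h
  · exact (mul_eq_zero.1 (by linear_combination y * e₁ + x * e₂ :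
      (x ^ 2 + y ^ 2) * v = 0)).resolve_left h

namespace IsFrame

variable (h : IsFrame a p X Y)
include h

lemma reSq_sq_add_imSq_sq_ne_zero : reSq a p ^ 2 + imSq a p ^ 2 ≠ 0 := by
  rw [reSq_sq_add_imSq_sq]
  exact pow_ne_zero 2 h.Sig_ne_zero

variable (hM : 0 < M) (ha : |a| ≤ M) (hp : p ∈ exterior M a)
  (hF : ∀ μ ν, DifferentiableWithinAt ℝ (fun q => F q μ ν) (exterior M a) p)
  (hskew : ∀ q ∈ exterior M a, ∀ μ ν, F q μ ν = -F q ν μ)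
include hM ha hp hF hskew

lemma e3_equations_iff :
    (der M a p (sigmaHat M a F) (e3 p)
        = -(imSq a p * hDiv M a (alphaBar M a F) p) - reSq a p * hCurl M a (alphaBar M a F) p ∧
      der M a p (rhoHat M a F) (e3 p)
        = -(reSq a p * hDiv M a (alphaBar M a F) p) + imSq a p * hCurl M a (alphaBar M a F) p) ↔
      extDer M a p F (e3 p) X Y = 0 ∧ divForm M a p F (e3 p) = 0 := by
  have hS := h.Sig_ne_zero
  rw [h.extDer_e3_X_Y hM ha hp hF hskew, h.divForm_e3 hM ha hp hF hskew]
  refine rotated_eq_iff h.reSq_sq_add_imSq_sq_ne_zero ?_ ?_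
  · rw [der_sigmaHat hM hp ha hF, der_reSq hM hp, der_imSq hM hp, dr_dot_e3 h.rad_pos,
      dcos_dot_e3 h.rad_pos, reSq, imSq]
    field_simp
    rw [Sig]
    ring
  · rw [der_rhoHat hM hp ha hF, der_reSq hM hp, der_imSq hM hp, dr_dot_e3 h.rad_pos,
      dcos_dot_e3 h.rad_pos, reSq, imSq]
    field_simp
    rw [Sig]
    ring

lemma e4_equations_iff :
    (der M a p (sigmaHat M a F) (e4 M a p)
        = imSq a p / Sig a p * hDiv M a (fun q => Sig a q • alpha M a F q) p
          - reSq a p / Sig a p * hCurl M a (fun q => Sig a q • alpha M a F q) p ∧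
      der M a p (rhoHat M a F) (e4 M a p)
        = reSq a p / Sig a p * hDiv M a (fun q => Sig a q • alpha M a F q) p
          + imSq a p / Sig a p * hCurl M a (fun q => Sig a q • alpha M a F q) p) ↔
      extDer M a p F (e4 M a p) X Y = 0 ∧ divForm M a p F (e4 M a p) = 0 := by
  have hS := h.Sig_ne_zero
  rw [← neg_eq_zero (a := divForm M a p F _), h.extDer_e4_X_Y hM ha hp hF hskew,
    h.divForm_e4 hM ha hp hF hskew]
  refine rotated_eq_iff h.reSq_sq_add_imSq_sq_ne_zero ?_ ?_
  · rw [der_sigmaHat hM hp ha hF, der_reSq hM hp, der_imSq hM hp, dr_dot_e4 h.rad_pos,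
      dcos_dot_e4 h.rad_pos, reSq, imSq]
    field_simp
    rw [Sig]
    ring
  · rw [der_rhoHat hM hp ha hF, der_reSq hM hp, der_imSq hM hp, dr_dot_e4 h.rad_pos,
      dcos_dot_e4 h.rad_pos, reSq, imSq]
    field_simp
    rw [Sig]
    ring

lemma X_equations_iff :
    (der M a p (sigmaHat M a F) X
        = imSq a p / Sig a p
            * (frakT M a (alpha M a F) p ⬝ᵥ X - frakTBar M a (alphaBar M a F) p ⬝ᵥ X)
          - reSq a p / Sig a p
            * (frakT M a (alpha M a F) p ⬝ᵥ Y + frakTBar M a (alphaBar M a F) p ⬝ᵥ Y) ∧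
      der M a p (rhoHat M a F) X
        = reSq a p / Sig a p
            * (frakT M a (alpha M a F) p ⬝ᵥ X - frakTBar M a (alphaBar M a F) p ⬝ᵥ X)
          + imSq a p / Sig a p
            * (frakT M a (alpha M a F) p ⬝ᵥ Y + frakTBar M a (alphaBar M a F) p ⬝ᵥ Y)) ↔
      extDer M a p F (e3 p) (e4 M a p) X = 0 ∧ divForm M a p F Y = 0 := by
  have hS := h.Sig_ne_zero
  have half_eq_zero : extDer M a p F (e3 p) (e4 M a p) X / 2 = 0
      ↔ extDer M a p F (e3 p) (e4 M a p) X = 0 := by simp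
  rw [and_comm (b := divForm M a p F Y = 0), ← half_eq_zero,
    h.extDer_e3_e4_X hM ha hp hF hskew, h.divForm_Y hM ha hp hF hskew]
  refine rotated_eq_iff h.reSq_sq_add_imSq_sq_ne_zero ?_ ?_
  · rw [der_sigmaHat hM hp ha hF, der_reSq hM hp, der_imSq hM hp, h.isHor_X.dr_dot,
      h.isHor_X.dcos_dot, reSq, imSq]
    field_simp
    rw [Sig]
    ring
  · rw [der_rhoHat hM hp ha hF, der_reSq hM hp, der_imSq hM hp, h.isHor_X.dr_dot,
      h.isHor_X.dcos_dot, reSq, imSq]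
    field_simp
    rw [Sig]
    ring

lemma hGrad_equations_iff :
    ((∀ ν, hGrad M a (sigmaHat M a F) p ν
        = imSq a p / Sig a p
            * (frakT M a (alpha M a F) p ν - frakTBar M a (alphaBar M a F) p ν)
          - reSq a p / Sig a p * (hStar M a (frakT M a (alpha M a F)) p ν
            + hStar M a (frakTBar M a (alphaBar M a F)) p ν)) ∧
      ∀ ν, hGrad M a (rhoHat M a F) p ν
        = reSq a p / Sig a p
            * (frakT M a (alpha M a F) p ν - frakTBar M a (alphaBar M a F) p ν)
          - -(imSq a p / Sig a p) * (hStar M a (frakT M a (alpha M a F)) p ν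
            + hStar M a (frakTBar M a (alphaBar M a F)) p ν)) ↔
      (extDer M a p F (e3 p) (e4 M a p) X = 0 ∧ divForm M a p F Y = 0) ∧
      extDer M a p F (e3 p) (e4 M a p) Y = 0 ∧ divForm M a p F X = 0 := by
  have hA := hskew p hp
  have hT := h.frakT_expand hM ha hp (differentiableWithinAt_alpha hM hp hF)
  have hTBar := h.frakTBar_expand hM ha hp (differentiableWithinAt_alphaBar hM hp hF)
    (alphaBar_dot_e3 hA ha h.rad_pos) (alphaBar_dot_e4 hA ha h.rad_pos)
  rw [h.hGrad_eq_iff ha hT hTBar, h.hGrad_eq_iff ha hT hTBar,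
    ← h.X_equations_iff hM ha hp hF hskew, ← neg_eq_zero (a := divForm M a p F X), ← divForm_neg,
    ← h.rotate.X_equations_iff hM ha hp hF hskew, and_and_and_comm]
  simp only [dotProduct_neg, neg_mul, neg_neg, ← neg_add, mul_neg, sub_eq_add_neg]

end IsFrame

/-- The six modified Maxwell equations of Proposition 3.3 at the point `p`: the transport equations
along `e₃` and `e₄`, and the horizontal gradients, of `σ̂` and `ρ̂`. -/
def ModifiedMaxwellAt (M a : ℝ) (F : Field₂) (p : Point) : Prop :=
  along M a e3 (sigmaHat M a F) p =
      1 / 2 * Sig a p ^ 2 * (atrChiBar M a p * trChiBar M a p) * hDiv M a (alphaBar M a F) p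
      - 1 / 4 * Sig a p ^ 2 * (trChiBar M a p ^ 2 - atrChiBar M a p ^ 2)
        * hCurl M a (alphaBar M a F) p ∧
  along M a e3 (rhoHat M a F) p =
      -(1 / 4) * Sig a p ^ 2 * (trChiBar M a p ^ 2 - atrChiBar M a p ^ 2)
        * hDiv M a (alphaBar M a F) p
      - 1 / 2 * Sig a p ^ 2 * (atrChiBar M a p * trChiBar M a p)
        * hCurl M a (alphaBar M a F) p ∧
  along M a (e4 M a) (sigmaHat M a F) p =
      -(1 / 2) * Sig a p * (atrChiBar M a p * trChiBar M a p)
        * hDiv M a (fun q => Sig a q • alpha M a F q) p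
      - 1 / 4 * Sig a p * (trChiBar M a p ^ 2 - atrChiBar M a p ^ 2)
        * hCurl M a (fun q => Sig a q • alpha M a F q) p ∧
  along M a (e4 M a) (rhoHat M a F) p =
      1 / 4 * Sig a p * (trChiBar M a p ^ 2 - atrChiBar M a p ^ 2)
        * hDiv M a (fun q => Sig a q • alpha M a F q) p
      - 1 / 2 * Sig a p * (atrChiBar M a p * trChiBar M a p)
        * hCurl M a (fun q => Sig a q • alpha M a F q) p ∧
  (∀ ν, hGrad M a (sigmaHat M a F) p ν =
      -(1 / 2) * Sig a p * (atrChiBar M a p * trChiBar M a p)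
        * (frakT M a (alpha M a F) p ν - frakTBar M a (alphaBar M a F) p ν)
      - 1 / 4 * Sig a p * (trChiBar M a p ^ 2 - atrChiBar M a p ^ 2)
        * (hStar M a (frakT M a (alpha M a F)) p ν
          + hStar M a (frakTBar M a (alphaBar M a F)) p ν)) ∧
  ∀ ν, hGrad M a (rhoHat M a F) p ν =
      1 / 4 * Sig a p * (trChiBar M a p ^ 2 - atrChiBar M a p ^ 2)
        * (frakT M a (alpha M a F) p ν - frakTBar M a (alphaBar M a F) p ν)
      - 1 / 2 * Sig a p * (atrChiBar M a p * trChiBar M a p)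
        * (hStar M a (frakT M a (alpha M a F)) p ν
          + hStar M a (frakTBar M a (alphaBar M a F)) p ν)

theorem maxwellAt_iff_modifiedMaxwellAt (hM : 0 < M) (ha : |a| ≤ M) (hp : p ∈ exterior M a)
    (hF : ∀ μ ν, DifferentiableWithinAt ℝ (fun q => F q μ ν) (exterior M a) p)
    (hskew : ∀ q ∈ exterior M a, ∀ μ ν, F q μ ν = -F q ν μ) :
    MaxwellAt M a F p ↔ ModifiedMaxwellAt M a F p := by
  obtain ⟨X, Y, h⟩ := exists_isFrame a (rad_pos hM hp)
  have hS := h.Sig_ne_zero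
  have hre := trChiBar_sq_sub_atrChiBar_sq hM hp ha
  have him := atrChiBar_mul_trChiBar hM hp ha
  have hre' : 1 / 4 * Sig a p ^ 2 * (trChiBar M a p ^ 2 - atrChiBar M a p ^ 2) = reSq a p := by
    linear_combination Sig a p * hre + mul_div_cancel₀ (reSq a p) hS
  have him' : 1 / 2 * Sig a p ^ 2 * (atrChiBar M a p * trChiBar M a p) = -imSq a p := by
    linear_combination Sig a p * him - mul_div_cancel₀ (imSq a p) hS
  rw [h.maxwellAt_iff hM ha hp hF hskew, ← h.hGrad_equations_iff hM ha hp hF hskew,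
    ← h.e3_equations_iff hM ha hp hF hskew, ← h.e4_equations_iff hM ha hp hF hskew]
  simp only [ModifiedMaxwellAt, along_eq_der, neg_mul, hre, him, hre', him', neg_neg,
    sub_neg_eq_add, and_assoc]

end Kerr

end

theorem proposition3p3_general {M a : ℝ} (hM : 0 < M) (ha : |a| ≤ M) {F : Field₂} {p : Point}
    (hp : p ∈ exterior M a)
    (hF : ∀ μ ν, DifferentiableWithinAt ℝ (fun q => F q μ ν) (exterior M a) p)
    (hskew : ∀ q ∈ exterior M a, ∀ μ ν, F q μ ν = -F q ν μ) :
    (rhoHat M a F p =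
        1 / 4 * Sig a p * (trChiBar M a p ^ 2 - atrChiBar M a p ^ 2) * (Sig a p * rho M a F p)
        + 1 / 2 * Sig a p * (atrChiBar M a p * trChiBar M a p) * (Sig a p * sigma M a F p) ∧
      sigmaHat M a F p =
        -(1 / 2) * Sig a p * (atrChiBar M a p * trChiBar M a p) * (Sig a p * rho M a F p)
        + 1 / 4 * Sig a p * (trChiBar M a p ^ 2 - atrChiBar M a p ^ 2)
          * (Sig a p * sigma M a F p)) ∧
    (MaxwellAt M a F p ↔ ModifiedMaxwellAt M a F p) :=
  ⟨⟨rhoHat_eq hM hp ha F, sigmaHat_eq hM hp ha F⟩,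
    maxwellAt_iff_modifiedMaxwellAt hM ha hp hF hskew⟩

theorem proposition3p3 (M a : ℝ) (hM : 0 < M) (ha : |a| ≤ M)
    (F : Field₂) (hF : IsTwoForm M a F) :
    (∀ p ∈ exterior M a,
      rhoHat M a F p =
          1 / 4 * Sig a p * (trChiBar M a p ^ 2 - atrChiBar M a p ^ 2) * (Sig a p * rho M a F p)
          + 1 / 2 * Sig a p * (atrChiBar M a p * trChiBar M a p) * (Sig a p * sigma M a F p) ∧
      sigmaHat M a F p =
          -(1 / 2) * Sig a p * (atrChiBar M a p * trChiBar M a p) * (Sig a p * rho M a F p)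
          + 1 / 4 * Sig a p * (trChiBar M a p ^ 2 - atrChiBar M a p ^ 2)
            * (Sig a p * sigma M a F p)) ∧
    (IsMaxwell M a F ↔ ∀ p ∈ exterior M a,
      along M a e3 (sigmaHat M a F) p =
          1 / 2 * Sig a p ^ 2 * (atrChiBar M a p * trChiBar M a p) * hDiv M a (alphaBar M a F) p
          - 1 / 4 * Sig a p ^ 2 * (trChiBar M a p ^ 2 - atrChiBar M a p ^ 2)
            * hCurl M a (alphaBar M a F) p ∧
      along M a e3 (rhoHat M a F) p =
          -(1 / 4) * Sig a p ^ 2 * (trChiBar M a p ^ 2 - atrChiBar M a p ^ 2)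
            * hDiv M a (alphaBar M a F) p
          - 1 / 2 * Sig a p ^ 2 * (atrChiBar M a p * trChiBar M a p)
            * hCurl M a (alphaBar M a F) p ∧
      along M a (e4 M a) (sigmaHat M a F) p =
          -(1 / 2) * Sig a p * (atrChiBar M a p * trChiBar M a p)
            * hDiv M a (fun q ν => Sig a q * alpha M a F q ν) p
          - 1 / 4 * Sig a p * (trChiBar M a p ^ 2 - atrChiBar M a p ^ 2)
            * hCurl M a (fun q ν => Sig a q * alpha M a F q ν) p ∧
      along M a (e4 M a) (rhoHat M a F) p =
          1 / 4 * Sig a p * (trChiBar M a p ^ 2 - atrChiBar M a p ^ 2)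
            * hDiv M a (fun q ν => Sig a q * alpha M a F q ν) p
          - 1 / 2 * Sig a p * (atrChiBar M a p * trChiBar M a p)
            * hCurl M a (fun q ν => Sig a q * alpha M a F q ν) p ∧
      (∀ ν, hGrad M a (sigmaHat M a F) p ν =
          -(1 / 2) * Sig a p * (atrChiBar M a p * trChiBar M a p)
            * (frakT M a (alpha M a F) p ν - frakTBar M a (alphaBar M a F) p ν)
          - 1 / 4 * Sig a p * (trChiBar M a p ^ 2 - atrChiBar M a p ^ 2)
            * (hStar M a (frakT M a (alpha M a F)) p ν
              + hStar M a (frakTBar M a (alphaBar M a F)) p ν)) ∧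
      (∀ ν, hGrad M a (rhoHat M a F) p ν =
          1 / 4 * Sig a p * (trChiBar M a p ^ 2 - atrChiBar M a p ^ 2)
            * (frakT M a (alpha M a F) p ν - frakTBar M a (alphaBar M a F) p ν)
          - 1 / 2 * Sig a p * (atrChiBar M a p * trChiBar M a p)
            * (hStar M a (frakT M a (alpha M a F)) p ν
              + hStar M a (frakTBar M a (alphaBar M a F)) p ν))) :=
  have general (p) (hp : p ∈ exterior M a) := proposition3p3_general hM ha hp
    (fun μ ν => (hF.1 μ ν).differentiableOn (by simp) p hp) hF.2
  ⟨fun p hp => (general p hp).1, forall₂_congr fun p hp => (general p hp).2⟩
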